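/- Let $K$ be a field of characteristic $0$, let $M,p\ge 0$ be integers with $4(p+1)\le M$, and realize $\mathfrak g=so(M)$ as the Lie algebra of $M\times M$ matrices $A$ over $K$ with $A^{T}J+JA=0$, where $J_{ij}=\delta_{i,j'}$ and $i'=M+1-i$. Put $F_{ij}=e_{ij}-e_{j'i'}\in\mathfrak g$. For $0\le k\le p$ let $a=2k+1$, $b=2k+2$ and $$H^k_{1\pm2}=\tfrac12(F_{aa}\pm F_{bb}),\quad E^k_{1+2}=F_{ab'},\quad E^k_{1-2}=F_{ab},$$ $$I^{1\otimes2}_{M-4k}=\sum_{j=2k+3}^{M-2k-2}F_{aj}\otimes F_{jb'},\quad I^{1\wedge2}_{M-4k}=\sum_{j=2k+3}^{M-2k-2}F_{aj}\wedge F_{jb'},\quad I^{1}_{M-4k}=\tfrac12\sum_{j=2k+3}^{M-2k-2}F_{aj}F_{aj'},$$ with $x\wedge y=x\otimes y-y\otimes x$. (In terms of root vectors of $so(M-4k)$, $I^{1\otimes 2}_{M-4k}=\sum_{l}(E_{1+l}\otimes E_{2-l}+E_{1-l}\otimes E_{2+l})$ and $I^1_{M-4k}=\sum_{l}E_{1+l}E_{1-l}$,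 sums over $3\le l\le\lfloor M/2\rfloor-2k$, with the additional terms $E_1\otimes E_2$ and $\frac12E_1^2$ if $M$ is odd.) Let $h$ be a formal parameter and let $\eta_0,\xi_0,\eta_1,\xi_1,\dots\in K$ be arbitrary. In $U(\mathfrak g)[[h]]$ put $$\sigma^k_{1+2}=\ln(1+h\eta_kE^k_{1+2}),\qquad \sigma^k_G=\ln(1+G^{k+1}_{1-2}),\qquad G^{k+1}_{1-2}=h\eta_k\xi_k\,(E^k_{1-2}-h\eta_kI^1_{M-4k}),$$ and in $(U(\mathfrak g)\otimes U(\mathfrak g))[[h]]$ put $$\Phi^G_{J_k}=\exp(H^k_{1-2}\otimes\sigma^k_G),\quad \Phi_{E_k}=\exp\{h\eta_k\,I^{1\otimes2}_{M-4k}(1\otimes e^{-\frac12\sigma^k_{1+2}})\},\quad \Phi_{J_k}=\exp(H^k_{1+2}\otimes\sigma^k_{1+2}).$$ The full chain is $$\mathcal F_{\eta,\xi}=\prod_{k=p}^{0}\Phi^G_{J_k}\Phi_{E_k}\Phi_{J_k}$$ (the factor with $k=p$ on the left, the one with $k=0$ on the right), and $$r_{\eta,\xi}=\sum_{k=0}^{p}\eta_k\left(H^k_{1+2}\wedge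 E^k_{1+2}+\xi_kH^k_{1-2}\wedge E^k_{1-2}+I^{1\wedge2}_{M-4k}\right).$$ Then: (1) $\mathcal F=\mathcal F_{\eta,\xi}$ is a twisting element: it is invertible, $\mathcal F_{12}(\Delta\otimes\mathrm{id})\mathcal F=\mathcal F_{23}(\mathrm{id}\otimes\Delta)\mathcal F$ and $(\epsilon\otimes\mathrm{id})\mathcal F=(\mathrm{id}\otimes\epsilon)\mathcal F=1$, where $\Delta,\epsilon$ are the usual coproduct and counit of $U(\mathfrak g)$, extended coefficientwise. (2) $r_{\eta,\xi}$ is an antisymmetric solution of the classical Yang–Baxter equation. (3) $\mathcal R=\mathcal F_{21}\mathcal F^{-1}$ quantizes $r_{\eta,\xi}$ up to the sign convention: $U(\mathfrak g)[[h]]$ with the coproduct $\Delta_{\mathcal F}(x)=\mathcal F\Delta(x)\mathcal F^{-1}$ and the counit $\epsilon$ is a triangular bialgebra with universal R-matrix $\mathcal R$, i.e. $\Delta_{\mathcal F}$ is coassociative and counital, $\mathcal R\Delta_{\mathcal F}(x)=\Delta_{\mathcal F}^{op}(x)\mathcal R$, $(\Delta_{\mathcal F}\otimes\mathrm{id})\mathcal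 R=\mathcal R_{13}\mathcal R_{23}$, $(\mathrm{id}\otimes\Delta_{\mathcal F})\mathcal R=\mathcal R_{13}\mathcal R_{12}$, $\mathcal R_{21}\mathcal R=1$; moreover $\mathcal R$ satisfies the quantum Yang–Baxter equation $\mathcal R_{12}\mathcal R_{13}\mathcal R_{23}=\mathcal R_{23}\mathcal R_{13}\mathcal R_{12}$, and $\mathcal R=1\otimes1-h\,r_{\eta,\xi}+O(h^2)$. Replacing $\eta$ by $-\eta$, the R-matrix of $\mathcal F_{-\eta,\xi}$ has the same properties and equals $1\otimes1+h\,r_{\eta,\xi}+O(h^2)$. -/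

import Mathlib

open scoped TensorProduct

noncomputable section

namespace FullChain

attribute [local instance 100] LieRing.ofAssociativeRing

/-! ## Formal exponential and logarithm in `A[[h]]` -/

section FormalSeries

variable (K : Type*) [Field K] {A : Type*} [Ring A] [Algebra K A]

/-- `exp f = ∑ fᵐ / m!` for `f ∈ h A[[h]]`, where `A` need not be commutative.
The coefficient of `hⁿ` only receives contributions from `m ≤ n`, as `fᵐ` is divisible by `hᵐ`. -/
def fexp (f : PowerSeries A) : PowerSeries A :=
  PowerSeries.mk fun n =>
    ∑ m ∈ Finset.range (n + 1), ((m.factorial : K)⁻¹) • PowerSeries.coeff n (f ^ m)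

/-- `ln (1 + f) = ∑_{m ≥ 1} (-1)^(m+1) fᵐ / m` for `f ∈ h A[[h]]`. -/
def flog1p (f : PowerSeries A) : PowerSeries A :=
  PowerSeries.mk fun n =>
    ∑ m ∈ Finset.Icc 1 n, ((-1 : K) ^ (m + 1) / (m : K)) • PowerSeries.coeff n (f ^ m)

end FormalSeries

/-! ## The universal enveloping algebra, twists, R-matrices -/

section Twists

variable (K : Type*) [Field K] (L : Type*) [LieRing L] [LieAlgebra K L]

/-- `U(L)`. -/
abbrev U : Type _ := UniversalEnvelopingAlgebra K L

/-- `U(L) ⊗ U(L)`. -/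
abbrev U2 : Type _ := U K L ⊗[K] U K L

/-- `U(L) ⊗ U(L) ⊗ U(L)`. -/
abbrev U3 : Type _ := U2 K L ⊗[K] U K L

/-- The canonical map `L → U(L)`. -/
abbrev inc : L →ₗ⁅K⁆ U K L := UniversalEnvelopingAlgebra.ι K

/-- The undeformed coproduct of `U(L)`, `Δ x = x ⊗ 1 + 1 ⊗ x` for `x ∈ L`. -/
def comul : U K L →ₐ[K] U2 K L :=
  UniversalEnvelopingAlgebra.lift K
    { toFun := fun x => inc K L x ⊗ₜ[K] 1 + 1 ⊗ₜ[K] inc K L x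
      map_add' := by
        intro x y
        simp only [map_add, TensorProduct.add_tmul, TensorProduct.tmul_add]
        abel
      map_smul' := by
        intro c x
        simp only [map_smul, TensorProduct.smul_tmul', TensorProduct.tmul_smul, smul_add,
          RingHom.id_apply]
      map_lie' := by
        intro x y
        simp only [LieHom.map_lie, LieRing.of_associative_ring_bracket, mul_add, add_mul,
          Algebra.TensorProduct.tmul_mul_tmul, mul_one, one_mul, TensorProduct.sub_tmul,
          TensorProduct.tmul_sub]
        abel }

/-- The counit of `U(L)`, `ε x = 0` for `x ∈ L`. -/
def counit : U K L →ₐ[K] K :=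
  UniversalEnvelopingAlgebra.lift K 0

/-- `a ⊗ b ↦ b ⊗ a`. -/
def flip : U2 K L →ₐ[K] U2 K L :=
  (Algebra.TensorProduct.comm K (U K L) (U K L)).toAlgHom

/-- `a ⊗ b ↦ a ⊗ b ⊗ 1`. -/
def leg12 : U2 K L →ₐ[K] U3 K L := Algebra.TensorProduct.includeLeft

/-- `a ⊗ b ↦ a ⊗ 1 ⊗ b`. -/
def leg13 : U2 K L →ₐ[K] U3 K L :=
  Algebra.TensorProduct.map Algebra.TensorProduct.includeLeft (AlgHom.id K (U K L))

/-- `a ⊗ b ↦ 1 ⊗ a ⊗ b`. -/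
def leg23 : U2 K L →ₐ[K] U3 K L :=
  Algebra.TensorProduct.map Algebra.TensorProduct.includeRight (AlgHom.id K (U K L))

/-- `Δ ⊗ id`. -/
def comulId : U2 K L →ₐ[K] U3 K L :=
  Algebra.TensorProduct.map (comul K L) (AlgHom.id K (U K L))

/-- `id ⊗ Δ`. -/
def idComul : U2 K L →ₐ[K] U3 K L :=
  (Algebra.TensorProduct.assoc K K K (U K L) (U K L) (U K L)).symm.toAlgHom.comp
    (Algebra.TensorProduct.map (AlgHom.id K (U K L)) (comul K L))

/-- `ε ⊗ id`. -/
def counitId : U2 K L →ₐ[K] U K L :=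
  (Algebra.TensorProduct.lid K (U K L)).toAlgHom.comp
    (Algebra.TensorProduct.map (counit K L) (AlgHom.id K (U K L)))

/-- `id ⊗ ε`. -/
def idCounit : U2 K L →ₐ[K] U K L :=
  (Algebra.TensorProduct.rid K K (U K L)).toAlgHom.comp
    (Algebra.TensorProduct.map (AlgHom.id K (U K L)) (counit K L))

variable {K L}

/-- The coefficientwise extension `A[[h]] → B[[h]]` of an algebra homomorphism `A → B`. -/
abbrev ext {A B : Type*} [Ring A] [Algebra K A] [Ring B] [Algebra K B] (f : A →ₐ[K] B) :
    PowerSeries A →+* PowerSeries B :=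
  PowerSeries.map (f : A →+* B)

/-- `F ∈ (U(L) ⊗ U(L))[[h]]` is a twisting element: it is invertible and satisfies the
twist equations. -/
structure IsTwist (F : PowerSeries (U2 K L)) : Prop where
  isUnit : IsUnit F
  cocycle :
    ext (leg12 K L) F * ext (comulId K L) F = ext (leg23 K L) F * ext (idComul K L) F
  counit_left : ext (counitId K L) F = 1
  counit_right : ext (idCounit K L) F = 1

/-- The twisted coproduct `Δ_F(x) = F Δ(x) F⁻¹` on `U(L)[[h]]`. -/
def twistedComul (F : PowerSeries (U2 K L)) (x : PowerSeries (U K L)) : PowerSeries (U2 K L) :=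
  F * ext (comul K L) x * Ring.inverse F

/-- `Δ_F ⊗ id`. -/
def twistedComulId (F : PowerSeries (U2 K L)) (y : PowerSeries (U2 K L)) :
    PowerSeries (U3 K L) :=
  ext (leg12 K L) F * ext (comulId K L) y * ext (leg12 K L) (Ring.inverse F)

/-- `id ⊗ Δ_F`. -/
def idTwistedComul (F : PowerSeries (U2 K L)) (y : PowerSeries (U2 K L)) :
    PowerSeries (U3 K L) :=
  ext (leg23 K L) F * ext (idComul K L) y * ext (leg23 K L) (Ring.inverse F)

/-- The R-matrix `R_F = F₂₁ F⁻¹`. -/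
def rMatrix (F : PowerSeries (U2 K L)) : PowerSeries (U2 K L) :=
  ext (flip K L) F * Ring.inverse F

/-- The image in `U(L) ⊗ U(L)` of a tensor `r ∈ L ⊗ L`. -/
def tensorInc (r : L ⊗[K] L) : U2 K L :=
  TensorProduct.map (inc K L : L →ₗ[K] U K L) (inc K L : L →ₗ[K] U K L) r

/-- `r ∈ L ⊗ L` is a (triangular) classical r-matrix: it is antisymmetric and solves the
classical Yang-Baxter equation `[r₁₂, r₁₃] + [r₁₂, r₂₃] + [r₁₃, r₂₃] = 0`. -/
structure IsClassicalRMatrix (r : L ⊗[K] L) : Prop where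
  antisymm : TensorProduct.comm K L L r = -r
  cybe :
    ⁅leg12 K L (tensorInc r), leg13 K L (tensorInc r)⁆ +
      ⁅leg12 K L (tensorInc r), leg23 K L (tensorInc r)⁆ +
      ⁅leg13 K L (tensorInc r), leg23 K L (tensorInc r)⁆ = 0

/-- The R-matrix `R = F₂₁ F⁻¹` quantizes the classical r-matrix `r`: `U(L)[[h]]` with the twisted
coproduct `Δ_F` is a triangular bialgebra with universal R-matrix `R` (so that, in particular,
`R` solves the quantum Yang-Baxter equation), and `R = 1 ⊗ 1 + h r + O(h²)`. -/
structure RMatrixQuantizes (F : PowerSeries (U2 K L)) (r : L ⊗[K] L) : Prop where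
  coassoc : ∀ x : PowerSeries (U K L),
    twistedComulId F (twistedComul F x) = idTwistedComul F (twistedComul F x)
  counit_left : ∀ x : PowerSeries (U K L), ext (counitId K L) (twistedComul F x) = x
  counit_right : ∀ x : PowerSeries (U K L), ext (idCounit K L) (twistedComul F x) = x
  intertwines : ∀ x : PowerSeries (U K L),
    rMatrix F * twistedComul F x = ext (flip K L) (twistedComul F x) * rMatrix F
  hexagon_left :
    twistedComulId F (rMatrix F) = ext (leg13 K L) (rMatrix F) * ext (leg23 K L) (rMatrix F)
  hexagon_right :
    idTwistedComul F (rMatrix F) = ext (leg13 K L) (rMatrix F) * ext (leg12 K L) (rMatrix F)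
  triangular : ext (flip K L) (rMatrix F) * rMatrix F = 1
  qybe :
    ext (leg12 K L) (rMatrix F) * ext (leg13 K L) (rMatrix F) * ext (leg23 K L) (rMatrix F) =
      ext (leg23 K L) (rMatrix F) * ext (leg13 K L) (rMatrix F) * ext (leg12 K L) (rMatrix F)
  coeff_zero : PowerSeries.coeff 0 (rMatrix F) = 1
  coeff_one : PowerSeries.coeff 1 (rMatrix F) = tensorInc r

/-- `x ∧ y = x ⊗ y - y ⊗ x`. -/
def wedge (x y : L) : L ⊗[K] L := x ⊗ₜ[K] y - y ⊗ₜ[K] x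

end Twists

/-! ## The orthogonal Lie algebra and the generators of the chain

`so(M)` is realized in a basis `v_0, …, v_{M-1}` of the vector representation for which the
invariant form is `(v_i, v_j) = 1` if `i + j = M - 1` and `0` otherwise; write `i' = M - 1 - i`
(`Fin.rev`). The diagonal matrices form a Cartan subalgebra, `v_i` has weight `e_{i+1}` and `v_{i'}`
has weight `-e_{i+1}` for `i < ⌊M/2⌋`, and the middle vector (for odd `M`) has weight `0`. -/

section Orthogonal

variable (K : Type*) [Field K] (M : ℕ)

/-- The Gram matrix of the invariant form. -/
def gram : Matrix (Fin M) (Fin M) K := Matrix.of fun i j => if j = i.rev then 1 else 0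

/-- The (split) orthogonal Lie algebra `so(M)`: matrices `A` with `Aᵀ J + J A = 0`. -/
abbrev so : LieSubalgebra K (Matrix (Fin M) (Fin M) K) :=
  skewAdjointMatricesLieSubalgebra (gram K M)

variable {M}

/-- The generator `F_{ij} = e_{ij} - e_{j'i'}` of `so(M)`; its weight is the weight of `v_i` minus
the weight of `v_j`. -/
def gen (i j : Fin M) : so K M :=
  ⟨Matrix.single i j 1 - Matrix.single j.rev i.rev 1, by
    rw [mem_skewAdjointMatricesLieSubalgebra, mem_skewAdjointMatricesSubmodule]
    change Matrix.transpose _ * gram K M = gram K M * (-_)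
    ext a b
    have e1 : ∀ x y : Fin M, (x = y.rev) = (y = x.rev) := fun x y =>
      propext ⟨fun h => by rw [h, Fin.rev_rev], fun h => by rw [h, Fin.rev_rev]⟩
    have e2 : ∀ c : Fin M, (b = c.rev) = (c = b.rev) := fun c => e1 b c
    simp only [gram, Matrix.mul_apply, Matrix.transpose_apply, Matrix.neg_apply,
      Matrix.of_apply, e2, mul_ite, ite_mul, mul_one, one_mul, mul_zero, zero_mul,
      Finset.sum_ite_eq', Finset.mem_univ, if_true]
    simp only [Matrix.sub_apply, Matrix.single_apply, Fin.rev_inj, neg_sub, e1 i b,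
      e1 i a]
    congr 1 <;> congr 1 <;> apply propext <;> constructor <;> rintro ⟨rfl, rfl⟩ <;> simp⟩

variable {k : ℕ}

/-- The index `i` of the basis vector of weight `e_{2k+1}`; inside `so(M - 4k) ⊆ so(M)` this weight
plays the role of `e_1`. -/
def i1 (hk : 4 * (k + 1) ≤ M) : Fin M := ⟨2 * k, by omega⟩

/-- The index of the basis vector of weight `e_{2k+2}`, the `e_2` of `so(M - 4k)`. -/
def i2 (hk : 4 * (k + 1) ≤ M) : Fin M := ⟨2 * k + 1, by omega⟩

variable (M) in
/-- The indices of the basis vectors spanning the vector representation of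
`g_{k+1} = so(M - 4(k+1))`; their weights are `±e_l` with `l > 2k+2`, and `0` if `M` is odd. -/
def vecIdx (k : ℕ) : Finset (Fin M) :=
  Finset.univ.filter fun j => 2 * k + 2 ≤ (j : ℕ) ∧ (j : ℕ) + (2 * k + 2) < M

/-- `H_{1+2}^k`. -/
def Hplus (hk : 4 * (k + 1) ≤ M) : so K M :=
  (2⁻¹ : K) • (gen K (i1 hk) (i1 hk) + gen K (i2 hk) (i2 hk))

/-- `H_{1-2}^k`. -/
def Hminus (hk : 4 * (k + 1) ≤ M) : so K M :=
  (2⁻¹ : K) • (gen K (i1 hk) (i1 hk) - gen K (i2 hk) (i2 hk))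

/-- `E_{1+2}^k`. -/
def Eplus (hk : 4 * (k + 1) ≤ M) : so K M := gen K (i1 hk) (i2 hk).rev

/-- `E_{1-2}^k`. -/
def Eminus (hk : 4 * (k + 1) ≤ M) : so K M := gen K (i1 hk) (i2 hk)

/-- The root vector of weight `e_1 - wt(v_j)` in `so(M - 4k)`: this is `E_{1-l}` if `v_j` has weight
`e_l`, `E_{1+l}` if it has weight `-e_l`, and `E_1` if it has weight `0`. -/
def E1 (hk : 4 * (k + 1) ≤ M) (j : Fin M) : so K M := gen K (i1 hk) j

/-- The root vector of weight `e_2 + wt(v_j)` in `so(M - 4k)`: this is `E_{2+l}` if `v_j` has weight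
`e_l`, `E_{2-l}` if it has weight `-e_l`, and `E_2` if it has weight `0`. The normalization is such
that `[E_{1∓l}, E_{2±l}] = [E_1, E_2] = E_{1+2}`. -/
def E2 (hk : 4 * (k + 1) ≤ M) (j : Fin M) : so K M := gen K j (i2 hk).rev

/-- The invariant `I_{M-4k}^{1⊗2}`. Summing over all `j` gives
`∑_l (E_{1+l} ⊗ E_{2-l} + E_{1-l} ⊗ E_{2+l})`, and in addition `E_1 ⊗ E_2` if `M` is odd. -/
def I12 (hk : 4 * (k + 1) ≤ M) : U2 K (so K M) :=
  ∑ j ∈ vecIdx M k, inc K (so K M) (E1 K hk j) ⊗ₜ[K] inc K (so K M) (E2 K hk j)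

/-- The invariant `I_{M-4k}^1`. As `E_{1+l}` and `E_{1-l}` commute, summing over all `j` gives
`∑_l E_{1+l} E_{1-l}`, and in addition `E_1² / 2` if `M` is odd. -/
def I1 (hk : 4 * (k + 1) ≤ M) : U K (so K M) :=
  (2⁻¹ : K) •
    ∑ j ∈ vecIdx M k, inc K (so K M) (E1 K hk j) * inc K (so K M) (E1 K hk j.rev)

/-- `I_{M-4k}^{1∧2}`. -/
def I12wedge (hk : 4 * (k + 1) ≤ M) : so K M ⊗[K] so K M :=
  ∑ j ∈ vecIdx M k, wedge (K := K) (E1 K hk j) (E2 K hk j)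

end Orthogonal

/-! ## The full chain

The formal parameter enters through the rescaling `E_{1+2}^k ↦ h η_k E_{1+2}^k`,
`E_{1-2}^k ↦ h η_k ξ_k E_{1-2}^k` of the chain by the Cartan torus, under which
`I_{M-4k}^{1⊗2} ↦ h η_k I_{M-4k}^{1⊗2}` and `I_{M-4k}^1 ↦ (h η_k) (h η_k ξ_k) I_{M-4k}^1`. -/

section Chain

variable {K : Type*} [Field K] {M k : ℕ}

/-- `σ_{1+2}^k = ln (1 + h η E_{1+2}^k)`. -/
def sigma (hk : 4 * (k + 1) ≤ M) (η : K) : PowerSeries (U K (so K M)) :=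
  flog1p K (η • (PowerSeries.X * PowerSeries.C (inc K (so K M) (Eplus K hk))))

/-- The Jordanian factor `Φ_{J_k} = exp (H_{1+2}^k ⊗ σ_{1+2}^k)`. -/
def PhiJ (hk : 4 * (k + 1) ≤ M) (η : K) : PowerSeries (U2 K (so K M)) :=
  fexp K (PowerSeries.C (inc K (so K M) (Hplus K hk) ⊗ₜ[K] 1) *
    ext Algebra.TensorProduct.includeRight (sigma hk η))

/-- The extension factor `Φ_{E_k} = exp (h η I_{M-4k}^{1⊗2} (1 ⊗ exp (-σ_{1+2}^k / 2)))`. -/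
def PhiE (hk : 4 * (k + 1) ≤ M) (η : K) : PowerSeries (U2 K (so K M)) :=
  fexp K (η • (PowerSeries.X * PowerSeries.C (I12 K hk) *
    ext Algebra.TensorProduct.includeRight (fexp K (-(2⁻¹ : K) • sigma hk η))))

/-- The deformed generator `G_{1-2}^{k+1} = E_{1-2}^k - I_{M-4k}^1`; after the rescaling it reads
`h η ξ (E_{1-2}^k - h η I_{M-4k}^1)`. -/
def Gminus (hk : 4 * (k + 1) ≤ M) (η ξ : K) : PowerSeries (U K (so K M)) :=
  (η * ξ) • (PowerSeries.X * (PowerSeries.C (inc K (so K M) (Eminus K hk)) -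
    η • (PowerSeries.X * PowerSeries.C (I1 K hk))))

/-- The Jordanian factor on the deformed carrier space,
`Φ^G_{J_k} = exp (H_{1-2}^k ⊗ ln (1 + G_{1-2}^{k+1}))`. -/
def PhiG (hk : 4 * (k + 1) ≤ M) (η ξ : K) : PowerSeries (U2 K (so K M)) :=
  fexp K (PowerSeries.C (inc K (so K M) (Hminus K hk) ⊗ₜ[K] 1) *
    ext Algebra.TensorProduct.includeRight (flog1p K (Gminus hk η ξ)))

/-- The `k`-th link `Φ^G_{J_k} Φ_{E_k} Φ_{J_k}`. -/
def link (hk : 4 * (k + 1) ≤ M) (η ξ : K) : PowerSeries (U2 K (so K M)) :=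
  PhiG hk η ξ * PhiE hk η * PhiJ hk η

/-- The full chain `∏_{k=p}^0 Φ^G_{J_k} Φ_{E_k} Φ_{J_k}`, the factor with `k = p` standing on the
left and the one with `k = 0` on the right. -/
def chain : (p : ℕ) → 4 * (p + 1) ≤ M → (η ξ : ℕ → K) → PowerSeries (U2 K (so K M))
  | 0, h, η, ξ => link h (η 0) (ξ 0)
  | p + 1, h, η, ξ => link h (η (p + 1)) (ξ (p + 1)) * chain p (by omega) η ξ

/-- `r = ∑_{k=0}^p η_k (H_{1+2}^k ∧ E_{1+2}^k + ξ_k H_{1-2}^k ∧ E_{1-2}^k + I_{M-4k}^{1∧2})`. -/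
def classicalR (p : ℕ) (h : 4 * (p + 1) ≤ M) (η ξ : ℕ → K) : so K M ⊗[K] so K M :=
  ∑ k : Fin (p + 1),
    have hk : 4 * ((k : ℕ) + 1) ≤ M := by omega
    η k • (wedge (K := K) (Hplus K hk) (Eplus K hk) +
      ξ k • wedge (K := K) (Hminus K hk) (Eminus K hk) + I12wedge K hk)

end Chain

end FullChain

end

/-! Conventions: `F₁₂`, `F₁₃`, ... are images in the tensor cube, σ = ln(1 + x) and "primitive for
`Δ_F`" means Δ_F(x) = x ⊗ 1 + 1 ⊗ x.

The chain is assembled one exponential factor at a time. If `F` is a twist and `G` satisfies the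
twist equations with the coproduct `Δ_F` in place of `Δ`, then `G * F` is a twist
(`IsRelTwist.isTwist_mul`). So each factor only has to be checked against the coproduct twisted by
everything to its right, and it suffices to know that coproduct on the few elements the factor
involves.

Two kinds of factors occur. A Jordanian factor exp(H ⊗ ln(1 + x)) is a relative twist as soon as `H`
and `x` are primitive for `Δ_F` and [H, x] = x (`isRelTwist_jordanian`): it turns ln(1 + x) into a
primitive element. An extension factor exp(∑ eⱼ ⊗ fⱼ s) is a relative twist when the `e`'s commute
with each other, the `f`'s likewise, [eᵢ, fⱼ] = δᵢⱼ x with `x` commuting with all of them, s =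
exp(-σ/2), and the Jordanian factor has already given the `eⱼ`, `fⱼ` the coproduct y ⊗ exp(σ/2) + 1
⊗ y (`isRelTwist_extension`).

The delicate point is the second Jordanian factor of a link. After the extension E_{1-2} is no
longer primitive, because it does not commute with the E_{2±l}; the correction by the quadratic
element I¹ restores primitivity (`twistedComul_extension_mul_deformed`). Since H_{1-2} stays
primitive and acts on the corrected element with weight one, the Jordanian criterion applies again.

The induction along the chain rests on invariance: I^{1⊗2} and I¹ are invariants of so(M - 4(k+1)),
whose generators also commute with the Cartan elements and with E_{1±2} of the link `k`. Hence that
subalgebra remains primitive after the link `k` (`isPrimOn_link_mul`), and the next link starts from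
the same situation as the first one (`isTwist_chain`).

Everything about R = F₂₁ F⁻¹ then follows formally from the twist equations and the cocommutativity
of `Δ`. The coefficient of `h` in the chain is the sum of those of its links, and R has linear term
F₂₁ - F in order one, namely -r. The classical Yang-Baxter equation is the h² part of the quantum
one, so it needs no separate computation. -/

noncomputable section

namespace FullChain

attribute [local instance 100] LieRing.ofAssociativeRing

/-! ### Substituting a noncommutative series without constant term into scalar power series. -/

section Series

open PowerSeries

variable {K : Type*} [Field K] {A : Type*} [Ring A] [Algebra K A]

theorem coeff_pow_eq_zero {f : PowerSeries A} (hf : constantCoeff f = 0) {n m : ℕ} (h : n < m) :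
    coeff n (f ^ m) = 0 :=
  coeff_of_lt_order _ (lt_of_lt_of_le (by exact_mod_cast h)
    (le_order_pow_of_constantCoeff_eq_zero m hf))

theorem coeff_aeval_of_X_pow_dvd {f : PowerSeries A} (hf : constantCoeff f = 0) {n N : ℕ}
    (h : n < N) {P : Polynomial K} (hP : Polynomial.X ^ N ∣ P) :
    coeff n (Polynomial.aeval f P) = 0 := by
  obtain ⟨Q, rfl⟩ := hP
  rw [map_mul, map_pow, Polynomial.aeval_X, coeff_mul]
  refine Finset.sum_eq_zero fun x hx => ?_
  rw [coeff_pow_eq_zero hf, zero_mul]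
  have := Finset.HasAntidiagonal.mem_antidiagonal.1 hx
  omega

/-- The value `∑ pₘ fᵐ` of a scalar power series at `f ∈ h A[[h]]`. -/
def evalSeries (p : PowerSeries K) (f : PowerSeries A) : PowerSeries A :=
  PowerSeries.mk fun n => ∑ m ∈ Finset.range (n + 1), coeff m p • coeff n (f ^ m)

theorem aeval_trunc (p : PowerSeries K) (f : PowerSeries A) (N : ℕ) :
    Polynomial.aeval f (trunc N p) = ∑ m ∈ Finset.range N, coeff m p • f ^ m := by
  rw [Polynomial.aeval_def, eval₂_trunc_eq_sum_range]
  simp [Algebra.smul_def]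

theorem coeff_evalSeries {f : PowerSeries A} (hf : constantCoeff f = 0) (p : PowerSeries K)
    {n N : ℕ} (h : n < N) :
    coeff n (evalSeries p f) = coeff n (Polynomial.aeval f (trunc N p)) := by
  rw [aeval_trunc, evalSeries, coeff_mk, map_sum,
    ← Finset.sum_subset (Finset.range_mono (Nat.succ_le_of_lt h))]
  · rfl
  · intro m _ hm
    rw [coeff_smul, coeff_pow_eq_zero hf, smul_zero]
    simpa using hm

theorem evalSeries_coe {f : PowerSeries A} (hf : constantCoeff f = 0) (P : Polynomial K) :
    evalSeries (P : PowerSeries K) f = Polynomial.aeval f P := by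
  ext n
  rw [coeff_evalSeries hf _ (lt_of_le_of_lt (le_max_left n P.natDegree) (Nat.lt_succ_self _)),
    trunc_coe_eq_self (lt_of_le_of_lt (le_max_right n P.natDegree) (Nat.lt_succ_self _))]

/-- Up to order hⁿ only the truncations of `p` and `q` matter, and there evaluation is polynomial.
The truncation of the product differs from the product of the truncations by a multiple of X^(n+1),
which contributes nothing to hⁿ. -/
theorem evalSeries_mul {f : PowerSeries A} (hf : constantCoeff f = 0) (p q : PowerSeries K) :
    evalSeries (p * q) f = evalSeries p f * evalSeries q f := by
  ext n
  have h1 : coeff n (evalSeries p f * evalSeries q f) =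
      coeff n (Polynomial.aeval f (trunc (n + 1) p * trunc (n + 1) q)) := by
    rw [map_mul (Polynomial.aeval f), coeff_mul, coeff_mul]
    refine Finset.sum_congr rfl fun x hx => ?_
    have := Finset.HasAntidiagonal.mem_antidiagonal.1 hx
    rw [coeff_evalSeries hf p (N := n + 1) (by omega),
      coeff_evalSeries hf q (N := n + 1) (by omega)]
  rw [h1, coeff_evalSeries hf _ n.lt_succ_self, ← sub_eq_zero, ← map_sub, ← map_sub]
  refine coeff_aeval_of_X_pow_dvd hf n.lt_succ_self ?_
  rw [Polynomial.X_pow_dvd_iff]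
  intro d hd
  rw [Polynomial.coeff_sub, coeff_trunc, if_pos hd, coeff_mul_eq_coeff_trunc_mul_trunc _ _ hd,
    ← Polynomial.coe_mul, Polynomial.coeff_coe, sub_self]

/-- Evaluation of scalar power series at `f ∈ h A[[h]]`, as a homomorphism. -/
def evalHom {f : PowerSeries A} (hf : constantCoeff f = 0) : PowerSeries K →ₐ[K] PowerSeries A :=
  AlgHom.ofLinearMap
    { toFun := fun p => evalSeries p f
      map_add' := fun p q => by
        ext n
        simp [evalSeries, add_smul, Finset.sum_add_distrib]
      map_smul' := fun c p => by
        ext n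
        simp [evalSeries, mul_smul, Finset.smul_sum] }
    (by simpa using evalSeries_coe hf (1 : Polynomial K)) (evalSeries_mul hf)

theorem evalHom_apply {f : PowerSeries A} (hf : constantCoeff f = 0) (p : PowerSeries K) :
    evalHom hf p = evalSeries p f := rfl

theorem constantCoeff_evalSeries (p : PowerSeries K) (f : PowerSeries A) :
    constantCoeff (evalSeries p f) = algebraMap K A (constantCoeff p) := by
  rw [← coeff_zero_eq_constantCoeff_apply, evalSeries, coeff_mk]
  simp [Algebra.algebraMap_eq_smul_one]

/-- Evaluation at `f` is an algebra homomorphism out of K[[X]], so it commutes with polynomials.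
This reduces identities between exp and ln in the noncommutative algebra to identities in K[[X]]. -/
theorem evalSeries_evalSeries {f : PowerSeries A} (hf : constantCoeff f = 0) {p : PowerSeries K}
    (hp : constantCoeff p = 0) (q : PowerSeries K) :
    evalSeries q (evalSeries p f) = evalSeries (evalSeries q p) f := by
  ext n
  have h0 : constantCoeff (evalSeries p f) = 0 := by
    rw [constantCoeff_evalSeries, hp, map_zero]
  have ht : trunc (n + 1) (evalSeries q p) =
      trunc (n + 1) (Polynomial.aeval p (trunc (n + 1) q)) := by
    ext d
    rw [coeff_trunc, coeff_trunc]
    split_ifs with hd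
    · exact coeff_evalSeries hp q hd
    · rfl
  rw [coeff_evalSeries h0 q n.lt_succ_self, coeff_evalSeries hf _ n.lt_succ_self, ht,
    ← coeff_evalSeries hf _ n.lt_succ_self, ← evalHom_apply hf, ← evalHom_apply hf,
    ← Polynomial.aeval_algHom_apply (evalHom hf)]

theorem evalSeries_eq_subst {p : PowerSeries K} (hp : constantCoeff p = 0) (q : PowerSeries K) :
    evalSeries q p = q.subst p := by
  ext n
  rw [coeff_subst' (HasSubst.of_constantCoeff_zero' hp), evalSeries, coeff_mk,
    finsum_eq_sum_of_support_subset]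
  intro m hm
  by_contra h
  refine hm ?_
  change coeff m q • coeff n (p ^ m) = 0
  rw [coeff_pow_eq_zero hp, smul_zero]
  simpa using h

variable (K) in
theorem fexp_eq_evalSeries [CharZero K] (f : PowerSeries A) :
    fexp K f = evalSeries (PowerSeries.exp K) f := by
  ext n
  simp [fexp, evalSeries, coeff_exp]

variable (K) in
theorem flog1p_eq_evalSeries [CharZero K] (f : PowerSeries A) :
    flog1p K f = evalSeries (PowerSeries.log K) f := by
  ext n
  simp only [flog1p, evalSeries, coeff_mk, coeff_log]
  rw [Finset.range_eq_Ico, Finset.sum_eq_sum_Ico_succ_bot (Nat.succ_pos n)]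
  simp only [if_true, zero_smul, zero_add]
  refine Finset.sum_congr rfl fun m hm => ?_
  have : m ≠ 0 := by
    have := (Finset.mem_Icc.1 hm).1
    omega
  simp [this]

theorem derivative_log_mul [CharZero K] : d⁄dX K (PowerSeries.log K) * (1 + X) = 1 := by
  rw [deriv_log]
  ext n
  rcases n with _ | n
  · simp [mul_add]
  · simp [mul_add, coeff_succ_mul_X, coeff_one, pow_succ]

/-- The composite E satisfies E'(1 + X) = E and E(0) = 1. Comparing coefficients gives (n+1)Eₙ₊₁ +
nEₙ = Eₙ, hence E₁ = 1, E₂ = 0, and all later coefficients vanish in characteristic zero. -/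
theorem exp_subst_log [CharZero K] : (PowerSeries.exp K).subst (PowerSeries.log K) = 1 + X := by
  have hs : HasSubst (PowerSeries.log K) := HasSubst.log
  set E := (PowerSeries.exp K).subst (PowerSeries.log K) with hE
  have hd : d⁄dX K E = E * d⁄dX K (PowerSeries.log K) := by
    rw [hE, derivative_subst hs, derivative_exp]
  have hd' : d⁄dX K E * (1 + X) = E := by rw [hd, mul_assoc, derivative_log_mul, mul_one]
  have h0 : constantCoeff E = 1 := by
    rw [hE, ← evalSeries_eq_subst constantCoeff_log, constantCoeff_evalSeries]
    simp
  have hc : ∀ n, coeff (n + 1) E * (n + 1) + coeff n E * n = coeff n E := fun n => by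
    conv_rhs => rw [← hd']
    rcases n with _ | n
    · have := coeff_derivative E 0
      simp only [coeff_zero_eq_constantCoeff_apply] at this
      simp [mul_add, this]
    · simp [mul_add, coeff_derivative, coeff_succ_mul_X]
  have h1 : coeff 1 E = 1 := by
    have := hc 0
    simpa [h0] using this
  have h2 : ∀ n, coeff (n + 2) E = 0 := fun n => by
    induction n with
    | zero =>
      have := hc 1
      rw [h1] at this
      norm_num at this
      exact this
    | succ n ih =>
      have := hc (n + 2)
      rw [ih] at this
      simp only [zero_mul, add_zero] at this
      rcases mul_eq_zero.1 this with h | h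
      · exact h
      · exact absurd h (Nat.cast_add_one_ne_zero _)
  ext n
  rcases n with _ | _ | n
  · simp [h0]
  · simp [h1, coeff_one]
  · simp [h2, coeff_one, coeff_X]

/-- Both sides have constant term zero and derivative one: substituting exp - 1 into log'(X)(1 + X)
= 1 is exactly the chain rule for the left side. -/
theorem log_subst_exp_sub_one [CharZero K] :
    (PowerSeries.log K).subst (PowerSeries.exp K - 1) = X := by
  have hs : HasSubst (PowerSeries.exp K - 1) := HasSubst.exp_sub_one
  have h0 : constantCoeff (PowerSeries.exp K - 1) = 0 := by simp
  refine derivative.ext ?_ ?_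
  · have := congrArg (fun q => evalHom (K := K) h0 q) (derivative_log_mul (K := K))
    simp only [map_mul, map_add, map_one, evalHom_apply, evalSeries_eq_subst h0] at this
    rw [subst_X hs, add_sub_cancel] at this
    rw [derivative_subst hs, map_sub, derivative_exp, derivative_one, sub_zero, this,
      derivative_X]
  · rw [← evalSeries_eq_subst h0, constantCoeff_evalSeries]
    simp

variable [CharZero K]

variable (K) in
theorem fexp_flog1p {f : PowerSeries A} (hf : constantCoeff f = 0) :
    fexp K (flog1p K f) = 1 + f := by
  rw [fexp_eq_evalSeries, flog1p_eq_evalSeries, evalSeries_evalSeries hf constantCoeff_log,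
    evalSeries_eq_subst constantCoeff_log, exp_subst_log, ← evalHom_apply hf, map_add, map_one,
    evalHom_apply hf, ← Polynomial.coe_X, evalSeries_coe hf, Polynomial.aeval_X]

variable (K) in
theorem flog1p_fexp_sub_one {f : PowerSeries A} (hf : constantCoeff f = 0) :
    flog1p K (fexp K f - 1) = f := by
  have h0 : constantCoeff (PowerSeries.exp K - 1) = 0 := by simp
  have h1 : fexp K f - 1 = evalSeries (PowerSeries.exp K - 1) f := by
    rw [fexp_eq_evalSeries, ← evalHom_apply hf, ← evalHom_apply hf, map_sub, map_one]
  rw [h1, flog1p_eq_evalSeries, evalSeries_evalSeries hf h0, evalSeries_eq_subst h0,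
    log_subst_exp_sub_one, ← Polynomial.coe_X, evalSeries_coe hf, Polynomial.aeval_X]

end Series

/-! ### Exponential and logarithm under conjugation, on commuting sums, and the Hadamard formula. -/

section ExpLog

open PowerSeries

variable {K : Type*} [Field K] {A : Type*} [Ring A] [Algebra K A]
  {B : Type*} [Ring B] [Algebra K B]

theorem coeff_mul_evalSeries {f : PowerSeries A} (hf : constantCoeff f = 0) (p : PowerSeries K)
    (y : PowerSeries A) {n N : ℕ} (h : n < N) :
    coeff n (y * evalSeries p f) = coeff n (y * Polynomial.aeval f (trunc N p)) := by
  rw [coeff_mul, coeff_mul]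
  refine Finset.sum_congr rfl fun x hx => ?_
  have := Finset.HasAntidiagonal.mem_antidiagonal.1 hx
  rw [coeff_evalSeries hf p (N := N) (by omega)]

theorem coeff_evalSeries_mul {f : PowerSeries A} (hf : constantCoeff f = 0) (p : PowerSeries K)
    (y : PowerSeries A) {n N : ℕ} (h : n < N) :
    coeff n (evalSeries p f * y) = coeff n (Polynomial.aeval f (trunc N p) * y) := by
  rw [coeff_mul, coeff_mul]
  refine Finset.sum_congr rfl fun x hx => ?_
  have := Finset.HasAntidiagonal.mem_antidiagonal.1 hx
  rw [coeff_evalSeries hf p (N := N) (by omega)]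

/-- An intertwining relation y a = b y passes to powers, hence to series. Working with
semiconjugation instead of conjugation also covers intertwiners `y` that are not invertible, such as
those in `jordanian_mul_inl`. -/
theorem SemiconjBy.evalSeries {y a b : PowerSeries A} (h : SemiconjBy y a b)
    (ha : constantCoeff a = 0) (hb : constantCoeff b = 0) (p : PowerSeries K) :
    SemiconjBy y (evalSeries p a) (evalSeries p b) := by
  ext n
  rw [coeff_mul_evalSeries ha p y n.lt_succ_self, coeff_evalSeries_mul hb p y n.lt_succ_self,
    aeval_trunc, aeval_trunc, Finset.mul_sum, Finset.sum_mul]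
  congr 1
  refine Finset.sum_congr rfl fun m _ => ?_
  rw [mul_smul_comm, smul_mul_assoc, (h.pow_right m).eq]

theorem ext_evalSeries (φ : A →ₐ[K] B) (p : PowerSeries K) (f : PowerSeries A) :
    ext φ (evalSeries p f) = evalSeries p (ext φ f) := by
  ext n
  simp only [coeff_map, FullChain.evalSeries, coeff_mk, ← map_pow, RingHom.coe_coe, map_sum,
    map_smul]

theorem ext_smul (φ : A →ₐ[K] B) (c : K) (f : PowerSeries A) : ext φ (c • f) = c • ext φ f := by
  ext n
  simp

theorem constantCoeff_ext {f : PowerSeries A} (hf : constantCoeff f = 0) (φ : A →ₐ[K] B) :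
    constantCoeff (ext φ f) = 0 := by
  rw [← coeff_zero_eq_constantCoeff_apply] at hf ⊢
  rw [coeff_map, hf, map_zero]

theorem coeff_one_fexp (f : PowerSeries A) : coeff 1 (fexp K f) = coeff 1 f := by
  simp [fexp, Finset.sum_range_succ, coeff_one]

theorem coeff_one_flog1p (f : PowerSeries A) : coeff 1 (flog1p K f) = coeff 1 f := by
  simp [flog1p]

variable (K) in
theorem flog1p_zero : flog1p K (0 : PowerSeries A) = 0 := by
  ext n
  simp only [flog1p, coeff_mk, map_zero]
  refine Finset.sum_eq_zero fun m hm => ?_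
  have := (Finset.mem_Icc.1 hm).1
  rw [zero_pow (by omega), map_zero, smul_zero]

variable (K) in
theorem fexp_zero : fexp K (0 : PowerSeries A) = 1 := by
  ext n
  simp [fexp, Finset.sum_range_succ', coeff_one]

variable [CharZero K]

theorem SemiconjBy.fexp {y a b : PowerSeries A} (h : SemiconjBy y a b)
    (ha : constantCoeff a = 0) (hb : constantCoeff b = 0) :
    SemiconjBy y (fexp K a) (fexp K b) := by
  rw [fexp_eq_evalSeries, fexp_eq_evalSeries]
  exact FullChain.SemiconjBy.evalSeries h ha hb _

theorem SemiconjBy.flog1p {y a b : PowerSeries A} (h : SemiconjBy y a b)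
    (ha : constantCoeff a = 0) (hb : constantCoeff b = 0) :
    SemiconjBy y (flog1p K a) (flog1p K b) := by
  rw [flog1p_eq_evalSeries, flog1p_eq_evalSeries]
  exact FullChain.SemiconjBy.evalSeries h ha hb _

theorem ext_fexp (φ : A →ₐ[K] B) (f : PowerSeries A) : ext φ (fexp K f) = fexp K (ext φ f) := by
  rw [fexp_eq_evalSeries, fexp_eq_evalSeries, ext_evalSeries]

theorem ext_flog1p (φ : A →ₐ[K] B) (f : PowerSeries A) :
    ext φ (flog1p K f) = flog1p K (ext φ f) := by
  rw [flog1p_eq_evalSeries, flog1p_eq_evalSeries, ext_evalSeries]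

theorem constantCoeff_fexp (f : PowerSeries A) : constantCoeff (fexp K f) = 1 := by
  rw [fexp_eq_evalSeries, constantCoeff_evalSeries, constantCoeff_exp, map_one]

theorem constantCoeff_flog1p (f : PowerSeries A) : constantCoeff (flog1p K f) = 0 := by
  rw [flog1p_eq_evalSeries, constantCoeff_evalSeries, constantCoeff_log, map_zero]

variable (K) in
/-- The partial sums of the exponential series. -/
def expSum (f : PowerSeries A) (N : ℕ) : PowerSeries A :=
  ∑ m ∈ Finset.range N, (m.factorial : K)⁻¹ • f ^ m

theorem aeval_trunc_exp (f : PowerSeries A) (N : ℕ) :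
    Polynomial.aeval f (trunc N (PowerSeries.exp K)) = expSum K f N := by
  rw [aeval_trunc, expSum]
  simp [coeff_exp]

theorem coeff_mul_fexp {f : PowerSeries A} (hf : constantCoeff f = 0)
    (y : PowerSeries A) {n N : ℕ} (h : n < N) :
    coeff n (y * fexp K f) = coeff n (y * expSum K f N) := by
  rw [fexp_eq_evalSeries, coeff_mul_evalSeries hf _ y h, aeval_trunc_exp]

theorem coeff_fexp_mul {f : PowerSeries A} (hf : constantCoeff f = 0)
    (y : PowerSeries A) {n N : ℕ} (h : n < N) :
    coeff n (fexp K f * y) = coeff n (expSum K f N * y) := by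
  rw [fexp_eq_evalSeries, coeff_evalSeries_mul hf _ y h, aeval_trunc_exp]

theorem coeff_pow_mul_pow_eq_zero {u v : PowerSeries A} (hu : constantCoeff u = 0)
    (hv : constantCoeff v = 0) {n i j : ℕ} (h : n < i + j) : coeff n (u ^ i * v ^ j) = 0 := by
  rw [coeff_mul]
  refine Finset.sum_eq_zero fun x hx => ?_
  have := Finset.HasAntidiagonal.mem_antidiagonal.1 hx
  by_cases h1 : x.1 < i
  · rw [coeff_pow_eq_zero hu h1, zero_mul]
  · rw [coeff_pow_eq_zero hv (by omega : x.2 < j), mul_zero]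

variable (K) in
theorem fexp_add {u v : PowerSeries A} (huv : Commute u v) (hu : constantCoeff u = 0)
    (hv : constantCoeff v = 0) : fexp K (u + v) = fexp K u * fexp K v := by
  have huv0 : constantCoeff (u + v) = 0 := by rw [map_add, hu, hv, add_zero]
  ext n
  have h1 : coeff n (fexp K u * fexp K v) = coeff n (expSum K u (n + 1) * expSum K v (n + 1)) := by
    rw [coeff_mul_fexp hv _ n.lt_succ_self, coeff_fexp_mul hu _ n.lt_succ_self]
  have h2 : coeff n (fexp K (u + v)) = coeff n (expSum K (u + v) (n + 1)) := by
    have := coeff_mul_fexp (K := K) huv0 1 n.lt_succ_self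
    rwa [one_mul, one_mul] at this
  have h3 : expSum K (u + v) (n + 1) = ∑ m ∈ Finset.range (n + 1),
      ∑ x ∈ Finset.HasAntidiagonal.antidiagonal m, ((x.1.factorial : K)⁻¹ * (x.2.factorial : K)⁻¹) •
        (u ^ x.1 * v ^ x.2) := by
    refine Finset.sum_congr rfl fun m _ => ?_
    rw [huv.add_pow', Finset.smul_sum]
    refine Finset.sum_congr rfl fun x hx => ?_
    have hx := Finset.HasAntidiagonal.mem_antidiagonal.1 hx
    rw [← Nat.cast_smul_eq_nsmul K, smul_smul]
    congr 1
    have h : ((m.choose x.1 * x.1.factorial * x.2.factorial : ℕ) : K) = m.factorial := by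
      have := Nat.choose_mul_factorial_mul_factorial (Nat.le_add_right x.1 x.2)
      rw [Nat.add_sub_cancel_left] at this
      rw [← hx, this]
    push_cast at h
    have h1 : (x.1.factorial : K) ≠ 0 := by exact_mod_cast x.1.factorial_ne_zero
    have h2 : (x.2.factorial : K) ≠ 0 := by exact_mod_cast x.2.factorial_ne_zero
    have h3 : (m.factorial : K) ≠ 0 := by exact_mod_cast m.factorial_ne_zero
    field_simp
    linear_combination h
  rw [h1, h2, h3, expSum, expSum, Finset.sum_mul_sum, ← Finset.sum_product',
    Finset.sum_sigma', map_sum, map_sum]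
  -- The triangle of pairs with i + j ≤ n is embedded in the full square; the pairs left over have i
  -- + j > n and do not reach order hⁿ.
  refine Finset.sum_of_injOn (fun x => x.2) ?_ ?_ ?_ ?_
  · rintro ⟨m, i, j⟩ hx ⟨m', i', j'⟩ hx' h
    simp only [Finset.coe_sigma, Set.mem_sigma_iff, Finset.mem_coe,
      Finset.HasAntidiagonal.mem_antidiagonal]
      at hx hx'
    obtain ⟨rfl, rfl⟩ := Prod.mk.inj h
    obtain ⟨-, rfl⟩ := hx
    obtain ⟨-, rfl⟩ := hx'
    rfl
  · rintro ⟨m, i, j⟩ hx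
    simp only [Finset.coe_sigma, Set.mem_sigma_iff, Finset.mem_coe,
      Finset.HasAntidiagonal.mem_antidiagonal,
      Finset.mem_range, Finset.coe_product, Set.mem_prod] at hx ⊢
    omega
  · rintro ⟨i, j⟩ hx hx'
    rw [smul_mul_smul_comm, coeff_smul, coeff_pow_mul_pow_eq_zero hu hv, smul_zero]
    by_contra h
    refine hx' ⟨⟨i + j, i, j⟩, ?_, rfl⟩
    simp only [Finset.coe_sigma, Set.mem_sigma_iff, Finset.mem_coe,
      Finset.HasAntidiagonal.mem_antidiagonal,
      Finset.mem_range, and_true]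
    omega
  · rintro ⟨m, i, j⟩ hx
    rw [smul_mul_smul_comm]

variable (K) in
theorem fexp_mul_fexp_neg {u : PowerSeries A} (hu : constantCoeff u = 0) :
    fexp K u * fexp K (-u) = 1 := by
  rw [← fexp_add K (Commute.neg_right (Commute.refl u)) hu (by rw [map_neg, hu, neg_zero]),
    add_neg_cancel, fexp_zero]

variable (K) in
theorem isUnit_fexp {u : PowerSeries A} (hu : constantCoeff u = 0) : IsUnit (fexp K u) :=
  ⟨⟨fexp K u, fexp K (-u), fexp_mul_fexp_neg K hu, by
    have := fexp_mul_fexp_neg K (u := -u) (by rw [map_neg, hu, neg_zero])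
    rwa [neg_neg] at this⟩, rfl⟩

variable (K) in
-- Write 1 + x and 1 + y as exponentials of their logarithms; these commute, so the exponents add,
-- and the logarithm undoes the exponential.
theorem flog1p_mul {x y : PowerSeries A} (hxy : Commute x y) (hx : constantCoeff x = 0)
    (hy : constantCoeff y = 0) :
    flog1p K ((1 + x) * (1 + y) - 1) = flog1p K x + flog1p K y := by
  have h1 : Commute (flog1p K x) y :=
    Commute.symm (FullChain.SemiconjBy.flog1p hxy.symm hx hx)
  have h2 : Commute (flog1p K x) (flog1p K y) := FullChain.SemiconjBy.flog1p h1 hy hy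
  rw [← fexp_flog1p K hx, ← fexp_flog1p K hy,
    ← fexp_add K h2 (constantCoeff_flog1p _) (constantCoeff_flog1p _), flog1p_fexp_sub_one]
  rw [map_add, constantCoeff_flog1p, constantCoeff_flog1p, add_zero]

theorem mul_inv_factorial_smul_pow (u : PowerSeries A) (m : ℕ) :
    u * ((m.factorial : K)⁻¹ • u ^ m) =
      ((m : K) + 1) • (((m + 1).factorial : K)⁻¹ • u ^ (m + 1)) := by
  have h1 : (m : K) + 1 ≠ 0 := Nat.cast_add_one_ne_zero m
  rw [mul_smul_comm, ← pow_succ', smul_smul, Nat.factorial_succ]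
  congr 1
  push_cast
  field_simp

/-- With divided powers u^(n) = uⁿ/n!, this moves u^(m+2) past `y` when v = [u, y], w = [u, v] and
[u, w] = 0. Only three terms survive since ad u cubed kills `y`; the induction uses u u^(n) = (n+1)
u^(n+1). -/
theorem smul_pow_mul_of_ad_nilpotent {u y v w : PowerSeries A} (hy : u * y = y * u + v)
    (hv : u * v = v * u + w) (hw : Commute u w) (m : ℕ) :
    (((m + 2).factorial : K)⁻¹ • u ^ (m + 2)) * y =
      y * (((m + 2).factorial : K)⁻¹ • u ^ (m + 2)) +
        v * (((m + 1).factorial : K)⁻¹ • u ^ (m + 1)) +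
        (2⁻¹ : K) • (w * ((m.factorial : K)⁻¹ • u ^ m)) := by
  induction m with
  | zero =>
    simp only [zero_add, Nat.factorial, pow_zero, pow_one, pow_two]
    have : u * u * y = y * (u * u) + (2 : K) • (v * u) + w := by
      rw [mul_assoc, hy, mul_add, ← mul_assoc, hy, hv, two_smul]
      noncomm_ring
    rw [smul_mul_assoc, this]
    simp only [Nat.cast_mul, Nat.cast_one, mul_one, smul_add, smul_smul, mul_smul_comm]
    norm_num
  | succ m ih =>
    have hd := mul_inv_factorial_smul_pow (K := K) u
    rw [show m + 1 + 2 = m + 3 from rfl, show m + 1 + 1 = m + 2 from rfl]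
    -- The divided powers are made opaque, so that only the recursion `hd` is used and the
    -- factorials do not have to be normalized.
    obtain ⟨D, hD⟩ : ∃ D : ℕ → PowerSeries A, ∀ n, (n.factorial : K)⁻¹ • u ^ n = D n :=
      ⟨_, fun n => rfl⟩
    simp only [hD] at *
    have h3 : (m : K) + 3 ≠ 0 := by exact_mod_cast Nat.succ_ne_zero (m + 2)
    have h' : D (m + 3) = ((m : K) + 3)⁻¹ • (u * D (m + 2)) := by
      rw [hd, smul_smul, show ((m + 2 : ℕ) : K) + 1 = m + 3 by push_cast; ring,
        inv_mul_cancel₀ h3, one_smul]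
    have h2 : u * D (m + 2) = ((m : K) + 3) • D (m + 3) := by
      rw [h', smul_smul, mul_inv_cancel₀ h3, one_smul]
    have h1 : u * D (m + 1) = ((m : K) + 2) • D (m + 2) := by
      rw [hd, show ((m + 1 : ℕ) : K) + 1 = m + 2 by push_cast; ring]
    have h4 : u * (D (m + 2) * y) = ((m : K) + 3) • (y * D (m + 3) + v * D (m + 2) +
        (2⁻¹ : K) • (w * D (m + 1))) := by
      rw [ih, mul_add, mul_add, ← mul_assoc u y, ← mul_assoc u v, mul_smul_comm, ← mul_assoc u w,
        hy, hv, hw.eq, add_mul, add_mul, mul_assoc y, mul_assoc v, mul_assoc w, h2, h1, hd m]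
      simp only [mul_smul_comm]
      match_scalars <;> ring
    rw [h', smul_mul_assoc, mul_assoc, h4, smul_smul, inv_mul_cancel₀ h3, one_smul, ← h']

theorem expSum_mul_of_ad_nilpotent {u y v w : PowerSeries A} (hy : u * y = y * u + v)
    (hv : u * v = v * u + w) (hw : Commute u w) (N : ℕ) :
    expSum K u (N + 2) * y =
      y * expSum K u (N + 2) + v * expSum K u (N + 1) + (2⁻¹ : K) • (w * expSum K u N) := by
  induction N with
  | zero => simp [expSum, Finset.sum_range_succ, add_mul, mul_add, hy, add_assoc]
  | succ N ih =>
    have hs : ∀ n, expSum K u (n + 1) = expSum K u n + ((n.factorial : K)⁻¹ • u ^ n) :=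
      fun n => Finset.sum_range_succ _ _
    rw [hs (N + 2), add_mul, ih, smul_pow_mul_of_ad_nilpotent hy hv hw, hs (N + 1), hs N]
    simp only [mul_add, smul_add]
    abel

variable (K) in
-- The Hadamard formula exp(u) y exp(-u) = y + [u, y] + ½[u, [u, y]] for an element killed by (ad
-- u)³. It computes the effect of an extension factor on a coproduct.
theorem fexp_mul_of_ad_nilpotent {u y v w : PowerSeries A} (hu : constantCoeff u = 0)
    (hy : u * y = y * u + v) (hv : u * v = v * u + w) (hw : Commute u w) :
    fexp K u * y = (y + v + (2⁻¹ : K) • w) * fexp K u := by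
  ext n
  -- The partial sums involved have lengths N + 2, N + 1 and N; taking N = n + 1 makes even the
  -- shortest one exact in order hⁿ.
  rw [coeff_fexp_mul hu _ (show n < n + 1 + 2 by omega), expSum_mul_of_ad_nilpotent hy hv hw,
    add_mul, add_mul, smul_mul_assoc]
  simp only [map_add, coeff_smul]
  rw [← coeff_mul_fexp hu y (show n < n + 1 + 2 by omega),
    ← coeff_mul_fexp hu v (show n < n + 1 + 1 by omega),
    ← coeff_mul_fexp hu w (show n < n + 1 by omega)]

end ExpLog

/-! ### Coefficientwise extension of algebra homomorphisms. -/

section Coefficientwise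

open PowerSeries

variable {K : Type*} [Field K] {A B C : Type*} [Ring A] [Algebra K A] [Ring B] [Algebra K B]
  [Ring C] [Algebra K C]

theorem ext_ext (φ : B →ₐ[K] C) (ψ : A →ₐ[K] B) (x : PowerSeries A) :
    ext φ (ext ψ x) = ext (φ.comp ψ) x := by
  ext n
  simp

theorem ext_id (x : PowerSeries A) : ext (AlgHom.id K A) x = x := by
  ext n
  simp

theorem commute_ext {φ : A →ₐ[K] C} {ψ : B →ₐ[K] C} (h : ∀ a b, Commute (φ a) (ψ b))
    (x : PowerSeries A) (y : PowerSeries B) : Commute (ext φ x) (ext ψ y) := by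
  ext n
  -- The formal variable is central, so reversing a product only exchanges the two indices of each
  -- convolution term.
  rw [coeff_mul, coeff_mul, ← Finset.Nat.sum_antidiagonal_swap]
  refine Finset.sum_congr rfl fun p _ => ?_
  simp only [coeff_map]
  exact h _ _

end Coefficientwise

/-! ### Embeddings into tensor powers, permutations of the legs, and the Hopf structure of U(L). -/

section Legs

variable (K : Type*) [Field K] (L : Type*) [LieRing L] [LieAlgebra K L]

/-- `a ↦ a ⊗ 1`. -/
abbrev inl : U K L →ₐ[K] U2 K L := Algebra.TensorProduct.includeLeft

/-- `a ↦ 1 ⊗ a`. -/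
abbrev inr : U K L →ₐ[K] U2 K L := Algebra.TensorProduct.includeRight

/-- `a ↦ a ⊗ 1 ⊗ 1`. -/
def slot1 : U K L →ₐ[K] U3 K L := (leg12 K L).comp (inl K L)

/-- `a ↦ 1 ⊗ a ⊗ 1`. -/
def slot2 : U K L →ₐ[K] U3 K L := (leg12 K L).comp (inr K L)

/-- `a ↦ 1 ⊗ 1 ⊗ a`. -/
def slot3 : U K L →ₐ[K] U3 K L := Algebra.TensorProduct.includeRight

/-- `a ⊗ b ⊗ c ↦ b ⊗ a ⊗ c`. -/
def swap12 : U3 K L →ₐ[K] U3 K L := Algebra.TensorProduct.map (flip K L) (AlgHom.id K (U K L))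

/-- `a ⊗ b ⊗ c ↦ a ⊗ c ⊗ b`. -/
def swap23 : U3 K L →ₐ[K] U3 K L :=
  (Algebra.TensorProduct.assoc K K K (U K L) (U K L) (U K L)).symm.toAlgHom.comp
    ((Algebra.TensorProduct.map (AlgHom.id K (U K L)) (flip K L)).comp
      (Algebra.TensorProduct.assoc K K K (U K L) (U K L) (U K L)).toAlgHom)

variable {K L}

theorem commute_inl_inr (a b : U K L) : Commute (inl K L a) (inr K L b) := by
  simp [Commute, SemiconjBy]

theorem commute_leg12_slot3 (z : U2 K L) (b : U K L) : Commute (leg12 K L z) (slot3 K L b) := by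
  simp [Commute, SemiconjBy, leg12, slot3]

theorem commute_slot1_leg23 (a : U K L) (z : U2 K L) : Commute (slot1 K L a) (leg23 K L z) := by
  induction z using TensorProduct.induction_on with
  | zero => simp
  | tmul x y => simp [Commute, SemiconjBy, slot1, leg12, leg23]
  | add x y hx hy =>
    rw [map_add]
    exact hx.add_right hy

theorem commute_slot1_slot2 (a b : U K L) : Commute (slot1 K L a) (slot2 K L b) :=
  (commute_inl_inr a b).map (leg12 K L)

theorem commute_slot1_slot3 (a b : U K L) : Commute (slot1 K L a) (slot3 K L b) :=
  commute_leg12_slot3 _ _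

theorem commute_slot2_slot3 (a b : U K L) : Commute (slot2 K L a) (slot3 K L b) :=
  commute_leg12_slot3 _ _

theorem leg23_comp_inl : (leg23 K L).comp (inl K L) = slot2 K L := by
  refine AlgHom.ext fun a => ?_
  simp [leg23, slot2, leg12]

theorem leg23_comp_inr : (leg23 K L).comp (inr K L) = slot3 K L := by
  refine AlgHom.ext fun a => ?_
  simp [leg23, slot3, Algebra.TensorProduct.one_def]

theorem comul_ι (x : L) : comul K L (inc K L x) = inl K L (inc K L x) + inr K L (inc K L x) :=
  UniversalEnvelopingAlgebra.lift_ι_apply K _ x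

theorem counit_ι (x : L) : counit K L (inc K L x) = 0 :=
  UniversalEnvelopingAlgebra.lift_ι_apply K _ x

theorem comulId_comp_inl : (comulId K L).comp (inl K L) = (leg12 K L).comp (comul K L) := by
  refine AlgHom.ext fun a => ?_
  simp [comulId, leg12]

theorem comulId_comp_inr : (comulId K L).comp (inr K L) = slot3 K L := by
  refine AlgHom.ext fun a => ?_
  simp [comulId, slot3]

theorem idComul_comp_inl : (idComul K L).comp (inl K L) = slot1 K L := by
  refine AlgHom.ext fun a => ?_
  simp [idComul, slot1, leg12, Algebra.TensorProduct.one_def]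

theorem assoc_symm_one_tmul (z : U2 K L) :
    (Algebra.TensorProduct.assoc K K K (U K L) (U K L) (U K L)).symm (1 ⊗ₜ z) =
      leg23 K L z := by
  induction z using TensorProduct.induction_on with
  | zero => simp
  | tmul x y => simp [leg23]
  | add x y hx hy => rw [TensorProduct.tmul_add, map_add, map_add, hx, hy]

theorem idComul_comp_inr : (idComul K L).comp (inr K L) = (leg23 K L).comp (comul K L) := by
  refine AlgHom.ext fun a => ?_
  simp [idComul, assoc_symm_one_tmul]

theorem counitId_comp_inl :
    (counitId K L).comp (inl K L) = (Algebra.ofId K (U K L)).comp (counit K L) := by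
  refine AlgHom.ext fun a => ?_
  simp [counitId, Algebra.ofId_apply, Algebra.algebraMap_eq_smul_one]

theorem counitId_comp_inr : (counitId K L).comp (inr K L) = AlgHom.id K _ := by
  refine AlgHom.ext fun a => ?_
  simp [counitId]

theorem idCounit_comp_inl : (idCounit K L).comp (inl K L) = AlgHom.id K _ := by
  refine AlgHom.ext fun a => ?_
  simp [idCounit]

theorem idCounit_comp_inr :
    (idCounit K L).comp (inr K L) = (Algebra.ofId K (U K L)).comp (counit K L) := by
  refine AlgHom.ext fun a => ?_
  simp [idCounit, Algebra.ofId_apply, Algebra.algebraMap_eq_smul_one]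

/-- Together with the universal property of U(L), this reduces every identity between leg maps and
coproducts to generators in a single leg. -/
theorem U2_hom_ext {A : Type*} [Ring A] [Algebra K A] {f g : U2 K L →ₐ[K] A}
    (hl : f.comp (inl K L) = g.comp (inl K L)) (hr : f.comp (inr K L) = g.comp (inr K L)) :
    f = g :=
  Algebra.TensorProduct.ext hl hr

theorem flip_comp_inl : (flip K L).comp (inl K L) = inr K L := by
  refine AlgHom.ext fun a => ?_
  simp [flip]

theorem flip_comp_inr : (flip K L).comp (inr K L) = inl K L := by
  refine AlgHom.ext fun a => ?_
  simp [flip]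

/-- Cocommutativity of the undeformed coproduct: the source of triangularity, and of the invariance
of (Δ ⊗ id)F and (id ⊗ Δ)F under exchanging the two legs produced by `Δ`. -/
theorem flip_comp_comul : (flip K L).comp (comul K L) = comul K L := by
  refine UniversalEnvelopingAlgebra.hom_ext K (LieHom.ext fun x => ?_)
  change flip K L (comul K L (inc K L x)) = comul K L (inc K L x)
  rw [comul_ι, map_add, ← AlgHom.comp_apply, ← AlgHom.comp_apply, flip_comp_inl, flip_comp_inr,
    add_comm]

theorem flip_comp_flip : (flip K L).comp (flip K L) = AlgHom.id K _ := by
  refine U2_hom_ext ?_ ?_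
  · rw [AlgHom.comp_assoc, flip_comp_inl, flip_comp_inr, AlgHom.id_comp]
  · rw [AlgHom.comp_assoc, flip_comp_inr, flip_comp_inl, AlgHom.id_comp]

theorem comulId_comp_comul :
    (comulId K L).comp (comul K L) = (idComul K L).comp (comul K L) := by
  refine UniversalEnvelopingAlgebra.hom_ext K (LieHom.ext fun x => ?_)
  change comulId K L (comul K L (inc K L x)) = idComul K L (comul K L (inc K L x))
  rw [comul_ι, map_add, map_add]
  simp only [← AlgHom.comp_apply]
  rw [comulId_comp_inl, comulId_comp_inr, idComul_comp_inl, idComul_comp_inr,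
    AlgHom.comp_apply, AlgHom.comp_apply, comul_ι, map_add, map_add]
  simp only [← AlgHom.comp_apply]
  rw [leg23_comp_inl, leg23_comp_inr, ← add_assoc]
  rfl

theorem counitId_comp_comul : (counitId K L).comp (comul K L) = AlgHom.id K _ := by
  refine UniversalEnvelopingAlgebra.hom_ext K (LieHom.ext fun x => ?_)
  change counitId K L (comul K L (inc K L x)) = inc K L x
  rw [comul_ι, map_add, ← AlgHom.comp_apply, ← AlgHom.comp_apply, counitId_comp_inl,
    counitId_comp_inr, AlgHom.comp_apply, counit_ι, map_zero, zero_add, AlgHom.id_apply]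

theorem idCounit_comp_comul : (idCounit K L).comp (comul K L) = AlgHom.id K _ := by
  refine UniversalEnvelopingAlgebra.hom_ext K (LieHom.ext fun x => ?_)
  change idCounit K L (comul K L (inc K L x)) = inc K L x
  rw [comul_ι, map_add, ← AlgHom.comp_apply, ← AlgHom.comp_apply, idCounit_comp_inl,
    idCounit_comp_inr, AlgHom.comp_apply, counit_ι, map_zero, add_zero, AlgHom.id_apply]

theorem swap12_comp_leg12 : (swap12 K L).comp (leg12 K L) = (leg12 K L).comp (flip K L) :=
  Algebra.TensorProduct.ext' fun a b => by simp [swap12, leg12, flip]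

theorem swap12_comp_leg13 : (swap12 K L).comp (leg13 K L) = leg23 K L :=
  Algebra.TensorProduct.ext' fun a b => by simp [swap12, leg13, leg23, flip]

theorem swap12_comp_leg23 : (swap12 K L).comp (leg23 K L) = leg13 K L :=
  Algebra.TensorProduct.ext' fun a b => by simp [swap12, leg13, leg23, flip]

theorem swap23_comp_leg12 : (swap23 K L).comp (leg12 K L) = leg13 K L :=
  Algebra.TensorProduct.ext' fun a b => by simp [swap23, leg12, leg13, flip]

theorem swap23_comp_leg13 : (swap23 K L).comp (leg13 K L) = leg12 K L :=
  Algebra.TensorProduct.ext' fun a b => by simp [swap23, leg12, leg13, flip]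

theorem swap23_comp_leg23 : (swap23 K L).comp (leg23 K L) = (leg23 K L).comp (flip K L) :=
  Algebra.TensorProduct.ext' fun a b => by simp [swap23, leg23, flip]

theorem swap12_comp_slot3 : (swap12 K L).comp (slot3 K L) = slot3 K L := by
  rw [← leg23_comp_inr, ← AlgHom.comp_assoc, swap12_comp_leg23]
  refine AlgHom.ext fun a => ?_
  simp [leg13, leg23]

theorem swap23_comp_slot1 : (swap23 K L).comp (slot1 K L) = slot1 K L := by
  rw [slot1, ← AlgHom.comp_assoc, swap23_comp_leg12]
  refine AlgHom.ext fun a => ?_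
  simp [leg13, leg12]

theorem swap12_comp_slot1 : (swap12 K L).comp (slot1 K L) = slot2 K L := by
  rw [slot1, ← AlgHom.comp_assoc, swap12_comp_leg12, AlgHom.comp_assoc, flip_comp_inl, slot2]

theorem swap23_comp_slot2 : (swap23 K L).comp (slot2 K L) = slot3 K L := by
  rw [← leg23_comp_inl, ← AlgHom.comp_assoc, swap23_comp_leg23, AlgHom.comp_assoc, flip_comp_inl,
    leg23_comp_inr]

theorem swap12_comp_slot2 : (swap12 K L).comp (slot2 K L) = slot1 K L := by
  rw [slot2, ← AlgHom.comp_assoc, swap12_comp_leg12, AlgHom.comp_assoc, flip_comp_inr, slot1]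

theorem swap23_comp_slot3 : (swap23 K L).comp (slot3 K L) = slot2 K L := by
  rw [← leg23_comp_inr, ← AlgHom.comp_assoc, swap23_comp_leg23, AlgHom.comp_assoc, flip_comp_inr,
    leg23_comp_inl]

theorem swap12_comp_comulId : (swap12 K L).comp (comulId K L) = comulId K L := by
  refine U2_hom_ext ?_ ?_
  · rw [AlgHom.comp_assoc, comulId_comp_inl, ← AlgHom.comp_assoc, swap12_comp_leg12,
      AlgHom.comp_assoc, flip_comp_comul]
  · rw [AlgHom.comp_assoc, comulId_comp_inr, swap12_comp_slot3]

theorem swap23_comp_idComul : (swap23 K L).comp (idComul K L) = idComul K L := by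
  refine U2_hom_ext ?_ ?_
  · rw [AlgHom.comp_assoc, idComul_comp_inl, swap23_comp_slot1]
  · rw [AlgHom.comp_assoc, idComul_comp_inr, ← AlgHom.comp_assoc, swap23_comp_leg23,
      AlgHom.comp_assoc, flip_comp_comul]

theorem comulId_comp_flip : (comulId K L).comp (flip K L) =
    (swap23 K L).comp ((swap12 K L).comp (idComul K L)) := by
  refine U2_hom_ext ?_ ?_
  · rw [AlgHom.comp_assoc, AlgHom.comp_assoc, AlgHom.comp_assoc, flip_comp_inl,
      comulId_comp_inr, idComul_comp_inl, swap12_comp_slot1, swap23_comp_slot2]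
  · rw [AlgHom.comp_assoc, AlgHom.comp_assoc, AlgHom.comp_assoc, flip_comp_inr,
      comulId_comp_inl, idComul_comp_inr, ← AlgHom.comp_assoc _ _ (comul K L), swap12_comp_leg23,
      ← AlgHom.comp_assoc, swap23_comp_leg13]

theorem idComul_comp_flip : (idComul K L).comp (flip K L) =
    (swap12 K L).comp ((swap23 K L).comp (comulId K L)) := by
  refine U2_hom_ext ?_ ?_
  · rw [AlgHom.comp_assoc, AlgHom.comp_assoc, AlgHom.comp_assoc, flip_comp_inl,
      comulId_comp_inl, idComul_comp_inr, ← AlgHom.comp_assoc _ _ (comul K L), swap23_comp_leg12,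
      ← AlgHom.comp_assoc, swap12_comp_leg13]
  · rw [AlgHom.comp_assoc, AlgHom.comp_assoc, AlgHom.comp_assoc, flip_comp_inr,
      comulId_comp_inr, idComul_comp_inl, swap23_comp_slot3, swap12_comp_slot2]

end Legs

/-! ### From a twist to a triangular bialgebra and the Yang-Baxter equations. -/

section Quantization

open PowerSeries

variable {K : Type*} [Field K] {L : Type*} [LieRing L] [LieAlgebra K L]

theorem ext_comp_congr {A B C D : Type*} [Ring A] [Algebra K A] [Ring B] [Algebra K B]
    [Ring C] [Algebra K C] [Ring D] [Algebra K D] {φ : B →ₐ[K] C} {ψ : A →ₐ[K] B}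
    {φ' : D →ₐ[K] C} {ψ' : A →ₐ[K] D} (h : φ.comp ψ = φ'.comp ψ') (x : PowerSeries A) :
    ext φ (ext ψ x) = ext φ' (ext ψ' x) := by
  rw [ext_ext, ext_ext, h]

theorem ext_comp_apply {A B C : Type*} [Ring A] [Algebra K A] [Ring B] [Algebra K B]
    [Ring C] [Algebra K C] {φ : B →ₐ[K] C} {ψ : A →ₐ[K] B}
    {χ : A →ₐ[K] C} (h : φ.comp ψ = χ) (x : PowerSeries A) :
    ext φ (ext ψ x) = ext χ x := by
  rw [ext_ext, h]

theorem ext_inverse {A B : Type*} [Ring A] [Algebra K A] [Ring B] [Algebra K B] (φ : A →ₐ[K] B)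
    {F : PowerSeries A} (hF : IsUnit F) :
    ext φ (Ring.inverse F) = Ring.inverse (ext φ F) := by
  obtain ⟨u, rfl⟩ := hF
  rw [Ring.inverse_unit]
  exact (Ring.inverse_unit (Units.map (ext φ : PowerSeries A →* PowerSeries B) u)).symm

/-- The action of `ext φ` on invertible power series. -/
def unitsExt {A B : Type*} [Ring A] [Algebra K A] [Ring B] [Algebra K B] (φ : A →ₐ[K] B) :
    (PowerSeries A)ˣ →* (PowerSeries B)ˣ :=
  Units.map (ext φ : PowerSeries A →* PowerSeries B)

variable {F : PowerSeries (U2 K L)}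

/-- The images of the twist equation under the permutations of the legs. -/
theorem IsTwist.swap12_cocycle (hF : IsTwist F) :
    ext (leg12 K L) (ext (flip K L) F) * ext (comulId K L) F =
      ext (leg13 K L) F * ext (swap12 K L) (ext (idComul K L) F) := by
  have h := congrArg (ext (swap12 K L)) hF.cocycle
  rwa [map_mul, map_mul, ext_comp_congr (swap12_comp_leg12 (K := K) (L := L)),
    ext_comp_apply (swap12_comp_comulId (K := K) (L := L)),
    ext_comp_apply (swap12_comp_leg23 (K := K) (L := L))] at h

theorem IsTwist.swap23_cocycle (hF : IsTwist F) :
    ext (leg13 K L) F * ext (swap23 K L) (ext (comulId K L) F) =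
      ext (leg23 K L) (ext (flip K L) F) * ext (idComul K L) F := by
  have h := congrArg (ext (swap23 K L)) hF.cocycle
  rwa [map_mul, map_mul, ext_comp_congr (swap23_comp_leg23 (K := K) (L := L)),
    ext_comp_apply (swap23_comp_idComul (K := K) (L := L)),
    ext_comp_apply (swap23_comp_leg12 (K := K) (L := L))] at h

theorem IsTwist.swap23_swap12_cocycle (hF : IsTwist F) :
    ext (leg13 K L) (ext (flip K L) F) * ext (swap23 K L) (ext (comulId K L) F) =
      ext (leg12 K L) F * ext (comulId K L) (ext (flip K L) F) := by
  have h := congrArg (ext (swap23 K L)) hF.swap12_cocycle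
  have e : ext (comulId K L) (ext (flip K L) F) =
      ext (swap23 K L) (ext (swap12 K L) (ext (idComul K L) F)) := by
    simp only [ext_ext, comulId_comp_flip]
  rw [map_mul, map_mul, ← e, ext_comp_apply (swap23_comp_leg12 (K := K) (L := L)),
    ext_comp_apply (swap23_comp_leg13 (K := K) (L := L))] at h
  exact h

theorem IsTwist.swap12_swap23_cocycle (hF : IsTwist F) :
    ext (leg13 K L) (ext (flip K L) F) * ext (swap12 K L) (ext (idComul K L) F) =
      ext (leg23 K L) F * ext (idComul K L) (ext (flip K L) F) := by
  have h := congrArg (ext (swap12 K L)) hF.swap23_cocycle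
  have e : ext (idComul K L) (ext (flip K L) F) =
      ext (swap12 K L) (ext (swap23 K L) (ext (comulId K L) F)) := by
    simp only [ext_ext, idComul_comp_flip]
  rw [map_mul, map_mul, ← e, ext_comp_apply (swap12_comp_leg23 (K := K) (L := L)),
    ext_comp_apply (swap12_comp_leg13 (K := K) (L := L))] at h
  exact h.symm

/-- The hexagon identity as a statement about groups. For the left one, `a`, `b`, `a'`, `b'` are
F₁₂, (Δ ⊗ id)F, F₂₃, (id ⊗ Δ)F, while `f`, `d`, `t` are F₃₁, F₁₃, F₃₂ and p = (Δ ⊗ id)F₂₁; `h1` and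
`h2` are permuted twist equations sharing the factor `s`. Exchanging the roles of the two sides of
the twist equation gives the right hexagon. -/
theorem hexagon_of_group {G : Type*} [Group G] {a b a' b' f d p t s : G} (h : a * b = a' * b')
    (h1 : f * s = a * p) (h2 : d * s = t * b') :
    a * (p * b⁻¹) * a⁻¹ = f * d⁻¹ * (t * a'⁻¹) := by
  have e1 : p = a⁻¹ * (f * s) := by rw [h1, inv_mul_cancel_left]
  have e2 : t = d * s * b'⁻¹ := by rw [h2, mul_inv_cancel_right]
  have e3 : b⁻¹ * a⁻¹ = b'⁻¹ * a'⁻¹ := by rw [← mul_inv_rev, h, mul_inv_rev]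
  rw [e1, e2]
  simp only [mul_assoc, mul_inv_cancel_left, inv_mul_cancel_left, e3]

theorem IsTwist.hexagon_left (hF : IsTwist F) :
    twistedComulId F (rMatrix F) = ext (leg13 K L) (rMatrix F) * ext (leg23 K L) (rMatrix F) := by
  have hc := hF.cocycle
  have h1 := hF.swap23_swap12_cocycle
  have h2 := hF.swap23_cocycle
  obtain ⟨u, rfl⟩ := hF.isUnit
  have key := hexagon_of_group (a := unitsExt (leg12 K L) u) (b := unitsExt (comulId K L) u)
    (a' := unitsExt (leg23 K L) u) (b' := unitsExt (idComul K L) u)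
    (f := unitsExt (leg13 K L) (unitsExt (flip K L) u))
    (d := unitsExt (leg13 K L) u) (p := unitsExt (comulId K L) (unitsExt (flip K L) u))
    (t := unitsExt (leg23 K L) (unitsExt (flip K L) u))
    (s := unitsExt (swap23 K L) (unitsExt (comulId K L) u))
    (Units.ext hc) (Units.ext h1) (Units.ext h2)
  rw [twistedComulId, rMatrix, Ring.inverse_unit, map_mul, map_mul, map_mul]
  exact congrArg Units.val key

theorem IsTwist.hexagon_right (hF : IsTwist F) :
    idTwistedComul F (rMatrix F) = ext (leg13 K L) (rMatrix F) * ext (leg12 K L) (rMatrix F) := by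
  have hc := hF.cocycle.symm
  have h1 := hF.swap12_swap23_cocycle
  have h2 := hF.swap12_cocycle.symm
  obtain ⟨u, rfl⟩ := hF.isUnit
  have key := hexagon_of_group (a := unitsExt (leg23 K L) u) (b := unitsExt (idComul K L) u)
    (a' := unitsExt (leg12 K L) u) (b' := unitsExt (comulId K L) u)
    (f := unitsExt (leg13 K L) (unitsExt (flip K L) u))
    (d := unitsExt (leg13 K L) u) (p := unitsExt (idComul K L) (unitsExt (flip K L) u))
    (t := unitsExt (leg12 K L) (unitsExt (flip K L) u))
    (s := unitsExt (swap12 K L) (unitsExt (idComul K L) u))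
    (Units.ext hc) (Units.ext h1) (Units.ext h2)
  rw [idTwistedComul, rMatrix, Ring.inverse_unit, map_mul, map_mul, map_mul]
  exact congrArg Units.val key

/-- Both iterated coproducts conjugate the coassociative `Δ`, one by F₁₂ (Δ ⊗ id)F and the other by
F₂₃ (id ⊗ Δ)F; the twist equation says that these agree. -/
theorem IsTwist.coassoc (hF : IsTwist F) (x : PowerSeries (U K L)) :
    twistedComulId F (twistedComul F x) = idTwistedComul F (twistedComul F x) := by
  have hc := hF.cocycle
  have hx : ext (comulId K L) (ext (comul K L) x) = ext (idComul K L) (ext (comul K L) x) :=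
    ext_comp_congr comulId_comp_comul x
  obtain ⟨u, rfl⟩ := hF.isUnit
  have hi : ext (comulId K L) (↑u⁻¹ : PowerSeries (U2 K L)) * ext (leg12 K L) (↑u⁻¹) =
      ext (idComul K L) (↑u⁻¹ : PowerSeries (U2 K L)) * ext (leg23 K L) (↑u⁻¹) := by
    have h : unitsExt (leg12 K L) u * unitsExt (comulId K L) u =
      unitsExt (leg23 K L) u * unitsExt (idComul K L) u := Units.ext hc
    have h' := congrArg (fun v => v⁻¹) h
    simp only [mul_inv_rev] at h'
    exact congrArg Units.val h'
  simp only [twistedComulId, idTwistedComul, twistedComul, Ring.inverse_unit, map_mul]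
  rw [← mul_assoc, ← mul_assoc, hc, hx, mul_assoc, hi]
  simp only [mul_assoc]

theorem IsTwist.ext_counitId_inverse (hF : IsTwist F) :
    ext (counitId K L) (Ring.inverse F) = 1 := by
  rw [ext_inverse _ hF.isUnit, hF.counit_left, Ring.inverse_one]

theorem IsTwist.ext_idCounit_inverse (hF : IsTwist F) :
    ext (idCounit K L) (Ring.inverse F) = 1 := by
  rw [ext_inverse _ hF.isUnit, hF.counit_right, Ring.inverse_one]

theorem ext_flip_flip (y : PowerSeries (U2 K L)) : ext (flip K L) (ext (flip K L) y) = y := by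
  rw [ext_ext, flip_comp_flip, ext_id]

theorem rMatrix_mul_twistedComul (hF : IsUnit F) (x : PowerSeries (U K L)) :
    rMatrix F * twistedComul F x = ext (flip K L) (twistedComul F x) * rMatrix F := by
  have hi : ext (flip K L) (Ring.inverse F) * ext (flip K L) F = 1 := by
    rw [← map_mul, Ring.inverse_mul_cancel _ hF, map_one]
  rw [rMatrix, twistedComul, map_mul, map_mul,
    ext_comp_apply (flip_comp_comul (K := K) (L := L))]
  simp only [mul_assoc]
  rw [← mul_assoc (ext (flip K L) (Ring.inverse F)), hi, one_mul,
    ← mul_assoc (Ring.inverse F) F, Ring.inverse_mul_cancel _ hF, one_mul]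

theorem rMatrix_triangular (hF : IsUnit F) : ext (flip K L) (rMatrix F) * rMatrix F = 1 := by
  have hi : ext (flip K L) (Ring.inverse F) * ext (flip K L) F = 1 := by
    rw [← map_mul, Ring.inverse_mul_cancel _ hF, map_one]
  rw [rMatrix, map_mul, ext_flip_flip, mul_assoc, ← mul_assoc (ext (flip K L) (Ring.inverse F)),
    hi, one_mul, Ring.mul_inverse_cancel _ hF]

/-- By the left hexagon R₁₃R₂₃ = (Δ_F ⊗ id)R, and exchanging legs 1 and 2 turns this into (Δ_F^op ⊗
id)R = R₂₃R₁₃. Moving R₁₂ past the former gives the latter. -/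
theorem IsTwist.qybe (hF : IsTwist F) :
    ext (leg12 K L) (rMatrix F) * ext (leg13 K L) (rMatrix F) * ext (leg23 K L) (rMatrix F) =
      ext (leg23 K L) (rMatrix F) * ext (leg13 K L) (rMatrix F) *
        ext (leg12 K L) (rMatrix F) := by
  have hu := hF.isUnit
  have h12 : ext (leg12 K L) (rMatrix F) * ext (leg12 K L) F =
      ext (leg12 K L) (ext (flip K L) F) := by
    rw [← map_mul, rMatrix, mul_assoc, Ring.inverse_mul_cancel _ hu, mul_one]
  have hi : ext (leg12 K L) (ext (flip K L) (Ring.inverse F)) *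
      ext (leg12 K L) (rMatrix F) = ext (leg12 K L) (Ring.inverse F) := by
    rw [← map_mul, rMatrix, ← mul_assoc, ← map_mul, Ring.inverse_mul_cancel _ hu, map_one,
      one_mul]
  have hs := congrArg (ext (swap12 K L)) hF.hexagon_left
  rw [twistedComulId, map_mul, map_mul, map_mul,
    ext_comp_congr (swap12_comp_leg12 (K := K) (L := L)),
    ext_comp_congr (swap12_comp_leg12 (K := K) (L := L)),
    ext_comp_apply (swap12_comp_comulId (K := K) (L := L)),
    ext_comp_apply (swap12_comp_leg13 (K := K) (L := L)),
    ext_comp_apply (swap12_comp_leg23 (K := K) (L := L))] at hs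
  rw [mul_assoc, ← hF.hexagon_left, twistedComulId, ← hs, ← mul_assoc, ← mul_assoc, h12,
    mul_assoc _ _ (ext (leg12 K L) (rMatrix F)), hi]

theorem coeff_one_mul' {A : Type*} [Ring A] (f g : PowerSeries A) :
    coeff 1 (f * g) = coeff 0 f * coeff 1 g + coeff 1 f * coeff 0 g := by
  rw [coeff_mul, Finset.Nat.antidiagonal_succ]
  simp

theorem coeff_zero_mul' {A : Type*} [Ring A] (f g : PowerSeries A) :
    coeff 0 (f * g) = coeff 0 f * coeff 0 g := by
  simp

theorem coeff_zero_inverse (hF : IsUnit F) (h0 : coeff 0 F = 1) :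
    coeff 0 (Ring.inverse F) = 1 := by
  have h := congrArg (coeff 0) (Ring.mul_inverse_cancel F hF)
  rwa [coeff_zero_mul', h0, one_mul, coeff_zero_one] at h

theorem coeff_one_inverse (hF : IsUnit F) (h0 : coeff 0 F = 1) :
    coeff 1 (Ring.inverse F) = -coeff 1 F := by
  have h := congrArg (coeff 1) (Ring.mul_inverse_cancel F hF)
  rw [coeff_one_mul', h0, one_mul, coeff_zero_inverse hF h0, mul_one, coeff_one,
    if_neg one_ne_zero] at h
  exact eq_neg_of_add_eq_zero_left h

theorem coeff_zero_rMatrix (hF : IsUnit F) (h0 : coeff 0 F = 1) : coeff 0 (rMatrix F) = 1 := by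
  rw [rMatrix, coeff_zero_mul', coeff_zero_inverse hF h0, mul_one, coeff_map, h0, map_one]

theorem coeff_one_rMatrix (hF : IsUnit F) (h0 : coeff 0 F = 1) :
    coeff 1 (rMatrix F) = flip K L (coeff 1 F) - coeff 1 F := by
  rw [rMatrix, coeff_one_mul', coeff_one_inverse hF h0, coeff_zero_inverse hF h0, mul_one,
    coeff_map, coeff_map, h0, map_one, one_mul, neg_add_eq_sub]
  rfl

theorem IsTwist.rMatrixQuantizes (hF : IsTwist F) (h0 : coeff 0 F = 1) {r : L ⊗[K] L}
    (h1 : flip K L (coeff 1 F) - coeff 1 F = tensorInc r) : RMatrixQuantizes F r where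
  coassoc := hF.coassoc
  counit_left x := by
    rw [twistedComul, map_mul, map_mul, hF.counit_left, hF.ext_counitId_inverse, one_mul,
      mul_one, ext_ext, counitId_comp_comul, ext_id]
  counit_right x := by
    rw [twistedComul, map_mul, map_mul, hF.counit_right, hF.ext_idCounit_inverse, one_mul,
      mul_one, ext_ext, idCounit_comp_comul, ext_id]
  intertwines := rMatrix_mul_twistedComul hF.isUnit
  hexagon_left := hF.hexagon_left
  hexagon_right := hF.hexagon_right
  triangular := rMatrix_triangular hF.isUnit
  qybe := hF.qybe
  coeff_zero := coeff_zero_rMatrix hF.isUnit h0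
  coeff_one := by rw [coeff_one_rMatrix hF.isUnit h0, h1]

/-- The classical Yang-Baxter equation is the part of order `h²` of the quantum one. -/
theorem RMatrixQuantizes.cybe {r : L ⊗[K] L} (h : RMatrixQuantizes F r) :
    ⁅leg12 K L (tensorInc r), leg13 K L (tensorInc r)⁆ +
      ⁅leg12 K L (tensorInc r), leg23 K L (tensorInc r)⁆ +
      ⁅leg13 K L (tensorInc r), leg23 K L (tensorInc r)⁆ = 0 := by
  have h0 := h.coeff_zero
  have h1 := h.coeff_one
  have hq := congrArg (coeff 2) h.qybe
  have c2 : ∀ f g : PowerSeries (U3 K L), coeff 2 (f * g) =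
      coeff 0 f * coeff 2 g + coeff 1 f * coeff 1 g + coeff 2 f * coeff 0 g := fun f g => by
    rw [coeff_mul, Finset.Nat.sum_antidiagonal_eq_sum_range_succ_mk]
    simp [Finset.sum_range_succ]
  simp only [c2, coeff_one_mul', coeff_zero_mul', coeff_map, h0, h1, RingHom.coe_coe, map_one,
    one_mul, mul_one] at hq
  -- The second-order coefficients of R occur additively and identically on both sides of `hq`; what
  -- is left is exactly the three commutators of the first-order terms.
  simp only [LieRing.of_associative_ring_bracket]
  rw [← sub_eq_zero] at hq
  rw [← hq]
  noncomm_ring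

end Quantization

/-! ### Twisting in stages: coproducts and twist equations relative to an earlier twist. -/

section RelativeTwist

open PowerSeries

variable {K : Type*} [Field K] {L : Type*} [LieRing L] [LieAlgebra K L]
  {F G : PowerSeries (U2 K L)}

theorem commute_ext_inl_inr (x y : PowerSeries (U K L)) :
    Commute (ext (inl K L) x) (ext (inr K L) y) :=
  commute_ext (commute_inl_inr (K := K) (L := L)) x y

theorem twistedComul_semiconj (hF : IsUnit F) (x : PowerSeries (U K L)) :
    SemiconjBy F (ext (comul K L) x) (twistedComul F x) := by
  rw [SemiconjBy, twistedComul, mul_assoc _ (Ring.inverse F) F, Ring.inverse_mul_cancel _ hF,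
    mul_one]

theorem twistedComul_eq_of_semiconj (hF : IsUnit F) {x : PowerSeries (U K L)}
    {z : PowerSeries (U2 K L)} (h : SemiconjBy F (ext (comul K L) x) z) :
    twistedComul F x = z := by
  rw [twistedComul, h.eq, mul_assoc, Ring.mul_inverse_cancel _ hF, mul_one]

theorem twistedComul_mul (hF : IsUnit F) (x y : PowerSeries (U K L)) :
    twistedComul F (x * y) = twistedComul F x * twistedComul F y :=
  twistedComul_eq_of_semiconj hF (by
    rw [map_mul]
    exact (twistedComul_semiconj hF x).mul_right (twistedComul_semiconj hF y))

theorem twistedComul_add (x y : PowerSeries (U K L)) :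
    twistedComul F (x + y) = twistedComul F x + twistedComul F y := by
  simp [twistedComul, mul_add, add_mul]

theorem twistedComul_sub (x y : PowerSeries (U K L)) :
    twistedComul F (x - y) = twistedComul F x - twistedComul F y := by
  simp [twistedComul, mul_sub, sub_mul]

theorem twistedComul_smul (c : K) (x : PowerSeries (U K L)) :
    twistedComul F (c • x) = c • twistedComul F x := by
  simp [twistedComul, ext_smul]

theorem twistedComul_sum {ι : Type*} (S : Finset ι) (x : ι → PowerSeries (U K L)) :
    twistedComul F (∑ j ∈ S, x j) = ∑ j ∈ S, twistedComul F (x j) := by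
  simp [twistedComul, Finset.mul_sum, Finset.sum_mul]

theorem twistedComul_X (hF : IsUnit F) : twistedComul F X = X := by
  refine twistedComul_eq_of_semiconj hF ?_
  rw [map_X]
  exact commute_X F

/-- Δ_{GF} is `Δ_F` conjugated by `G`, so the new coproduct of `x` is found by commuting `G` past
the old one. -/
theorem twistedComul_mul_of_semiconj (hG : IsUnit G) (hF : IsUnit F) {x : PowerSeries (U K L)}
    {z : PowerSeries (U2 K L)} (h : SemiconjBy G (twistedComul F x) z) :
    twistedComul (G * F) x = z :=
  twistedComul_eq_of_semiconj (hG.mul hF) (h.mul_left (twistedComul_semiconj hF x))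

theorem twistedComulId_semiconj (hF : IsUnit F) (y : PowerSeries (U2 K L)) :
    SemiconjBy (ext (leg12 K L) F) (ext (comulId K L) y) (twistedComulId F y) := by
  rw [SemiconjBy, twistedComulId, mul_assoc _ _ (ext (leg12 K L) F), ← map_mul,
    Ring.inverse_mul_cancel _ hF, map_one, mul_one]

theorem twistedComulId_eq_of_semiconj (hF : IsUnit F) {y : PowerSeries (U2 K L)}
    {z : PowerSeries (U3 K L)}
    (h : SemiconjBy (ext (leg12 K L) F) (ext (comulId K L) y) z) : twistedComulId F y = z := by
  rw [twistedComulId, h.eq, mul_assoc, ← map_mul, Ring.mul_inverse_cancel _ hF, map_one, mul_one]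

theorem idTwistedComul_semiconj (hF : IsUnit F) (y : PowerSeries (U2 K L)) :
    SemiconjBy (ext (leg23 K L) F) (ext (idComul K L) y) (idTwistedComul F y) := by
  rw [SemiconjBy, idTwistedComul, mul_assoc _ _ (ext (leg23 K L) F), ← map_mul,
    Ring.inverse_mul_cancel _ hF, map_one, mul_one]

theorem idTwistedComul_eq_of_semiconj (hF : IsUnit F) {y : PowerSeries (U2 K L)}
    {z : PowerSeries (U3 K L)}
    (h : SemiconjBy (ext (leg23 K L) F) (ext (idComul K L) y) z) : idTwistedComul F y = z := by
  rw [idTwistedComul, h.eq, mul_assoc, ← map_mul, Ring.mul_inverse_cancel _ hF, map_one, mul_one]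

theorem twistedComulId_inl_mul_inr (hF : IsUnit F) (a b : PowerSeries (U K L)) :
    twistedComulId F (ext (inl K L) a * ext (inr K L) b) =
      ext (leg12 K L) (twistedComul F a) * ext (slot3 K L) b := by
  refine twistedComulId_eq_of_semiconj hF ?_
  rw [map_mul, ext_comp_congr (comulId_comp_inl (K := K) (L := L)),
    ext_comp_apply (comulId_comp_inr (K := K) (L := L))]
  have hc : Commute (ext (leg12 K L) F) (ext (slot3 K L) b) :=
    commute_ext (commute_leg12_slot3 (K := K) (L := L)) F b
  have h := congrArg (ext (leg12 K L)) (twistedComul_semiconj hF a).eq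
  rw [map_mul, map_mul] at h
  rw [SemiconjBy, ← mul_assoc, h, mul_assoc, hc.eq, ← mul_assoc]

theorem idTwistedComul_inl_mul_inr (hF : IsUnit F) (a b : PowerSeries (U K L)) :
    idTwistedComul F (ext (inl K L) a * ext (inr K L) b) =
      ext (slot1 K L) a * ext (leg23 K L) (twistedComul F b) := by
  refine idTwistedComul_eq_of_semiconj hF ?_
  rw [map_mul, ext_comp_congr (idComul_comp_inr (K := K) (L := L)),
    ext_comp_apply (idComul_comp_inl (K := K) (L := L))]
  have hc : Commute (ext (slot1 K L) a) (ext (leg23 K L) F) :=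
    commute_ext (commute_slot1_leg23 (K := K) (L := L)) a F
  have h := congrArg (ext (leg23 K L)) (twistedComul_semiconj hF b).eq
  rw [map_mul, map_mul] at h
  rw [SemiconjBy, ← mul_assoc, ← hc.eq, mul_assoc, h, ← mul_assoc]

theorem twistedComulId_sum {ι : Type*} (S : Finset ι) (y : ι → PowerSeries (U2 K L)) :
    twistedComulId F (∑ j ∈ S, y j) = ∑ j ∈ S, twistedComulId F (y j) := by
  simp [twistedComulId, Finset.mul_sum, Finset.sum_mul]

theorem idTwistedComul_sum {ι : Type*} (S : Finset ι) (y : ι → PowerSeries (U2 K L)) :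
    idTwistedComul F (∑ j ∈ S, y j) = ∑ j ∈ S, idTwistedComul F (y j) := by
  simp [idTwistedComul, Finset.mul_sum, Finset.sum_mul]

theorem constantCoeff_twisted {A : Type*} [Ring A] {x : PowerSeries A} (hx : constantCoeff x = 0)
    (y z : PowerSeries A) : constantCoeff (y * x * z) = 0 := by
  rw [map_mul, map_mul, hx, mul_zero, zero_mul]

theorem constantCoeff_sum_mul {A ι : Type*} [Ring A] (S : Finset ι) {x : ι → PowerSeries A}
    (hx : ∀ j ∈ S, constantCoeff (x j) = 0) (y : ι → PowerSeries A) :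
    constantCoeff (∑ j ∈ S, x j * y j) = 0 := by
  rw [map_sum]
  exact Finset.sum_eq_zero fun j hj => by rw [map_mul, hx j hj, zero_mul]

theorem constantCoeff_smul {A : Type*} [Ring A] [Algebra K A] {x : PowerSeries A}
    (hx : constantCoeff x = 0) (c : K) : constantCoeff (c • x) = 0 := by
  rw [← coeff_zero_eq_constantCoeff_apply] at hx ⊢
  rw [coeff_smul, hx, smul_zero]

section Exponentials

variable [CharZero K]

theorem twistedComulId_fexp (hF : IsUnit F) {y : PowerSeries (U2 K L)}
    (hy : constantCoeff y = 0) : twistedComulId F (fexp K y) = fexp K (twistedComulId F y) := by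
  refine twistedComulId_eq_of_semiconj hF ?_
  rw [ext_fexp]
  exact FullChain.SemiconjBy.fexp (twistedComulId_semiconj hF y) (constantCoeff_ext hy _)
    (constantCoeff_twisted (constantCoeff_ext hy _) _ _)

theorem idTwistedComul_fexp (hF : IsUnit F) {y : PowerSeries (U2 K L)}
    (hy : constantCoeff y = 0) : idTwistedComul F (fexp K y) = fexp K (idTwistedComul F y) := by
  refine idTwistedComul_eq_of_semiconj hF ?_
  rw [ext_fexp]
  exact FullChain.SemiconjBy.fexp (idTwistedComul_semiconj hF y) (constantCoeff_ext hy _)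
    (constantCoeff_twisted (constantCoeff_ext hy _) _ _)

theorem twistedComul_fexp (hF : IsUnit F) {x : PowerSeries (U K L)}
    (hx : constantCoeff x = 0) : twistedComul F (fexp K x) = fexp K (twistedComul F x) := by
  refine twistedComul_eq_of_semiconj hF ?_
  rw [ext_fexp]
  exact FullChain.SemiconjBy.fexp (twistedComul_semiconj hF x) (constantCoeff_ext hx _)
    (constantCoeff_twisted (constantCoeff_ext hx _) _ _)

theorem twistedComul_flog1p (hF : IsUnit F) {x : PowerSeries (U K L)}
    (hx : constantCoeff x = 0) : twistedComul F (flog1p K x) = flog1p K (twistedComul F x) := by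
  refine twistedComul_eq_of_semiconj hF ?_
  rw [ext_flog1p]
  exact FullChain.SemiconjBy.flog1p (twistedComul_semiconj hF x) (constantCoeff_ext hx _)
    (constantCoeff_twisted (constantCoeff_ext hx _) _ _)

end Exponentials

variable (F) in
/-- `G` is a twisting element relative to the coproduct `Δ_F`. -/
structure IsRelTwist (G : PowerSeries (U2 K L)) : Prop where
  isUnit : IsUnit G
  cocycle : ext (leg12 K L) G * twistedComulId F G = ext (leg23 K L) G * idTwistedComul F G
  counit_left : ext (counitId K L) G = 1
  counit_right : ext (idCounit K L) G = 1

/-- Moving F₁₂ past (Δ ⊗ id)G produces (Δ_F ⊗ id)G, and F₂₃ acts likewise on the other side. The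
twist equation splits into the relative one for `G` followed by the one for `F`. -/
theorem IsRelTwist.isTwist_mul (hG : IsRelTwist F G) (hF : IsTwist F) : IsTwist (G * F) where
  isUnit := hG.isUnit.mul hF.isUnit
  cocycle := by
    rw [map_mul, map_mul, map_mul, map_mul, mul_assoc,
      ← mul_assoc _ (ext (comulId K L) G), (twistedComulId_semiconj hF.isUnit G).eq, mul_assoc,
      hF.cocycle, ← mul_assoc, hG.cocycle]
    simp only [mul_assoc]
    rw [← mul_assoc (idTwistedComul F G), ← (idTwistedComul_semiconj hF.isUnit G).eq, mul_assoc]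
  counit_left := by rw [map_mul, hG.counit_left, hF.counit_left, one_mul]
  counit_right := by rw [map_mul, hG.counit_right, hF.counit_right, one_mul]

theorem isTwist_one : IsTwist (1 : PowerSeries (U2 K L)) where
  isUnit := isUnit_one
  cocycle := by simp only [map_one]
  counit_left := map_one _
  counit_right := map_one _

theorem ext_counitId_inl_mul_inr (a b : PowerSeries (U K L)) :
    ext (counitId K L) (ext (inl K L) a * ext (inr K L) b) =
      ext (Algebra.ofId K (U K L)) (ext (counit K L) a) * b := by
  rw [map_mul, ext_comp_congr (counitId_comp_inl (K := K) (L := L)),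
    ext_comp_apply (counitId_comp_inr (K := K) (L := L)), ext_id]

theorem ext_idCounit_inl_mul_inr (a b : PowerSeries (U K L)) :
    ext (idCounit K L) (ext (inl K L) a * ext (inr K L) b) =
      a * ext (Algebra.ofId K (U K L)) (ext (counit K L) b) := by
  rw [map_mul, ext_comp_congr (idCounit_comp_inr (K := K) (L := L)),
    ext_comp_apply (idCounit_comp_inl (K := K) (L := L)), ext_id]

end RelativeTwist

/-! ### Jordanian factors exp(H ⊗ ln(1 + x)). -/

section Jordanian

open PowerSeries

variable {K : Type*} [Field K] [CharZero K] {L : Type*} [LieRing L] [LieAlgebra K L]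
  {F : PowerSeries (U2 K L)} {H x y : PowerSeries (U K L)}

variable (K) in
/-- The Jordanian factor `exp (H ⊗ ln (1 + x))`. -/
def jordanian (H x : PowerSeries (U K L)) : PowerSeries (U2 K L) :=
  fexp K (ext (inl K L) H * ext (inr K L) (flog1p K x))

theorem constantCoeff_inl_mul_inr_flog1p (H x : PowerSeries (U K L)) :
    constantCoeff (ext (inl K L) H * ext (inr K L) (flog1p K x)) = 0 := by
  rw [map_mul, constantCoeff_ext (constantCoeff_flog1p x), mul_zero]

theorem isUnit_jordanian : IsUnit (jordanian K H x) :=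
  isUnit_fexp K (constantCoeff_inl_mul_inr_flog1p H x)

theorem commute_flog1p (hx0 : constantCoeff x = 0) (hxy : Commute x y) :
    Commute (flog1p K x) y :=
  Commute.symm (FullChain.SemiconjBy.flog1p hxy.symm hx0 hx0)

/-- If `y` has weight `c`, then y(H + c) = Hy, so y ⊗ 1 intertwines H ⊗ σ + c(1 ⊗ σ) with H ⊗ σ.
Exponentiating, the two commuting summands separate. -/
theorem jordanian_mul_inl {c : K} (hy : H * y = y * H + c • y) :
    jordanian K H x * ext (inl K L) y =
      ext (inl K L) y * ext (inr K L) (fexp K (c • flog1p K x)) * jordanian K H x := by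
  have h1 : constantCoeff (ext (inr K L) (c • flog1p K x)) = 0 :=
    constantCoeff_ext (constantCoeff_smul (constantCoeff_flog1p x) c) _
  have h0 := constantCoeff_inl_mul_inr_flog1p (K := K) H x
  have hc : Commute (ext (inr K L) (c • flog1p K x))
      (ext (inl K L) H * ext (inr K L) (flog1p K x)) := by
    refine (commute_ext_inl_inr _ _).symm.mul_right ?_
    rw [ext_smul]
    exact (Commute.refl _).smul_left c
  have hs : SemiconjBy (ext (inl K L) y)
      (ext (inr K L) (c • flog1p K x) + ext (inl K L) H * ext (inr K L) (flog1p K x))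
      (ext (inl K L) H * ext (inr K L) (flog1p K x)) := by
    have hy' := congrArg (ext (inl K L)) hy
    rw [map_mul, map_add, map_mul, ext_smul] at hy'
    rw [SemiconjBy, mul_assoc, (commute_ext_inl_inr y (flog1p K x)).symm.eq, ← mul_assoc, hy',
      ext_smul, mul_add, add_mul, ← mul_assoc, add_comm, smul_mul_assoc, mul_smul_comm]
  have := FullChain.SemiconjBy.fexp (K := K) hs (by rw [map_add, h1, h0, add_zero]) h0
  rw [SemiconjBy, fexp_add K hc h1 h0, ← ext_fexp, ← mul_assoc] at this
  exact this.symm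

theorem commute_jordanian_inr (hx0 : constantCoeff x = 0) (hxy : Commute x y) :
    Commute (jordanian K H x) (ext (inr K L) y) := by
  have h0 := constantCoeff_inl_mul_inr_flog1p (K := K) H x
  refine (FullChain.SemiconjBy.fexp (K := K) ?_ h0 h0).symm
  exact (commute_ext_inl_inr _ _).symm.mul_right
    ((commute_flog1p hx0 hxy).symm.map (ext (inr K L)))

/-- The coproduct, twisted by a Jordanian factor, of an element of weight `c`. -/
theorem twistedComul_jordanian_mul (hF : IsUnit F) (hx0 : constantCoeff x = 0)
    (hyp : twistedComul F y = ext (inl K L) y + ext (inr K L) y) {c : K}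
    (hy : H * y = y * H + c • y) (hxy : Commute x y) :
    twistedComul (jordanian K H x * F) y =
      ext (inl K L) y * ext (inr K L) (fexp K (c • flog1p K x)) + ext (inr K L) y := by
  refine twistedComul_mul_of_semiconj isUnit_jordanian hF ?_
  rw [hyp, SemiconjBy, mul_add, add_mul, jordanian_mul_inl hy,
    (commute_jordanian_inr hx0 hxy).eq]

theorem twistedComul_jordanian_mul_of_commute (hF : IsUnit F) (hx0 : constantCoeff x = 0)
    (hyp : twistedComul F y = ext (inl K L) y + ext (inr K L) y)
    (hy : Commute H y) (hxy : Commute x y) :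
    twistedComul (jordanian K H x * F) y = ext (inl K L) y + ext (inr K L) y := by
  rw [twistedComul_jordanian_mul hF hx0 hyp (c := 0) (by rw [zero_smul, add_zero, hy.eq]) hxy,
    zero_smul, fexp_zero, map_one, mul_one]

/-- Since exp(σ) = 1 + x and `x` has weight one, the factor carries x ⊗ 1 + 1 ⊗ x to x ⊗ (1 + x) + 1
⊗ x. Adding one gives (1 + x) ⊗ (1 + x), that is, 1 + x becomes group-like and σ primitive. -/
theorem jordanian_mul_twistedComul_flog1p (hF : IsUnit F) (hx0 : constantCoeff x = 0)
    (hxp : twistedComul F x = ext (inl K L) x + ext (inr K L) x) (hHx : H * x = x * H + x) :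
    SemiconjBy (jordanian K H x) (twistedComul F (flog1p K x))
      (ext (inl K L) (flog1p K x) + ext (inr K L) (flog1p K x)) := by
  have hl := constantCoeff_ext hx0 (inl K L)
  have hr := constantCoeff_ext hx0 (inr K L)
  rw [twistedComul_flog1p hF hx0, hxp, ext_flog1p, ext_flog1p,
    ← flog1p_mul K (commute_ext_inl_inr x x) hl hr]
  refine FullChain.SemiconjBy.flog1p ?_ ?_ ?_
  · have h1 := jordanian_mul_inl (K := K) (x := x) (y := x) (c := 1) (by rw [one_smul, hHx])
    rw [one_smul, fexp_flog1p K hx0, map_add, map_one] at h1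
    rw [SemiconjBy, mul_add, h1, (commute_jordanian_inr hx0 (Commute.refl x)).eq, ← add_mul]
    congr 1
    noncomm_ring
  · rw [map_add, hl, hr, add_zero]
  · rw [map_sub, map_mul, map_add, map_add, map_one, hl, hr, add_zero, mul_one, sub_self]

theorem twistedComul_jordanian_mul_flog1p (hF : IsUnit F) (hx0 : constantCoeff x = 0)
    (hxp : twistedComul F x = ext (inl K L) x + ext (inr K L) x) (hHx : H * x = x * H + x) :
    twistedComul (jordanian K H x * F) (flog1p K x) =
      ext (inl K L) (flog1p K x) + ext (inr K L) (flog1p K x) :=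
  twistedComul_mul_of_semiconj isUnit_jordanian hF
    (jordanian_mul_twistedComul_flog1p hF hx0 hxp hHx)

/-- A Jordanian factor built from primitive elements `H`, `x` of `Δ_F` with `[H, x] = x` is a
twisting element for `Δ_F`. -/
theorem isRelTwist_jordanian (hF : IsUnit F) (hx0 : constantCoeff x = 0)
    (hHp : twistedComul F H = ext (inl K L) H + ext (inr K L) H)
    (hxp : twistedComul F x = ext (inl K L) x + ext (inr K L) x) (hHx : H * x = x * H + x)
    (hH : ext (counit K L) H = 0) (hx : ext (counit K L) x = 0) :
    IsRelTwist F (jordanian K H x) where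
  isUnit := isUnit_jordanian
  cocycle := by
    have h0 := constantCoeff_inl_mul_inr_flog1p (K := K) H x
    have c12 := commute_ext (commute_slot1_slot2 (K := K) (L := L))
    have c13 := commute_ext (commute_slot1_slot3 (K := K) (L := L))
    have c23 := commute_ext (commute_slot2_slot3 (K := K) (L := L))
    have hγ : ∀ φ : U K L →ₐ[K] U3 K L, constantCoeff (ext φ (flog1p K x)) = 0 :=
      constantCoeff_ext (constantCoeff_flog1p x)
    have e12 : ext (leg12 K L) (jordanian K H x) =
        fexp K (ext (slot1 K L) H * ext (slot2 K L) (flog1p K x)) := by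
      rw [jordanian, ext_fexp, map_mul, ext_ext, ext_ext, slot1, slot2]
    have e23 : ext (leg23 K L) (jordanian K H x) =
        fexp K (ext (slot2 K L) H * ext (slot3 K L) (flog1p K x)) := by
      rw [jordanian, ext_fexp, map_mul, ext_ext, ext_ext, leg23_comp_inl, leg23_comp_inr]
    -- Primitivity of `H` splits the exponent into H ⊗ 1 ⊗ σ and 1 ⊗ H ⊗ σ.
    have e1 : twistedComulId F (jordanian K H x) =
        fexp K (ext (slot1 K L) H * ext (slot3 K L) (flog1p K x)) *
          ext (leg23 K L) (jordanian K H x) := by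
      rw [e23, ← fexp_add K, jordanian, twistedComulId_fexp hF h0, twistedComulId_inl_mul_inr hF,
        hHp, map_add, ext_ext, ext_ext, add_mul, slot1, slot2]
      · exact ((c12 _ _).mul_right (c13 _ _)).mul_left
          ((c23 _ _).symm.mul_right (Commute.refl _))
      · rw [map_mul, hγ, mul_zero]
      · rw [map_mul, hγ, mul_zero]
    -- Here the primitivity of σ after conjugation by the factor in legs 2 and 3 is used. Both sides
    -- of the twist equation then become exp(H ⊗ σ ⊗ 1) exp(H ⊗ 1 ⊗ σ) exp(1 ⊗ H ⊗ σ).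
    have e2 : ext (leg23 K L) (jordanian K H x) * idTwistedComul F (jordanian K H x) =
        fexp K (ext (slot1 K L) H * ext (slot2 K L) (flog1p K x) +
          ext (slot1 K L) H * ext (slot3 K L) (flog1p K x)) *
            ext (leg23 K L) (jordanian K H x) := by
      have hs := congrArg (ext (leg23 K L))
        (jordanian_mul_twistedComul_flog1p hF hx0 hxp hHx).eq
      rw [map_mul, map_mul, map_add, ext_ext _ (inl K L), ext_ext _ (inr K L), leg23_comp_inl,
        leg23_comp_inr] at hs
      conv_lhs => arg 2; rw [jordanian, idTwistedComul_fexp hF h0, idTwistedComul_inl_mul_inr hF]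
      rw [← mul_add]
      refine FullChain.SemiconjBy.fexp ?_ ?_ ?_
      · have hc : Commute (ext (slot1 K L) H) (ext (leg23 K L) (jordanian K H x)) :=
          commute_ext (commute_slot1_leg23 (K := K) (L := L)) _ _
        rw [SemiconjBy, ← mul_assoc, ← hc.eq, mul_assoc, hs, ← mul_assoc]
      · have h1 : constantCoeff (twistedComul F (flog1p K x)) = 0 :=
          constantCoeff_twisted (constantCoeff_ext (constantCoeff_flog1p x) _) _ _
        rw [map_mul, constantCoeff_ext h1, mul_zero]
      · rw [map_mul, map_add, hγ, hγ, add_zero, mul_zero]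
    rw [e1, e2, e12, ← mul_assoc, ← fexp_add K]
    · exact ((Commute.refl _).mul_right (c13 _ _)).mul_left
        ((c12 _ _).symm.mul_right (c23 _ _))
    · rw [map_mul, hγ, mul_zero]
    · rw [map_mul, hγ, mul_zero]
  counit_left := by
    rw [jordanian, ext_fexp, ext_counitId_inl_mul_inr, hH, map_zero, zero_mul, fexp_zero]
  counit_right := by
    rw [jordanian, ext_fexp, ext_idCounit_inl_mul_inr, ext_flog1p, hx, flog1p_zero, map_zero,
      mul_zero, fexp_zero]

end Jordanian

/-! ### Extension factors and the deformed primitive element. -/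

section Extension

open PowerSeries

variable {K : Type*} [Field K] {L : Type*} [LieRing L] [LieAlgebra K L]
  {F : PowerSeries (U2 K L)} {ι : Type*}

variable (K) in
/-- The extension factor `exp (∑ eⱼ ⊗ fⱼ s)`. -/
def extension (S : Finset ι) (e f : ι → PowerSeries (U K L)) (s : PowerSeries (U K L)) :
    PowerSeries (U2 K L) :=
  fexp K (∑ j ∈ S, ext (inl K L) (e j) * ext (inr K L) (f j * s))

/-- The commutation relations of the carrier of an extension factor: `t` plays the role of
`exp (σ / 2)` and `s` that of `exp (-σ / 2)`. -/
structure ExtensionRelations (S : Finset ι) (e f : ι → PowerSeries (U K L))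
    (s t : PowerSeries (U K L)) : Prop where
  constantCoeff_e : ∀ j ∈ S, constantCoeff (e j) = 0
  counit_e : ∀ j ∈ S, ext (counit K L) (e j) = 0
  counit_f : ∀ j ∈ S, ext (counit K L) (f j) = 0
  e_e : ∀ i ∈ S, ∀ j ∈ S, Commute (e i) (e j)
  f_f : ∀ i ∈ S, ∀ j ∈ S, Commute (f i) (f j)
  s_e : ∀ j ∈ S, Commute s (e j)
  s_f : ∀ j ∈ S, Commute s (f j)
  t_e : ∀ j ∈ S, Commute t (e j)
  t_f : ∀ j ∈ S, Commute t (f j)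
  s_t : s * t = 1
  t_s : t * s = 1
  e_f : ∀ i ∈ S, e i * f i = f i * e i + (t * t - 1)
  e_f_ne : ∀ i ∈ S, ∀ j ∈ S, i ≠ j → e i * f j = f j * e i

/-- The coproduct `Δ_F` on the carrier of an extension factor, `F` being a Jordanian twist. -/
structure ExtensionCoproduct (F : PowerSeries (U2 K L)) (S : Finset ι)
    (e f : ι → PowerSeries (U K L)) (s t : PowerSeries (U K L)) : Prop where
  e : ∀ j ∈ S, twistedComul F (e j) =
    ext (inl K L) (e j) * ext (inr K L) t + ext (inr K L) (e j)
  f : ∀ j ∈ S, twistedComul F (f j) =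
    ext (inl K L) (f j) * ext (inr K L) t + ext (inr K L) (f j)
  s : twistedComul F s = ext (inl K L) s * ext (inr K L) s

variable {S : Finset ι} {e f : ι → PowerSeries (U K L)} {s t : PowerSeries (U K L)}

theorem ExtensionRelations.constantCoeff (h : ExtensionRelations S e f s t) :
    constantCoeff (∑ j ∈ S, ext (inl K L) (e j) * ext (inr K L) (f j * s)) = 0 :=
  constantCoeff_sum_mul S (fun j hj => constantCoeff_ext (h.constantCoeff_e j hj) _) _

/-- `∑ eⱼ ⊗ z ⊗ fⱼ s`. -/
def middle (S : Finset ι) (e f : ι → PowerSeries (U K L)) (s z : PowerSeries (U K L)) :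
    PowerSeries (U3 K L) :=
  ∑ j ∈ S, ext (slot1 K L) (e j) * ext (slot2 K L) z * ext (slot3 K L) (f j * s)

theorem commute_slots {a₁ a₂ a₃ b₁ b₂ b₃ : PowerSeries (U K L)} (h₁ : Commute a₁ b₁)
    (h₂ : Commute a₂ b₂) (h₃ : Commute a₃ b₃) :
    Commute (ext (slot1 K L) a₁ * ext (slot2 K L) a₂ * ext (slot3 K L) a₃)
      (ext (slot1 K L) b₁ * ext (slot2 K L) b₂ * ext (slot3 K L) b₃) := by
  have c12 := commute_ext (commute_slot1_slot2 (K := K) (L := L))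
  have c13 := commute_ext (commute_slot1_slot3 (K := K) (L := L))
  have c23 := commute_ext (commute_slot2_slot3 (K := K) (L := L))
  exact ((((h₁.map _).mul_right (c12 _ _)).mul_right (c13 _ _)).mul_left
    (((c12 _ _).symm.mul_right (h₂.map _)).mul_right (c23 _ _))).mul_left
    (((c13 _ _).symm.mul_right (c23 _ _).symm).mul_right (h₃.map _))

theorem slots_mul_slots (a₁ a₂ a₃ b₁ b₂ b₃ : PowerSeries (U K L)) :
    (ext (slot1 K L) a₁ * ext (slot2 K L) a₂ * ext (slot3 K L) a₃) *
      (ext (slot1 K L) b₁ * ext (slot2 K L) b₂ * ext (slot3 K L) b₃) =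
      ext (slot1 K L) (a₁ * b₁) * ext (slot2 K L) (a₂ * b₂) * ext (slot3 K L) (a₃ * b₃) := by
  have c12 := commute_ext (commute_slot1_slot2 (K := K) (L := L)) b₁ a₂
  have c13 := commute_ext (commute_slot1_slot3 (K := K) (L := L)) b₁ a₃
  have c23 := commute_ext (commute_slot2_slot3 (K := K) (L := L)) b₂ a₃
  simp only [map_mul, mul_assoc]
  rw [← mul_assoc (ext (slot3 K L) a₃) (ext (slot1 K L) b₁), ← c13.eq,
    mul_assoc (ext (slot1 K L) b₁), ← mul_assoc (ext (slot2 K L) a₂) (ext (slot1 K L) b₁),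
    ← c12.eq, mul_assoc (ext (slot1 K L) b₁), ← mul_assoc (ext (slot3 K L) a₃), ← c23.eq,
    mul_assoc (ext (slot2 K L) b₂)]

theorem ext_leg12_inl_mul_inr (a b : PowerSeries (U K L)) :
    ext (leg12 K L) (ext (inl K L) a * ext (inr K L) b) =
      ext (slot1 K L) a * ext (slot2 K L) b * ext (slot3 K L) 1 := by
  rw [map_mul, ext_ext, ext_ext, map_one, mul_one, slot1, slot2]

theorem ext_leg23_inl_mul_inr (a b : PowerSeries (U K L)) :
    ext (leg23 K L) (ext (inl K L) a * ext (inr K L) b) =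
      ext (slot1 K L) 1 * ext (slot2 K L) a * ext (slot3 K L) b := by
  rw [map_mul, ext_ext, ext_ext, map_one, one_mul, leg23_comp_inl, leg23_comp_inr]

namespace ExtensionRelations

variable (h : ExtensionRelations S e f s t)
include h

theorem commute_fs {i j : ι} (hi : i ∈ S) (hj : j ∈ S) : Commute (f i * s) (f j * s) :=
  ((h.f_f i hi j hj).mul_right (h.s_f i hi).symm).mul_left
    ((h.s_f j hj).mul_right (Commute.refl _))

theorem commute_middle_middle {z z' : PowerSeries (U K L)} (hz : Commute z z') :
    Commute (middle S e f s z) (middle S e f s z') :=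
  Commute.sum_left _ _ _ fun i hi => Commute.sum_right _ _ _ fun j hj =>
    commute_slots (h.e_e i hi j hj) hz (h.commute_fs hi hj)

theorem commute_middle_leg12 {z : PowerSeries (U K L)} (hs : Commute z s)
    (hf : ∀ j ∈ S, Commute z (f j)) : Commute (middle S e f s z) (ext (leg12 K L)
      (∑ j ∈ S, ext (inl K L) (e j) * ext (inr K L) (f j * s))) := by
  rw [map_sum]
  refine Commute.sum_left _ _ _ fun i hi => Commute.sum_right _ _ _ fun j hj => ?_
  rw [ext_leg12_inl_mul_inr]
  exact commute_slots (h.e_e i hi j hj) ((hf j hj).mul_right hs) (Commute.one_right _)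

theorem commute_middle_leg23 {z : PowerSeries (U K L)} (he : ∀ j ∈ S, Commute z (e j)) :
    Commute (middle S e f s z) (ext (leg23 K L)
      (∑ j ∈ S, ext (inl K L) (e j) * ext (inr K L) (f j * s))) := by
  rw [map_sum]
  refine Commute.sum_left _ _ _ fun i hi => Commute.sum_right _ _ _ fun j hj => ?_
  rw [ext_leg23_inl_mul_inr]
  exact commute_slots (Commute.one_right _) (he j hj) (h.commute_fs hi hj)

/-- The choice s = t⁻¹ turns the bracket t² - 1 into (t² - 1)s = t - s. -/
theorem e_mul_fs [DecidableEq ι] {i j : ι} (hi : i ∈ S) (hj : j ∈ S) :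
    e i * (f j * s) = f j * s * e i + if i = j then t - s else 0 := by
  have hts : (t * t - 1) * s = t - s := by
    rw [sub_mul, one_mul, mul_assoc, h.t_s, mul_one]
  split_ifs with hij
  · subst hij
    rw [← mul_assoc, h.e_f i hi, add_mul, hts, mul_assoc, mul_assoc, (h.s_e i hi).eq]
  · rw [← mul_assoc, h.e_f_ne i hi j hj hij, add_zero, mul_assoc, mul_assoc, (h.s_e i hi).eq]

/-- Legs 1 and 3 contribute only commuting factors, so the commutator comes from eᵢ against fⱼ s in
leg 2. Only i = j survives, leaving ∑ eⱼ ⊗ (t - s) ⊗ fⱼ s. -/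
theorem leg23_mul_leg12 :
    ext (leg23 K L) (∑ j ∈ S, ext (inl K L) (e j) * ext (inr K L) (f j * s)) *
        ext (leg12 K L) (∑ j ∈ S, ext (inl K L) (e j) * ext (inr K L) (f j * s)) =
      ext (leg12 K L) (∑ j ∈ S, ext (inl K L) (e j) * ext (inr K L) (f j * s)) *
        ext (leg23 K L) (∑ j ∈ S, ext (inl K L) (e j) * ext (inr K L) (f j * s)) +
      (middle S e f s t - middle S e f s s) := by
  classical
  have hd : middle S e f s t - middle S e f s s = middle S e f s (t - s) := by
    simp only [middle, map_sub, mul_sub, sub_mul, Finset.sum_sub_distrib]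
  rw [hd, map_sum, map_sum, Finset.sum_mul_sum, Finset.sum_mul_sum,
    Finset.sum_comm (f := fun i j => ext (leg12 K L) _ * ext (leg23 K L) _), middle,
    ← Finset.sum_add_distrib]
  refine Finset.sum_congr rfl fun i hi => ?_
  have hterm : ∀ j ∈ S, ext (leg23 K L) (ext (inl K L) (e i) * ext (inr K L) (f i * s)) *
        ext (leg12 K L) (ext (inl K L) (e j) * ext (inr K L) (f j * s)) =
      ext (leg12 K L) (ext (inl K L) (e j) * ext (inr K L) (f j * s)) *
        ext (leg23 K L) (ext (inl K L) (e i) * ext (inr K L) (f i * s)) +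
      if i = j then ext (slot1 K L) (e i) * ext (slot2 K L) (t - s) *
        ext (slot3 K L) (f i * s) else 0 := fun j hj => by
    rw [ext_leg12_inl_mul_inr, ext_leg23_inl_mul_inr, slots_mul_slots, slots_mul_slots,
      h.e_mul_fs hi hj, one_mul, mul_one, one_mul, mul_one, map_add, mul_add, add_mul]
    congr 1
    split_ifs with hij
    · rw [hij]
    · rw [map_zero, mul_zero, zero_mul]
  rw [Finset.sum_congr rfl hterm, Finset.sum_add_distrib, Finset.sum_ite_eq, if_pos hi]

end ExtensionRelations

variable [CharZero K]

theorem ExtensionRelations.isUnit (h : ExtensionRelations S e f s t) :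
    IsUnit (extension K S e f s) :=
  isUnit_fexp K h.constantCoeff

/-- An extension factor is a twisting element for the coproduct twisted by a Jordanian factor. -/
theorem isRelTwist_extension (h : ExtensionRelations S e f s t) (hF : IsUnit F)
    (hΔ : ExtensionCoproduct F S e f s t) : IsRelTwist F (extension K S e f s) where
  isUnit := h.isUnit
  cocycle := by
    set u := ∑ j ∈ S, ext (inl K L) (e j) * ext (inr K L) (f j * s) with hu
    have hu0 : constantCoeff u = 0 := h.constantCoeff
    have hm0 : ∀ z, constantCoeff (middle S e f s z) = 0 := fun z => by
      simp only [middle, mul_assoc]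
      exact constantCoeff_sum_mul S (fun j hj => constantCoeff_ext (h.constantCoeff_e j hj) _) _
    have e1 : twistedComulId F u = ext (leg23 K L) u + middle S e f s t := by
      rw [hu, twistedComulId_sum, map_sum, middle, ← Finset.sum_add_distrib]
      refine Finset.sum_congr rfl fun j hj => ?_
      rw [twistedComulId_inl_mul_inr hF, hΔ.e j hj, map_add, map_mul, ext_ext, ext_ext, ext_ext,
        ext_leg23_inl_mul_inr, map_one, one_mul, slot1, slot2, add_mul, add_comm]
    have e2 : idTwistedComul F u = ext (leg12 K L) u + middle S e f s s := by
      rw [hu, idTwistedComul_sum, map_sum, middle, ← Finset.sum_add_distrib]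
      refine Finset.sum_congr rfl fun j hj => ?_
      -- In (f ⊗ t + 1 ⊗ f)(s ⊗ s) the second leg of the first term cancels because t s = 1; this is
      -- the purpose of the factor `s` in the exponent.
      have hfs : twistedComul F (f j * s) = ext (inl K L) (f j * s) +
          ext (inl K L) s * ext (inr K L) (f j * s) := by
        rw [twistedComul_mul hF, hΔ.f j hj, hΔ.s, add_mul, map_mul, map_mul, mul_assoc,
          ← mul_assoc (ext (inr K L) t), ← (commute_ext_inl_inr s t).eq,
          mul_assoc (ext (inl K L) s), ← map_mul (ext (inr K L)) t, h.t_s, map_one, mul_one,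
          ← mul_assoc (ext (inr K L) (f j)), ← (commute_ext_inl_inr s (f j)).eq, mul_assoc]
      rw [idTwistedComul_inl_mul_inr hF, hfs, map_add,
        ext_comp_apply (leg23_comp_inl (K := K) (L := L)), ext_leg23_inl_mul_inr,
        ext_leg12_inl_mul_inr, map_one, map_one, one_mul, mul_one, mul_add, mul_assoc]
    have hst : Commute s t := by rw [Commute, SemiconjBy, h.s_t, h.t_s]
    have cs12 := h.commute_middle_leg12 (Commute.refl s) h.s_f
    have ct12 := h.commute_middle_leg12 hst.symm h.t_f
    have cs23 := h.commute_middle_leg23 h.s_e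
    have ct23 := h.commute_middle_leg23 h.t_e
    have cst := h.commute_middle_middle hst
    have hcomm := h.leg23_mul_leg12
    rw [← hu] at cs12 ct12 cs23 ct23 hcomm
    have h12 := constantCoeff_ext hu0 (leg12 K L)
    have h23 := constantCoeff_ext hu0 (leg23 K L)
    have c23 : Commute (ext (leg23 K L) u) (middle S e f s t - middle S e f s s) :=
      ct23.symm.sub_right cs23.symm
    -- With m_z = `middle S e f s z`, the commutator [u₂₃, u₁₂] = m_t - m_s commutes with u₂₃, so
    -- exp(u₂₃) exp(u₁₂ - m_t + m_s) = exp(u₁₂) exp(u₂₃). Multiplying by exp(m_t) on the right gives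
    -- exp(u₂₃) exp(u₁₂ + m_s), which is the twist equation.
    have hs : SemiconjBy (fexp K (ext (leg23 K L) u))
        (ext (leg12 K L) u - (middle S e f s t - middle S e f s s)) (ext (leg12 K L) u) := by
      have h1 := fexp_mul_of_ad_nilpotent K (w := 0) h23 hcomm (by rw [c23.eq, add_zero])
        (Commute.zero_right _)
      have h2 : Commute (fexp K (ext (leg23 K L) u))
          (middle S e f s t - middle S e f s s) :=
        (FullChain.SemiconjBy.fexp c23.symm h23 h23).symm
      rw [smul_zero, add_zero] at h1
      rw [SemiconjBy, mul_sub, h1, h2.eq, add_mul, add_sub_cancel_right]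
    have hs' := FullChain.SemiconjBy.fexp (K := K) hs
      (by rw [map_sub, map_sub, h12, hm0, hm0, sub_zero, sub_zero]) h12
    rw [extension, twistedComulId_fexp hF hu0, idTwistedComul_fexp hF hu0, ext_fexp, ext_fexp,
      e1, e2, fexp_add K ct23.symm h23 (hm0 t), ← mul_assoc, ← hs'.eq, mul_assoc, ← fexp_add K]
    · rw [sub_sub_eq_add_sub, sub_add_cancel]
    · exact ct12.symm.sub_left ((Commute.refl _).sub_left cst)
    · rw [map_sub, map_sub, h12, hm0, hm0, sub_zero, sub_zero]
    · exact hm0 t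
  counit_left := by
    rw [extension, ext_fexp, map_sum, Finset.sum_eq_zero, fexp_zero]
    intro j hj
    rw [ext_counitId_inl_mul_inr, h.counit_e j hj, map_zero, zero_mul]
  counit_right := by
    rw [extension, ext_fexp, map_sum, Finset.sum_eq_zero, fexp_zero]
    intro j hj
    rw [ext_idCounit_inl_mul_inr, map_mul, h.counit_f j hj, zero_mul, map_zero, mul_zero]

theorem twistedComul_extension_mul_of_commute (h : ExtensionRelations S e f s t) (hF : IsUnit F)
    {y : PowerSeries (U K L)} {z : PowerSeries (U2 K L)} (hy : twistedComul F y = z)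
    (hz : Commute (∑ j ∈ S, ext (inl K L) (e j) * ext (inr K L) (f j * s)) z) :
    twistedComul (extension K S e f s * F) y = z :=
  twistedComul_mul_of_semiconj h.isUnit hF (by
    rw [hy]
    exact (FullChain.SemiconjBy.fexp hz.symm h.constantCoeff h.constantCoeff).symm)

/-- The element `ε - ½ ∑ eⱼ eⱼ'` is primitive with respect to the coproduct twisted by an
extension factor. -/
theorem twistedComul_extension_mul_deformed (h : ExtensionRelations S e f s t) (hF : IsUnit F)
    (hΔ : ExtensionCoproduct F S e f s t) {ε : PowerSeries (U K L)} {τ : ι → ι}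
    (hτ : ∀ j ∈ S, τ j ∈ S) (hττ : ∀ j ∈ S, τ (τ j) = j)
    (hε : twistedComul F ε = ext (inl K L) ε + ext (inr K L) ε)
    (hεs : Commute ε s) (hεe : ∀ j ∈ S, Commute ε (e j))
    (hεf : ∀ j ∈ S, ε * f j = f j * ε - e (τ j)) :
    twistedComul (extension K S e f s * F) (ε - (2⁻¹ : K) • ∑ j ∈ S, e j * e (τ j)) =
      ext (inl K L) (ε - (2⁻¹ : K) • ∑ j ∈ S, e j * e (τ j)) +
        ext (inr K L) (ε - (2⁻¹ : K) • ∑ j ∈ S, e j * e (τ j)) := by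
  classical
  set u := ∑ j ∈ S, ext (inl K L) (e j) * ext (inr K L) (f j * s) with hu
  set q := (2⁻¹ : K) • ∑ j ∈ S, e j * e (τ j) with hq
  set v := ∑ j ∈ S, ext (inl K L) (e j) * ext (inr K L) (e (τ j) * t) with hv
  have hst : Commute s t := by rw [Commute, SemiconjBy, h.s_t, h.t_s]
  have h2q : (2 : K) • q = ∑ j ∈ S, e j * e (τ j) := by
    rw [hq, smul_smul, mul_inv_cancel₀ two_ne_zero, one_smul]
  have hqe : ∀ j ∈ S, Commute q (e j) := fun j hj =>
    (Commute.sum_left _ _ _ fun i hi =>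
      (h.e_e i hi j hj).mul_left (h.e_e _ (hτ i hi) j hj)).smul_left _
  have hqz : ∀ z, (∀ j ∈ S, Commute z (e j)) → Commute q z := fun z hz =>
    (Commute.sum_left _ _ _ fun i hi =>
      ((hz i hi).symm.mul_left (hz _ (hτ i hi)).symm)).smul_left _
  have htt : ∀ {i j : ι}, i ∈ S → j ∈ S →
      e i * f j = f j * e i + if i = j then t * t - 1 else 0 := fun {i j} hi hj => by
    split_ifs with hij
    · subst hij
      exact h.e_f i hi
    · rw [h.e_f_ne i hi j hj hij, add_zero]
  have hx : ∀ j ∈ S, Commute (e j) (t * t - 1) := fun j hj =>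
    ((h.t_e j hj).symm.mul_right (h.t_e j hj).symm).sub_right (Commute.one_right _)
  -- Each fⱼ meets the quadratic sum twice, through i = j and i = τ j. The factor ½ cancels this
  -- doubling, also when τ fixes `j`, where both contributions come from one summand.
  have hqf : ∀ j ∈ S, q * f j = f j * q + e (τ j) * (t * t - 1) := fun j hj => by
    have h1 : (∑ i ∈ S, e i * e (τ i)) * f j =
        f j * (∑ i ∈ S, e i * e (τ i)) + (2 : K) • (e (τ j) * (t * t - 1)) := by
      have hterm : ∀ i ∈ S, e i * e (τ i) * f j = f j * (e i * e (τ i)) +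
          ((if j = τ i then e i * (t * t - 1) else 0) +
            (if j = i then (t * t - 1) * e (τ i) else 0)) := fun i hi => by
        rw [mul_assoc, htt (hτ i hi) hj, mul_add, ← mul_assoc, htt hi hj, add_mul, mul_assoc]
        simp only [mul_ite, ite_mul, mul_zero, zero_mul, eq_comm (a := j)]
        rw [add_assoc, add_comm (ite _ _ _)]
      have hτeq : ∀ i ∈ S, (j = τ i) = (τ j = i) := fun i hi =>
        propext ⟨fun h => by rw [h, hττ i hi], fun h => by rw [← h, hττ j hj]⟩
      rw [Finset.sum_mul, Finset.sum_congr rfl hterm, Finset.sum_add_distrib,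
        Finset.sum_add_distrib, Finset.sum_ite_eq, if_pos hj, ← Finset.mul_sum]
      congr 1
      have h3 : ∑ i ∈ S, (if j = τ i then e i * (t * t - 1) else 0) =
          ∑ i ∈ S, (if τ j = i then e i * (t * t - 1) else 0) :=
        Finset.sum_congr rfl fun i hi => by simp only [hτeq i hi]
      rw [h3, Finset.sum_ite_eq, if_pos (hτ j hj), (hx _ (hτ j hj)).eq, two_smul]
    rw [hq, smul_mul_assoc, h1, smul_add, smul_smul, inv_mul_cancel₀ two_ne_zero, one_smul,
      mul_smul_comm]
  -- The bracket of ε with fⱼ supplies the missing -1 of -(t² - 1), so the total is -e_{τj} t², and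
  -- t² s = t.
  have hyf : ∀ j ∈ S, (ε - q) * (f j * s) = f j * s * (ε - q) - e (τ j) * t := fun j hj => by
    have hc : Commute (ε - q) s := hεs.sub_left (hqz s h.s_e)
    have h1 : (ε - q) * f j = f j * (ε - q) - e (τ j) * (t * t) := by
      rw [sub_mul, hεf j hj, hqf j hj]
      noncomm_ring
    rw [← mul_assoc, h1, sub_mul, mul_assoc, hc.eq, mul_assoc (e (τ j)), mul_assoc t, h.t_s,
      mul_one, mul_assoc]
  -- The mixed terms form two sums exchanged by τ, both equal to `v`; the factor ½ leaves one of
  -- them.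
  have hDq : twistedComul F q =
      ext (inl K L) q * ext (inr K L) (t * t) + ext (inr K L) q + v := by
    have hterm : ∀ j ∈ S, twistedComul F (e j * e (τ j)) =
        ext (inl K L) (e j * e (τ j)) * ext (inr K L) (t * t) + ext (inr K L) (e j * e (τ j)) +
          (ext (inl K L) (e j) * ext (inr K L) (e (τ j) * t) +
            ext (inl K L) (e (τ j)) * ext (inr K L) (e j * t)) := fun j hj => by
      have c := commute_ext_inl_inr (K := K) (L := L)
      rw [twistedComul_mul hF, hΔ.e j hj, hΔ.e _ (hτ j hj), ← (h.t_e _ (hτ j hj)).eq]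
      simp only [map_mul, add_mul, mul_add, mul_assoc]
      rw [← mul_assoc (ext (inr K L) t), ← (c (e (τ j)) t).eq,
        ← mul_assoc (ext (inr K L) (e j)), ← (c (e (τ j)) (e j)).eq, mul_assoc, mul_assoc]
      abel
    have hsw : ∑ j ∈ S, ext (inl K L) (e (τ j)) * ext (inr K L) (e j * t) = v := by
      refine Finset.sum_bij' (fun j _ => τ j) (fun j _ => τ j) hτ hτ hττ hττ fun j hj => ?_
      rw [hττ j hj]
    rw [hq, twistedComul_smul, twistedComul_sum, Finset.sum_congr rfl hterm,
      Finset.sum_add_distrib, Finset.sum_add_distrib, Finset.sum_add_distrib, hsw, ← hv,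
      ← two_smul K v, smul_add, smul_smul, inv_mul_cancel₀ two_ne_zero, one_smul, ext_smul,
      ext_smul, map_sum, map_sum, smul_add, ← Finset.sum_mul, smul_mul_assoc]
  have huy : u * ext (inr K L) (ε - q) = ext (inr K L) (ε - q) * u + v := by
    rw [hu, hv, Finset.sum_mul, Finset.mul_sum, ← Finset.sum_add_distrib]
    refine Finset.sum_congr rfl fun j hj => ?_
    rw [← mul_assoc, ← (commute_ext_inl_inr (e j) (ε - q)).eq, mul_assoc, mul_assoc, ← map_mul,
      ← map_mul, hyf j hj, ← mul_add, ← map_add, sub_add_cancel]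
  -- Second commutator: only i = τ j contributes, and ∑ eⱼ e_{τj} = 2q.
  have huv : u * v = v * u + -((2 : K) • (ext (inl K L) q * ext (inr K L) (t * t - 1))) := by
    have hterm : ∀ i ∈ S, ∀ j ∈ S,
        ext (inl K L) (e i) * ext (inr K L) (f i * s) *
          (ext (inl K L) (e j) * ext (inr K L) (e (τ j) * t)) =
        ext (inl K L) (e j) * ext (inr K L) (e (τ j) * t) *
          (ext (inl K L) (e i) * ext (inr K L) (f i * s)) -
        if τ j = i then ext (inl K L) (e j * e (τ j)) * ext (inr K L) (t * t - 1) else 0 :=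
        fun i hi j hj => by
      have c := commute_ext_inl_inr (K := K) (L := L)
      have hmm : ∀ a b a' b', ext (inl K L) a * ext (inr K L) b *
          (ext (inl K L) a' * ext (inr K L) b') =
          ext (inl K L) (a * a') * ext (inr K L) (b * b') := fun a b a' b' => by
        rw [mul_assoc, ← mul_assoc (ext (inr K L) b), ← (c a' b).eq, mul_assoc, ← mul_assoc,
          ← map_mul, ← map_mul]
      have h1 : e (τ j) * t * (f i * s) = f i * s * (e (τ j) * t) +
          if τ j = i then t * t - 1 else 0 := by
        have ht : Commute t (f i * s) := (h.t_f i hi).mul_right hst.symm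
        rw [mul_assoc, ht.eq, ← mul_assoc, h.e_mul_fs (hτ j hj) hi, add_mul, mul_assoc (f i * s)]
        split_ifs
        · rw [sub_mul, h.s_t]
        · rw [zero_mul]
      rw [hmm, hmm, h1, (h.e_e j hj i hi).eq, map_add, mul_add]
      split_ifs with hij
      · rw [hij, (h.e_e j hj i hi).eq, add_sub_cancel_right]
      · rw [map_zero, mul_zero, add_zero, sub_zero]
    rw [hu, hv, Finset.sum_mul_sum, Finset.sum_mul_sum,
      Finset.sum_congr rfl fun i hi => Finset.sum_congr rfl (hterm i hi)]
    simp only [Finset.sum_sub_distrib]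
    rw [Finset.sum_comm, sub_eq_add_neg]
    congr 2
    rw [Finset.sum_comm, ← smul_mul_assoc, ← ext_smul, h2q, map_sum, Finset.sum_mul]
    refine Finset.sum_congr rfl fun j hj => ?_
    rw [Finset.sum_ite_eq, if_pos (hτ j hj)]
  have hu0 : constantCoeff u = 0 := h.constantCoeff
  have cuq : ∀ z, (∀ j ∈ S, Commute (f j * s) z) →
      Commute u (ext (inl K L) q * ext (inr K L) z) := fun z hz =>
    Commute.sum_left _ _ _ fun j hj =>
      (((hqe j hj).symm.map _).mul_right (commute_ext_inl_inr _ _)).mul_left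
        ((commute_ext_inl_inr _ _).symm.mul_right ((hz j hj).map _))
  have hzt : ∀ j ∈ S, Commute (f j * s) (t * t) := fun j hj =>
    (((h.t_f j hj).symm.mul_left hst).mul_right ((h.t_f j hj).symm.mul_left hst))
  have huw := cuq (t * t - 1) fun j hj => (hzt j hj).sub_right (Commute.one_right _)
  have huε : Commute u (ext (inl K L) ε) := Commute.sum_left _ _ _ fun j hj =>
    ((hεe j hj).symm.map _).mul_left (commute_ext_inl_inr _ _).symm
  have hfix : ∀ {z}, Commute u z → Commute (fexp K u) z := fun hz =>
    (FullChain.SemiconjBy.fexp hz.symm hu0 hu0).symm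
  -- Put W = q ⊗ (t² - 1). Conjugation by exp(u) sends 1 ⊗ (ε - q) to 1 ⊗ (ε - q) + v - W and `v` to
  -- v - 2W, and fixes ε ⊗ 1 and q ⊗ t². In the image of Δ_F(ε - q) the terms `v` cancel, and W - q
  -- ⊗ t² = -q ⊗ 1 is what primitivity requires.
  have hE1 := fexp_mul_of_ad_nilpotent K hu0 huy huv (huw.smul_right _).neg_right
  have hE2 := fexp_mul_of_ad_nilpotent K (w := 0) hu0 huv
    (by rw [((huw.smul_right (2 : K)).neg_right).eq, add_zero]) (Commute.zero_right _)
  refine twistedComul_mul_of_semiconj h.isUnit hF ?_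
  have hD : twistedComul F (ε - q) = ext (inl K L) ε + ext (inr K L) (ε - q) - v -
      ext (inl K L) q * ext (inr K L) (t * t) := by
    rw [twistedComul_sub, hε, hDq, map_sub]
    abel
  rw [hD, SemiconjBy, extension, ← hu, mul_sub, mul_sub, mul_add, hE1, hE2, (hfix huε).eq,
    (hfix (cuq _ hzt)).eq, ← add_mul, ← sub_mul, ← sub_mul]
  congr 1
  rw [smul_neg, smul_smul, inv_mul_cancel₀ two_ne_zero, one_smul, smul_zero, add_zero, two_smul,
    map_sub (ext (inl K L)), map_sub (ext (inr K L)) (t * t), map_one]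
  noncomm_ring

end Extension

/-! ### Structure constants of so(M) for the generators of a link. -/

section Brackets

variable {K : Type*} [Field K] {M k : ℕ}

theorem gen_val (i j : Fin M) : (gen K i j : so K M).1 =
    Matrix.single i j 1 - Matrix.single j.rev i.rev 1 := rfl

theorem gen_rev_rev (i j : Fin M) : (gen K j.rev i.rev : so K M) = -gen K i j := by
  refine Subtype.ext ?_
  change (gen K j.rev i.rev : so K M).1 = -(gen K i j : so K M).1
  rw [gen_val, gen_val, Fin.rev_rev, Fin.rev_rev, neg_sub]

theorem gen_rev_self (i : Fin M) : (gen K i i.rev : so K M) = 0 := by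
  refine Subtype.ext ?_
  change (gen K i i.rev : so K M).1 = 0
  rw [gen_val, Fin.rev_rev, sub_self]

theorem gen_rev_comm (i j : Fin M) : gen K i j.rev = -gen K j i.rev := by
  rw [← gen_rev_rev, Fin.rev_rev]

theorem single_mul_single_ite (i j k l : Fin M) :
    Matrix.single i j (1 : K) * Matrix.single k l 1 =
      if j = k then Matrix.single i l 1 else 0 := by
  split_ifs with h
  · subst h
    rw [Matrix.single_mul_single_same, mul_one]
  · rw [Matrix.single_mul_single_of_ne _ _ _ _ h]

/-- Index reversal is expressed additively over ℕ, so that every case condition in the brackets is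
linear arithmetic without truncated subtraction and `omega` can decide it. -/
theorem eq_rev_iff_val (i j : Fin M) : i = j.rev ↔ (i : ℕ) + j + 1 = M := by
  rw [Fin.ext_iff, Fin.val_rev]
  omega

theorem rev_eq_iff_val (i j : Fin M) : i.rev = j ↔ (i : ℕ) + j + 1 = M := by
  rw [Fin.ext_iff, Fin.val_rev]
  omega

theorem gen_mul_gen (i j k l : Fin M) : (gen K i j).1 * (gen K k l).1 =
    (if (j : ℕ) = k then Matrix.single i l 1 else 0) -
      (if (j : ℕ) + l + 1 = M then Matrix.single i k.rev 1 else 0) -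
      (if (i : ℕ) + k + 1 = M then Matrix.single j.rev l 1 else 0) +
      (if (i : ℕ) = l then Matrix.single j.rev k.rev 1 else 0) := by
  rw [gen_val, gen_val, sub_mul, mul_sub, mul_sub, single_mul_single_ite, single_mul_single_ite,
    single_mul_single_ite, single_mul_single_ite]
  simp only [Fin.rev_inj]
  simp only [eq_rev_iff_val, rev_eq_iff_val]
  simp only [Fin.ext_iff]
  abel

/-- The commutation relations of the generators `F_{ij}`. -/
theorem lie_gen_gen (i j k l : Fin M) : ⁅gen K i j, gen K k l⁆ =
    (if (j : ℕ) = k then gen K i l else 0) - (if (i : ℕ) = l then gen K k j else 0) -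
      (if (j : ℕ) + l + 1 = M then gen K i k.rev else 0) +
      (if (i : ℕ) + k + 1 = M then gen K l.rev j else 0) := by
  refine Subtype.ext ?_
  have hval : ∀ (p : Prop) [Decidable p] (x y : Fin M), ((if p then gen K x y else 0)).1 =
      (if p then Matrix.single x y 1 else 0) - if p then Matrix.single y.rev x.rev 1 else 0 :=
    fun p _ x y => by
      split_ifs
      · rfl
      · exact (sub_zero _).symm
  change (gen K i j).1 * (gen K k l).1 - (gen K k l).1 * (gen K i j).1 =
    ((if (j : ℕ) = k then gen K i l else 0)).1 - ((if (i : ℕ) = l then gen K k j else 0)).1 -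
      ((if (j : ℕ) + l + 1 = M then gen K i k.rev else 0)).1 +
      ((if (i : ℕ) + k + 1 = M then gen K l.rev j else 0)).1
  rw [hval, hval, hval, hval, gen_mul_gen, gen_mul_gen, Fin.rev_rev, Fin.rev_rev,
    add_comm (l : ℕ) j, add_comm (k : ℕ) i]
  simp only [eq_comm (a := (l : ℕ)) (b := i), eq_comm (a := (k : ℕ)) (b := j)]
  abel

theorem i1_val (hk : 4 * (k + 1) ≤ M) : (i1 hk : ℕ) = 2 * k := rfl

theorem i2_val (hk : 4 * (k + 1) ≤ M) : (i2 hk : ℕ) = 2 * k + 1 := rfl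

theorem i1_rev_val (hk : 4 * (k + 1) ≤ M) : ((i1 hk).rev : ℕ) + 2 * k + 1 = M := by
  rw [Fin.val_rev, i1_val]
  omega

theorem i2_rev_val (hk : 4 * (k + 1) ≤ M) : ((i2 hk).rev : ℕ) + 2 * k + 2 = M := by
  rw [Fin.val_rev, i2_val]
  omega

theorem mem_vecIdx {j : Fin M} :
    j ∈ vecIdx M k ↔ 2 * k + 2 ≤ (j : ℕ) ∧ (j : ℕ) + (2 * k + 2) < M := by
  simp [vecIdx]

theorem rev_mem_vecIdx {j : Fin M} (hj : j ∈ vecIdx M k) : j.rev ∈ vecIdx M k := by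
  rw [mem_vecIdx] at hj ⊢
  rw [Fin.val_rev]
  omega

theorem index_val (hk : 4 * (k + 1) ≤ M) :
    ((i1 hk : ℕ) = 2 * k ∧ (i2 hk : ℕ) = 2 * k + 1) ∧
      ((i1 hk).rev : ℕ) + 2 * k + 1 = M ∧ ((i2 hk).rev : ℕ) + 2 * k + 2 = M :=
  ⟨⟨i1_val hk, i2_val hk⟩, i1_rev_val hk, i2_rev_val hk⟩

variable (K) (hk : 4 * (k + 1) ≤ M)

theorem lie_Eplus_Eminus : ⁅Eplus K hk, Eminus K hk⁆ = 0 := by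
  have h := index_val hk
  rw [Eplus, Eminus]
  simp (disch := omega) only [lie_gen_gen, if_pos, if_neg]
  simp [gen_rev_self]

theorem lie_Hplus_Hminus : ⁅Hplus K hk, Hminus K hk⁆ = 0 := by
  have h := index_val hk
  rw [Hplus, Hminus]
  simp (disch := omega) only [smul_lie, lie_smul, add_lie, lie_sub, lie_gen_gen, if_neg]
  simp

theorem lie_Hplus_Eminus : ⁅Hplus K hk, Eminus K hk⁆ = 0 := by
  have h := index_val hk
  rw [Hplus, Eminus]
  simp (disch := omega) only [smul_lie, add_lie, lie_gen_gen, if_neg]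
  simp

theorem lie_Hminus_Eplus : ⁅Hminus K hk, Eplus K hk⁆ = 0 := by
  have h := index_val hk
  rw [Hminus, Eplus]
  simp (disch := omega) only [smul_lie, sub_lie, lie_gen_gen, if_pos, if_neg]
  simp [gen_rev_comm (i2 hk) (i1 hk)]

theorem lie_Hplus_Eplus [CharZero K] : ⁅Hplus K hk, Eplus K hk⁆ = Eplus K hk := by
  have h := index_val hk
  rw [Hplus, Eplus]
  simp (disch := omega) only [smul_lie, add_lie, lie_gen_gen, if_pos, if_neg]
  simp only [sub_zero, add_zero, zero_sub, gen_rev_comm (i2 hk) (i1 hk), neg_neg]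
  simp [← add_smul, ← two_mul]

theorem lie_Hminus_Eminus [CharZero K] : ⁅Hminus K hk, Eminus K hk⁆ = Eminus K hk := by
  have h := index_val hk
  rw [Hminus, Eminus]
  simp (disch := omega) only [smul_lie, sub_lie, lie_gen_gen, if_neg]
  simp only [sub_zero, add_zero, zero_sub, sub_neg_eq_add, ← two_smul K, smul_smul]
  simp

variable {i j l : Fin M}

theorem lie_Hplus_E1 (hj : j ∈ vecIdx M k) :
    ⁅Hplus K hk, E1 K hk j⁆ = (2⁻¹ : K) • E1 K hk j := by
  have h := index_val hk
  rw [mem_vecIdx] at hj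
  rw [Hplus, E1]
  simp (disch := omega) only [smul_lie, add_lie, lie_gen_gen, if_neg]
  simp

theorem lie_Hplus_E2 (hj : j ∈ vecIdx M k) :
    ⁅Hplus K hk, E2 K hk j⁆ = (2⁻¹ : K) • E2 K hk j := by
  have h := index_val hk
  rw [mem_vecIdx] at hj
  rw [Hplus, E2]
  simp (disch := omega) only [smul_lie, add_lie, lie_gen_gen, if_pos, if_neg]
  simp [gen_rev_comm (i2 hk) j]

theorem lie_Hminus_E1 (hj : j ∈ vecIdx M k) :
    ⁅Hminus K hk, E1 K hk j⁆ = (2⁻¹ : K) • E1 K hk j := by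
  have h := index_val hk
  rw [mem_vecIdx] at hj
  rw [Hminus, E1]
  simp (disch := omega) only [smul_lie, sub_lie, lie_gen_gen, if_neg]
  simp

/-- The weight is opposite to that of the E_{1∓l}, so I^{1⊗2} has total weight zero under H_{1-2}.
-/
theorem lie_Hminus_E2 (hj : j ∈ vecIdx M k) :
    ⁅Hminus K hk, E2 K hk j⁆ = -(2⁻¹ : K) • E2 K hk j := by
  have h := index_val hk
  rw [mem_vecIdx] at hj
  rw [Hminus, E2]
  simp (disch := omega) only [smul_lie, sub_lie, lie_gen_gen, if_pos, if_neg]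
  simp [gen_rev_comm (i2 hk) j]

theorem lie_Eplus_E1 (hj : j ∈ vecIdx M k) :
    ⁅Eplus K hk, E1 K hk j⁆ = 0 := by
  have h := index_val hk
  rw [mem_vecIdx] at hj
  rw [Eplus, E1]
  simp (disch := omega) only [lie_gen_gen, if_neg]
  simp

theorem lie_Eplus_E2 (hj : j ∈ vecIdx M k) :
    ⁅Eplus K hk, E2 K hk j⁆ = 0 := by
  have h := index_val hk
  rw [mem_vecIdx] at hj
  rw [Eplus, E2]
  simp (disch := omega) only [lie_gen_gen, if_neg]
  simp

theorem lie_Eminus_E1 (hj : j ∈ vecIdx M k) :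
    ⁅Eminus K hk, E1 K hk j⁆ = 0 := by
  have h := index_val hk
  rw [mem_vecIdx] at hj
  rw [Eminus, E1]
  simp (disch := omega) only [lie_gen_gen, if_neg]
  simp

/-- This bracket is the obstruction to E_{1-2} staying primitive under the extension factor, and the
reason for the correction I¹. -/
theorem lie_Eminus_E2 (hj : j ∈ vecIdx M k) :
    ⁅Eminus K hk, E2 K hk j⁆ = -E1 K hk j.rev := by
  have h := index_val hk
  rw [mem_vecIdx] at hj
  rw [Eminus, E2, E1]
  simp (disch := omega) only [lie_gen_gen, if_pos, if_neg]
  simp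

theorem lie_E1_E1 (hi : i ∈ vecIdx M k) (hj : j ∈ vecIdx M k) :
    ⁅E1 K hk i, E1 K hk j⁆ = 0 := by
  have h := index_val hk
  rw [mem_vecIdx] at hi hj
  rw [E1, E1]
  simp (disch := omega) only [lie_gen_gen, if_neg]
  simp [gen_rev_self]

theorem lie_E2_E2 (hi : i ∈ vecIdx M k) (hj : j ∈ vecIdx M k) :
    ⁅E2 K hk i, E2 K hk j⁆ = 0 := by
  have h := index_val hk
  rw [mem_vecIdx] at hi hj
  rw [E2, E2]
  simp (disch := omega) only [lie_gen_gen, if_neg]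
  simp [gen_rev_self]

theorem lie_gen_Hplus (hi : i ∈ vecIdx M k) (hl : l ∈ vecIdx M k) :
    ⁅gen K i l, Hplus K hk⁆ = 0 := by
  have h := index_val hk
  rw [mem_vecIdx] at hi hl
  rw [Hplus]
  simp (disch := omega) only [lie_smul, lie_add, lie_gen_gen, if_neg]
  simp

theorem lie_gen_Hminus (hi : i ∈ vecIdx M k) (hl : l ∈ vecIdx M k) :
    ⁅gen K i l, Hminus K hk⁆ = 0 := by
  have h := index_val hk
  rw [mem_vecIdx] at hi hl
  rw [Hminus]
  simp (disch := omega) only [lie_smul, lie_sub, lie_gen_gen, if_neg]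
  simp

theorem lie_gen_Eplus (hi : i ∈ vecIdx M k) (hl : l ∈ vecIdx M k) :
    ⁅gen K i l, Eplus K hk⁆ = 0 := by
  have h := index_val hk
  rw [mem_vecIdx] at hi hl
  rw [Eplus]
  simp (disch := omega) only [lie_gen_gen, if_neg]
  simp

theorem lie_gen_Eminus (hi : i ∈ vecIdx M k) (hl : l ∈ vecIdx M k) :
    ⁅gen K i l, Eminus K hk⁆ = 0 := by
  have h := index_val hk
  rw [mem_vecIdx] at hi hl
  rw [Eminus]
  simp (disch := omega) only [lie_gen_gen, if_neg]
  simp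

theorem lie_gen_E1 (hi : i ∈ vecIdx M k) (hl : l ∈ vecIdx M k) :
    ⁅gen K i l, E1 K hk j⁆ =
      (if l.rev = j then E1 K hk i.rev else 0) - if i = j then E1 K hk l else 0 := by
  have h := index_val hk
  rw [mem_vecIdx] at hi hl
  rw [E1, E1, E1]
  simp (disch := omega) only [lie_gen_gen, if_neg]
  simp only [rev_eq_iff_val, gen_rev_comm i (i1 hk), zero_sub, add_zero]
  simp only [Fin.ext_iff]
  split_ifs <;> abel

theorem lie_gen_E2 (hi : i ∈ vecIdx M k) (hl : l ∈ vecIdx M k) :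
    ⁅gen K i l, E2 K hk j⁆ =
      (if l = j then E2 K hk i else 0) - if i.rev = j then E2 K hk l.rev else 0 := by
  have h := index_val hk
  rw [mem_vecIdx] at hi hl
  rw [E2, E2, E2]
  simp (disch := omega) only [lie_gen_gen, if_neg]
  simp only [rev_eq_iff_val, gen_rev_comm l.rev (i2 hk), Fin.rev_rev, sub_zero]
  simp only [Fin.ext_iff]
  split_ifs <;> abel

theorem lie_E1_E2 {i j : Fin M} (hi : i ∈ vecIdx M k) (hj : j ∈ vecIdx M k) :
    ⁅E1 K hk i, E2 K hk j⁆ = if i = j then Eplus K hk else 0 := by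
  have h := index_val hk
  rw [mem_vecIdx] at hi hj
  rw [Eplus, E1, E2]
  simp (disch := omega) only [lie_gen_gen, if_neg]
  simp [Fin.ext_iff]

end Brackets

/-! ### Lie algebra elements as constant series, and primitive elements. -/

section Primitive

open PowerSeries

variable {K : Type*} [Field K] {L : Type*} [LieRing L] [LieAlgebra K L]
  {F : PowerSeries (U2 K L)}

variable (K) in
/-- The constant power series with coefficient `x ∈ L`. -/
def cst (x : L) : PowerSeries (U K L) := PowerSeries.C (inc K L x)

theorem cst_mul_cst (x y : L) : cst K x * cst K y = cst K y * cst K x + cst K ⁅x, y⁆ := by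
  rw [cst, cst, cst, LieHom.map_lie, LieRing.of_associative_ring_bracket, map_sub, map_mul,
    map_mul, add_sub_cancel]

theorem commute_cst {x y : L} (h : ⁅x, y⁆ = 0) : Commute (cst K x) (cst K y) := by
  rw [Commute, SemiconjBy, cst_mul_cst, h, cst, cst, cst, map_zero (inc K L), map_zero, add_zero]

theorem cst_smul (c : K) (x : L) : cst K (c • x) = c • cst K x := by
  ext n
  rw [cst, cst, map_smul (inc K L), coeff_smul, coeff_C, coeff_C]
  split_ifs
  · rfl
  · rw [smul_zero]

theorem cst_add (x y : L) : cst K (x + y) = cst K x + cst K y := by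
  rw [cst, map_add (inc K L), map_add, cst, cst]

theorem cst_sub (x y : L) : cst K (x - y) = cst K x - cst K y := by
  rw [cst, map_sub (inc K L), map_sub, cst, cst]

theorem cst_neg (x : L) : cst K (-x) = -cst K x := by
  rw [cst, map_neg (inc K L), map_neg, cst]

theorem cst_zero : cst K (0 : L) = 0 := by
  rw [cst, map_zero (inc K L), map_zero]

theorem ext_counit_cst (x : L) : ext (counit K L) (cst K x) = 0 := by
  rw [cst, map_C, RingHom.coe_coe, counit_ι, map_zero]

theorem ext_counit_smul_X_mul (η : K) {y : PowerSeries (U K L)} (hy : ext (counit K L) y = 0) :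
    ext (counit K L) (η • (X * y)) = 0 := by
  rw [ext_smul, map_mul, hy, mul_zero, smul_zero]

theorem constantCoeff_smul_X_mul (η : K) (y : PowerSeries (U K L)) :
    constantCoeff (η • (X * y)) = 0 :=
  constantCoeff_smul (by rw [map_mul, constantCoeff_X, zero_mul]) η

theorem mul_smul_X_mul {y z w : PowerSeries (U K L)} (h : y * z = z * y + w) (η : K) :
    y * (η • (X * z)) = η • (X * z) * y + η • (X * w) := by
  rw [mul_smul_comm, ← mul_assoc, (commute_X y).eq, mul_assoc, h, mul_add, smul_add,
    smul_mul_assoc, mul_assoc]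

theorem Commute.smul_X_mul {y z : PowerSeries (U K L)} (h : Commute y z) (η : K) :
    Commute y (η • (X * z)) :=
  ((commute_X y).mul_right h).smul_right η

/-- `x` is primitive with respect to the coproduct `Δ_F`. -/
def IsPrim (F : PowerSeries (U2 K L)) (x : PowerSeries (U K L)) : Prop :=
  twistedComul F x = ext (inl K L) x + ext (inr K L) x

theorem IsPrim.smul {x : PowerSeries (U K L)} (hx : IsPrim F x) (c : K) : IsPrim F (c • x) := by
  rw [IsPrim, twistedComul_smul, hx, ext_smul, ext_smul, smul_add]

theorem IsPrim.add {x y : PowerSeries (U K L)} (hx : IsPrim F x) (hy : IsPrim F y) :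
    IsPrim F (x + y) := by
  rw [IsPrim, twistedComul_add, hx, hy, map_add, map_add]
  abel

theorem IsPrim.sub {x y : PowerSeries (U K L)} (hx : IsPrim F x) (hy : IsPrim F y) :
    IsPrim F (x - y) := by
  rw [IsPrim, twistedComul_sub, hx, hy, map_sub, map_sub]
  abel

theorem IsPrim.smul_X_mul {x : PowerSeries (U K L)} (hx : IsPrim F x) (hF : IsUnit F) (η : K) :
    IsPrim F (η • (X * x)) := by
  refine IsPrim.smul ?_ η
  rw [IsPrim, twistedComul_mul hF, twistedComul_X hF, hx, map_mul, map_mul, map_X, map_X, mul_add]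

theorem isPrim_one_cst (x : L) : IsPrim 1 (cst K x) := by
  rw [IsPrim, twistedComul, Ring.inverse_one, one_mul, mul_one, cst, map_C, map_C, map_C,
    ← map_add]
  exact congrArg _ (comul_ι x)

end Primitive

/-! ### The factors of one link in terms of Jordanian and extension factors. -/

section Link

open PowerSeries

variable {K : Type*} [Field K] {M k : ℕ} (hk : 4 * (k + 1) ≤ M) (η ξ : K)

/-- `h η E_{1+2}`. -/
def xPlus : PowerSeries (U K (so K M)) := η • (X * cst K (Eplus K hk))

/-- `h η E_{1-2}`. -/
def xMinus : PowerSeries (U K (so K M)) := η • (X * cst K (Eminus K hk))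

/-- The first factors `h η E_{1∓l}` of the extension. -/
def extE (j : Fin M) : PowerSeries (U K (so K M)) := η • (X * cst K (E1 K hk j))

variable (K) in
/-- The second factors `E_{2±l}` of the extension. -/
def extF (j : Fin M) : PowerSeries (U K (so K M)) := cst K (E2 K hk j)

/-- `h η (E_{1-2} - h η I¹)`. -/
def deformed : PowerSeries (U K (so K M)) :=
  xMinus hk η - (2⁻¹ : K) • ∑ j ∈ vecIdx M k, extE hk η j * extE hk η j.rev

theorem sigma_eq : sigma hk η = flog1p K (xPlus hk η) := rfl

theorem PhiJ_eq : PhiJ hk η = jordanian K (cst K (Hplus K hk)) (xPlus hk η) := by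
  rw [PhiJ, jordanian, sigma_eq, cst, map_C]
  rfl

/-- Both terms of the deformed generator are brought to the same rescaling: putting one factor hη
into each E_{1∓l} gives exactly the (hη)² in front of I¹, and ξ factors out. -/
theorem Gminus_eq : Gminus hk η ξ = ξ • deformed hk η := by
  have h : ∑ j ∈ vecIdx M k, extE hk η j * extE hk η j.rev =
      (η * η) • (X * (X * PowerSeries.C (∑ j ∈ vecIdx M k, inc K (so K M) (E1 K hk j) *
        inc K (so K M) (E1 K hk j.rev)))) := by
    rw [map_sum, Finset.mul_sum, Finset.mul_sum, Finset.smul_sum]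
    refine Finset.sum_congr rfl fun j _ => ?_
    rw [extE, extE, smul_mul_smul_comm, map_mul, cst, cst, mul_assoc X,
      ← mul_assoc (PowerSeries.C _) X, (commute_X _).eq, mul_assoc X]
  have hC : ∀ (c : K) (a : U K (so K M)), PowerSeries.C (c • a) = c • PowerSeries.C a :=
    fun c a => by
      ext n
      rw [coeff_smul, coeff_C, coeff_C]
      split_ifs
      · rfl
      · rw [smul_zero]
  rw [Gminus, deformed, h, xMinus, I1, hC, cst]
  simp only [mul_sub, mul_smul_comm, smul_sub, smul_smul]
  congr 2 <;> ring

theorem PhiG_eq : PhiG hk η ξ = jordanian K (cst K (Hminus K hk)) (ξ • deformed hk η) := by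
  rw [PhiG, jordanian, Gminus_eq, cst, map_C]
  rfl

theorem PhiE_eq : PhiE hk η = extension K (vecIdx M k) (extE hk η) (extF K hk)
    (fexp K (-(2⁻¹ : K) • sigma hk η)) := by
  rw [PhiE, extension]
  congr 1
  rw [I12, map_sum, Finset.mul_sum, Finset.sum_mul, Finset.smul_sum]
  refine Finset.sum_congr rfl fun j _ => ?_
  have h : PowerSeries.C (inc K (so K M) (E1 K hk j) ⊗ₜ[K] inc K (so K M) (E2 K hk j)) =
      ext (inl K _) (cst K (E1 K hk j)) * ext (inr K _) (cst K (E2 K hk j)) := by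
    rw [cst, cst, map_C, map_C, ← map_mul]
    simp
  rw [h, extE, extF, ext_smul, map_mul, map_mul (ext (inr K _)), map_X, smul_mul_assoc]
  simp only [mul_assoc]

section Relations

variable {hk η} {i j l : Fin M}

theorem Hplus_mul_xPlus [CharZero K] : cst K (Hplus K hk) * xPlus hk η =
    xPlus hk η * cst K (Hplus K hk) + xPlus hk η :=
  mul_smul_X_mul (by rw [cst_mul_cst, lie_Hplus_Eplus]) η

theorem Hplus_mul_extE (hj : j ∈ vecIdx M k) : cst K (Hplus K hk) * extE hk η j =
    extE hk η j * cst K (Hplus K hk) + (2⁻¹ : K) • extE hk η j := by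
  rw [extE, mul_smul_X_mul (by rw [cst_mul_cst, lie_Hplus_E1 K hk hj, cst_smul]), mul_smul_comm,
    smul_comm η]

theorem Hplus_mul_extF (hj : j ∈ vecIdx M k) : cst K (Hplus K hk) * extF K hk j =
    extF K hk j * cst K (Hplus K hk) + (2⁻¹ : K) • extF K hk j := by
  rw [extF, cst_mul_cst, lie_Hplus_E2 K hk hj, cst_smul]

theorem Hminus_mul_extE (hj : j ∈ vecIdx M k) : cst K (Hminus K hk) * extE hk η j =
    extE hk η j * cst K (Hminus K hk) + (2⁻¹ : K) • extE hk η j := by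
  rw [extE, mul_smul_X_mul (by rw [cst_mul_cst, lie_Hminus_E1 K hk hj, cst_smul]), mul_smul_comm,
    smul_comm η]

theorem Hminus_mul_extF (hj : j ∈ vecIdx M k) : cst K (Hminus K hk) * extF K hk j =
    extF K hk j * cst K (Hminus K hk) - (2⁻¹ : K) • extF K hk j := by
  rw [extF, cst_mul_cst, lie_Hminus_E2 K hk hj, cst_smul, neg_smul, sub_eq_add_neg]

theorem Hminus_mul_xMinus [CharZero K] : cst K (Hminus K hk) * xMinus hk η =
    xMinus hk η * cst K (Hminus K hk) + xMinus hk η :=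
  mul_smul_X_mul (by rw [cst_mul_cst, lie_Hminus_Eminus]) η

theorem commute_Hplus_xMinus : Commute (cst K (Hplus K hk)) (xMinus hk η) :=
  Commute.smul_X_mul (commute_cst (lie_Hplus_Eminus K hk)) η

theorem commute_Hminus_xPlus : Commute (cst K (Hminus K hk)) (xPlus hk η) :=
  Commute.smul_X_mul (commute_cst (lie_Hminus_Eplus K hk)) η

theorem commute_xPlus_xMinus : Commute (xPlus hk η) (xMinus hk η) :=
  Commute.smul_X_mul (Commute.smul_X_mul (commute_cst (lie_Eplus_Eminus K hk)).symm η).symm η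

theorem commute_xPlus_extE (hj : j ∈ vecIdx M k) : Commute (xPlus hk η) (extE hk η j) :=
  Commute.smul_X_mul (Commute.smul_X_mul (commute_cst (lie_Eplus_E1 K hk hj)).symm η).symm η

theorem commute_xPlus_extF (hj : j ∈ vecIdx M k) : Commute (xPlus hk η) (extF K hk j) :=
  (Commute.smul_X_mul (commute_cst (lie_Eplus_E2 K hk hj)).symm η).symm

theorem commute_xMinus_extE (hj : j ∈ vecIdx M k) : Commute (xMinus hk η) (extE hk η j) :=
  Commute.smul_X_mul (Commute.smul_X_mul (commute_cst (lie_Eminus_E1 K hk hj)).symm η).symm η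

theorem commute_extE_extE (hi : i ∈ vecIdx M k) (hj : j ∈ vecIdx M k) :
    Commute (extE hk η i) (extE hk η j) :=
  Commute.smul_X_mul (Commute.smul_X_mul (commute_cst (lie_E1_E1 K hk hi hj)).symm η).symm η

theorem commute_extF_extF (hi : i ∈ vecIdx M k) (hj : j ∈ vecIdx M k) :
    Commute (extF K hk i) (extF K hk j) :=
  commute_cst (lie_E2_E2 K hk hi hj)

theorem smul_X_mul_mul {x y : so K M} :
    η • (X * cst K x) * cst K y = cst K y * (η • (X * cst K x)) + η • (X * cst K ⁅x, y⁆) := by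
  rw [mul_smul_comm, ← mul_assoc (cst K y), (commute_X _).eq, mul_assoc X, smul_mul_assoc,
    mul_assoc, cst_mul_cst, mul_add, smul_add]

theorem xMinus_mul_extF (hj : j ∈ vecIdx M k) : xMinus hk η * extF K hk j =
    extF K hk j * xMinus hk η - extE hk η j.rev := by
  rw [xMinus, extF, smul_X_mul_mul, lie_Eminus_E2 K hk hj, cst_neg, mul_neg, smul_neg,
    ← sub_eq_add_neg, extE]

theorem extE_mul_extF (hi : i ∈ vecIdx M k) (hj : j ∈ vecIdx M k) : extE hk η i * extF K hk j =
    extF K hk j * extE hk η i + if i = j then xPlus hk η else 0 := by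
  rw [extE, extF, smul_X_mul_mul, lie_E1_E2 K hk hi hj]
  split_ifs
  · rw [xPlus]
  · rw [cst_zero, mul_zero, smul_zero]

theorem gen_mul_extE (hi : i ∈ vecIdx M k) (hl : l ∈ vecIdx M k) :
    cst K (gen K i l) * extE hk η j = extE hk η j * cst K (gen K i l) +
      ((if l.rev = j then extE hk η i.rev else 0) - if i = j then extE hk η l else 0) := by
  rw [extE, mul_smul_X_mul (by rw [cst_mul_cst, lie_gen_E1 K hk hi hl]), cst_sub]
  congr 1
  simp only [apply_ite (cst K), cst_zero, mul_sub, mul_ite, mul_zero, smul_sub, smul_ite,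
    smul_zero, extE]

theorem gen_mul_extF (hi : i ∈ vecIdx M k) (hl : l ∈ vecIdx M k) :
    cst K (gen K i l) * extF K hk j = extF K hk j * cst K (gen K i l) +
      ((if l = j then extF K hk i else 0) - if i.rev = j then extF K hk l.rev else 0) := by
  rw [extF, cst_mul_cst, lie_gen_E2 K hk hi hl, cst_sub]
  simp only [apply_ite (cst K), cst_zero, extF]

theorem commute_gen_Hplus (hi : i ∈ vecIdx M k) (hl : l ∈ vecIdx M k) :
    Commute (cst K (gen K i l)) (cst K (Hplus K hk)) :=
  commute_cst (lie_gen_Hplus K hk hi hl)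

theorem commute_gen_Hminus (hi : i ∈ vecIdx M k) (hl : l ∈ vecIdx M k) :
    Commute (cst K (gen K i l)) (cst K (Hminus K hk)) :=
  commute_cst (lie_gen_Hminus K hk hi hl)

theorem commute_gen_xPlus (hi : i ∈ vecIdx M k) (hl : l ∈ vecIdx M k) :
    Commute (cst K (gen K i l)) (xPlus hk η) :=
  Commute.smul_X_mul (commute_cst (lie_gen_Eplus K hk hi hl)) η

theorem commute_gen_xMinus (hi : i ∈ vecIdx M k) (hl : l ∈ vecIdx M k) :
    Commute (cst K (gen K i l)) (xMinus hk η) :=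
  Commute.smul_X_mul (commute_cst (lie_gen_Eminus K hk hi hl)) η

/-- `I¹` is an invariant of `so(M - 4(k+1))`. -/
theorem commute_gen_deformed (hi : i ∈ vecIdx M k) (hl : l ∈ vecIdx M k) :
    Commute (cst K (gen K i l)) (deformed hk η) := by
  refine (commute_gen_xMinus hi hl).sub_right (Commute.smul_right ?_ _)
  have hterm : ∀ j ∈ vecIdx M k, cst K (gen K i l) * (extE hk η j * extE hk η j.rev) =
      extE hk η j * extE hk η j.rev * cst K (gen K i l) +
        ((if l.rev = j then extE hk η i.rev * extE hk η j.rev else 0) -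
          (if i = j then extE hk η l * extE hk η j.rev else 0) +
          ((if l = j then extE hk η j * extE hk η i.rev else 0) -
            if i.rev = j then extE hk η j * extE hk η l else 0)) := fun j _ => by
    have h1 : (l.rev = j.rev) = (l = j) := by rw [Fin.rev_inj]
    have h2 : (i = j.rev) = (i.rev = j) := propext Fin.rev_eq_iff.symm
    rw [← mul_assoc, gen_mul_extE hi hl, add_mul, mul_assoc, gen_mul_extE hi hl, mul_add,
      ← mul_assoc]
    simp only [h1, h2, sub_mul, mul_sub, ite_mul, mul_ite, zero_mul, mul_zero]
    abel
  -- Each Kronecker delta selects one summand, and the four remaining products cancel in pairs.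
  rw [Commute, SemiconjBy, Finset.mul_sum, Finset.sum_mul, Finset.sum_congr rfl hterm,
    Finset.sum_add_distrib, Finset.sum_add_distrib, Finset.sum_sub_distrib,
    Finset.sum_sub_distrib, Finset.sum_ite_eq, Finset.sum_ite_eq, Finset.sum_ite_eq,
    Finset.sum_ite_eq, if_pos (rev_mem_vecIdx hl), if_pos hi, if_pos hl,
    if_pos (rev_mem_vecIdx hi), Fin.rev_rev, sub_add_sub_cancel, sub_self, add_zero]

/-- `I^{1⊗2}` is an invariant of `so(M - 4(k+1))`. -/
theorem commute_extension_gen (hi : i ∈ vecIdx M k) (hl : l ∈ vecIdx M k)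
    {s : PowerSeries (U K (so K M))} (hs : Commute (cst K (gen K i l)) s) :
    Commute (∑ j ∈ vecIdx M k, ext (inl K _) (extE hk η j) * ext (inr K _) (extF K hk j * s))
      (ext (inl K _) (cst K (gen K i l)) + ext (inr K _) (cst K (gen K i l))) := by
  refine Commute.symm ?_
  have c := commute_ext_inl_inr (K := K) (L := so K M)
  have hterm : ∀ j ∈ vecIdx M k,
      (ext (inl K _) (cst K (gen K i l)) + ext (inr K _) (cst K (gen K i l))) *
        (ext (inl K _) (extE hk η j) * ext (inr K _) (extF K hk j * s)) =
      ext (inl K _) (extE hk η j) * ext (inr K _) (extF K hk j * s) *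
        (ext (inl K _) (cst K (gen K i l)) + ext (inr K _) (cst K (gen K i l))) +
        ((if l.rev = j then ext (inl K _) (extE hk η i.rev) * ext (inr K _) (extF K hk j * s)
            else 0) -
          (if i = j then ext (inl K _) (extE hk η l) * ext (inr K _) (extF K hk j * s) else 0) +
          ((if l = j then ext (inl K _) (extE hk η j) * ext (inr K _) (extF K hk i * s) else 0) -
            if i.rev = j then ext (inl K _) (extE hk η j) * ext (inr K _) (extF K hk l.rev * s)
              else 0)) := fun j _ => by
    have h1 : cst K (gen K i l) * (extF K hk j * s) = extF K hk j * s * cst K (gen K i l) +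
        ((if l = j then extF K hk i * s else 0) -
          if i.rev = j then extF K hk l.rev * s else 0) := by
      rw [← mul_assoc, gen_mul_extF hi hl, add_mul, mul_assoc, hs.eq, ← mul_assoc]
      simp only [sub_mul, ite_mul, zero_mul]
    rw [add_mul, ← mul_assoc, ← map_mul, gen_mul_extE hi hl, ← mul_assoc,
      ← (c (extE hk η j) (cst K (gen K i l))).eq, mul_assoc (ext (inl K _) (extE hk η j)),
      ← map_mul (ext (inr K _)), h1, mul_add, mul_assoc _ _ (ext (inl K _) (cst K (gen K i l))),
      ← (c (cst K (gen K i l)) (extF K hk j * s)).eq]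
    simp only [map_add, map_sub, map_mul, sub_mul, mul_sub, add_mul, mul_add,
      apply_ite (ext (inl K (so K M))), apply_ite (ext (inr K (so K M))), map_zero, ite_mul,
      mul_ite, zero_mul, mul_zero, mul_assoc]
    abel
  rw [Commute, SemiconjBy, Finset.mul_sum, Finset.sum_mul, Finset.sum_congr rfl hterm,
    Finset.sum_add_distrib, Finset.sum_add_distrib, Finset.sum_sub_distrib,
    Finset.sum_sub_distrib, Finset.sum_ite_eq, Finset.sum_ite_eq, Finset.sum_ite_eq,
    Finset.sum_ite_eq, if_pos (rev_mem_vecIdx hl), if_pos hi, if_pos hl,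
    if_pos (rev_mem_vecIdx hi), sub_add_sub_cancel, sub_self, add_zero]

end Relations

end Link

/-! ### One link is a relative twist, and the induction along the chain. -/

section LinkTwist

open PowerSeries

variable {K : Type*} [Field K] {M k : ℕ} {hk : 4 * (k + 1) ≤ M} {η ξ : K}
  {F : PowerSeries (U2 K (so K M))}

theorem constantCoeff_xPlus : constantCoeff (xPlus hk η) = 0 := constantCoeff_smul_X_mul η _

/-- H_{1-2} acts on the first legs with weight ½ and on the second legs with weight -½, so the
exponent is invariant and H_{1-2} stays primitive. -/
theorem commute_extension_Hminus {s : PowerSeries (U K (so K M))}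
    (hs : Commute (cst K (FullChain.Hminus K hk)) s) :
    Commute (∑ j ∈ vecIdx M k, ext (inl K _) (extE hk η j) * ext (inr K _) (extF K hk j * s))
      (ext (inl K _) (cst K (FullChain.Hminus K hk)) +
        ext (inr K _) (cst K (FullChain.Hminus K hk))) := by
  have c := commute_ext_inl_inr (K := K) (L := so K M)
  refine Commute.sum_left _ _ _ fun j hj => Commute.symm ?_
  have h1 : cst K (FullChain.Hminus K hk) * (extF K hk j * s) =
      extF K hk j * s * cst K (FullChain.Hminus K hk) - (2⁻¹ : K) • (extF K hk j * s) := by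
    rw [← mul_assoc, Hminus_mul_extF hj, sub_mul, mul_assoc, hs.eq, ← mul_assoc, smul_mul_assoc]
  rw [Commute, SemiconjBy, add_mul, ← mul_assoc, ← map_mul, Hminus_mul_extE hj, ← mul_assoc,
    ← (c (extE hk η j) _).eq, mul_assoc (ext (inl K _) (extE hk η j)), ← map_mul (ext (inr K _)),
    h1, mul_add, mul_assoc _ _ (ext (inl K _) (cst K (FullChain.Hminus K hk))),
    ← (c (cst K (FullChain.Hminus K hk)) (extF K hk j * s)).eq, map_add, map_sub, add_mul, mul_sub,
    ext_smul, ext_smul, map_mul, map_mul _ (extF K hk j * s), smul_mul_assoc, mul_smul_comm]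
  simp only [mul_assoc]
  abel

theorem constantCoeff_deformed : constantCoeff (deformed hk η) = 0 := by
  rw [deformed, map_sub, xMinus, constantCoeff_smul_X_mul, zero_sub, neg_eq_zero]
  refine constantCoeff_smul ?_ _
  rw [map_sum]
  refine Finset.sum_eq_zero fun j _ => ?_
  rw [map_mul, extE, constantCoeff_smul_X_mul, zero_mul]

/-- The generators with indices in `{2k, …, M - 2k - 1}`, i.e. those of `so(M - 4k)`, are primitive
with respect to `Δ_F`. -/
def IsPrimOn (F : PowerSeries (U2 K (so K M))) (k : ℕ) : Prop :=
  ∀ i j : Fin M, 2 * k ≤ (i : ℕ) → (i : ℕ) + 2 * k < M → 2 * k ≤ (j : ℕ) → (j : ℕ) + 2 * k < M →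
    IsPrim F (cst K (gen K i j))

theorem IsPrimOn.Eplus (h : IsPrimOn F k) : IsPrim F (cst K (Eplus K hk)) := by
  have hv := index_val hk
  exact h _ _ (by omega) (by omega) (by omega) (by omega)

theorem IsPrimOn.Eminus (h : IsPrimOn F k) : IsPrim F (cst K (Eminus K hk)) := by
  have hv := index_val hk
  exact h _ _ (by omega) (by omega) (by omega) (by omega)

theorem IsPrimOn.Hplus (h : IsPrimOn F k) : IsPrim F (cst K (Hplus K hk)) := by
  have hv := index_val hk
  rw [FullChain.Hplus, cst_smul, cst_add]
  exact ((h _ _ (by omega) (by omega) (by omega) (by omega)).add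
    (h _ _ (by omega) (by omega) (by omega) (by omega))).smul _

theorem IsPrimOn.Hminus (h : IsPrimOn F k) : IsPrim F (cst K (Hminus K hk)) := by
  have hv := index_val hk
  rw [FullChain.Hminus, cst_smul, cst_sub]
  exact ((h _ _ (by omega) (by omega) (by omega) (by omega)).sub
    (h _ _ (by omega) (by omega) (by omega) (by omega))).smul _

theorem IsPrimOn.E1 (h : IsPrimOn F k) {j : Fin M} (hj : j ∈ vecIdx M k) :
    IsPrim F (cst K (E1 K hk j)) := by
  have hv := index_val hk
  rw [mem_vecIdx] at hj
  exact h _ _ (by omega) (by omega) (by omega) (by omega)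

theorem IsPrimOn.E2 (h : IsPrimOn F k) {j : Fin M} (hj : j ∈ vecIdx M k) :
    IsPrim F (cst K (E2 K hk j)) := by
  have hv := index_val hk
  rw [mem_vecIdx] at hj
  exact h _ _ (by omega) (by omega) (by omega) (by omega)

theorem IsPrimOn.gen (h : IsPrimOn F k) {i j : Fin M} (hi : i ∈ vecIdx M k) (hj : j ∈ vecIdx M k) :
    IsPrim F (cst K (gen K i j)) := by
  rw [mem_vecIdx] at hi hj
  exact h _ _ (by omega) (by omega) (by omega) (by omega)

variable [CharZero K]

theorem constantCoeff_smul_flog1p (c : K) (x : PowerSeries (U K (so K M))) :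
    constantCoeff (c • flog1p K x) = 0 :=
  constantCoeff_smul (constantCoeff_flog1p x) c

theorem commute_fexp_smul_sigma {y : PowerSeries (U K (so K M))} (h : Commute (xPlus hk η) y)
    (c : K) : Commute (fexp K (c • sigma hk η)) y := by
  have h0 := constantCoeff_smul_flog1p c (xPlus hk η)
  exact (FullChain.SemiconjBy.fexp
    ((commute_flog1p constantCoeff_xPlus h).smul_left c).symm h0 h0).symm

/-- Identifies t² - 1 with hηE_{1+2}, which is the bracket of the rescaled E_{1∓l} with the matching
E_{2±l}. -/
theorem fexp_sigma_mul_self :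
    fexp K ((2⁻¹ : K) • sigma hk η) * fexp K ((2⁻¹ : K) • sigma hk η) - 1 = xPlus hk η := by
  have h0 := constantCoeff_smul_flog1p (2⁻¹ : K) (xPlus hk η)
  rw [← sigma_eq] at h0
  rw [← fexp_add K (Commute.refl _) h0 h0, ← two_smul K, smul_smul,
    mul_inv_cancel₀ two_ne_zero, one_smul, sigma_eq, fexp_flog1p K constantCoeff_xPlus,
    add_sub_cancel_left]

theorem extensionRelations : ExtensionRelations (vecIdx M k) (extE hk η) (extF K hk)
    (fexp K (-(2⁻¹ : K) • sigma hk η)) (fexp K ((2⁻¹ : K) • sigma hk η)) where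
  constantCoeff_e _ _ := constantCoeff_smul_X_mul η _
  counit_e _ _ := ext_counit_smul_X_mul η (ext_counit_cst _)
  counit_f _ _ := ext_counit_cst _
  e_e _ hi _ hj := commute_extE_extE hi hj
  f_f _ hi _ hj := commute_extF_extF hi hj
  s_e _ hj := commute_fexp_smul_sigma (commute_xPlus_extE hj) _
  s_f _ hj := commute_fexp_smul_sigma (commute_xPlus_extF hj) _
  t_e _ hj := commute_fexp_smul_sigma (commute_xPlus_extE hj) _
  t_f _ hj := commute_fexp_smul_sigma (commute_xPlus_extF hj) _
  s_t := by
    have h := fexp_mul_fexp_neg K (constantCoeff_smul_flog1p (-2⁻¹ : K) (xPlus hk η))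
    rwa [← neg_smul, neg_neg] at h
  t_s := by
    have h := fexp_mul_fexp_neg K (constantCoeff_smul_flog1p (2⁻¹ : K) (xPlus hk η))
    rwa [← neg_smul] at h
  e_f i hi := by rw [extE_mul_extF hi hi, if_pos rfl, fexp_sigma_mul_self]
  e_f_ne i hi j hj hij := by rw [extE_mul_extF hi hj, if_neg hij, add_zero]

/-- Each E_{1∓l} has weight ½ under H_{1-2}, so the quadratic correction has weight one, the same as
E_{1-2}. -/
theorem Hminus_mul_deformed : cst K (FullChain.Hminus K hk) * deformed hk η =
    deformed hk η * cst K (FullChain.Hminus K hk) + deformed hk η := by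
  have hterm : ∀ j ∈ vecIdx M k, cst K (FullChain.Hminus K hk) * (extE hk η j * extE hk η j.rev) =
      extE hk η j * extE hk η j.rev * cst K (FullChain.Hminus K hk) +
        extE hk η j * extE hk η j.rev := fun j hj => by
    rw [← mul_assoc, Hminus_mul_extE hj, add_mul, mul_assoc, Hminus_mul_extE (rev_mem_vecIdx hj),
      mul_add, ← mul_assoc, smul_mul_assoc, mul_smul_comm, add_assoc, ← add_smul, ← two_mul,
      mul_inv_cancel₀ two_ne_zero, one_smul]
  rw [deformed, mul_sub, Hminus_mul_xMinus, mul_smul_comm, Finset.mul_sum,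
    Finset.sum_congr rfl hterm, Finset.sum_add_distrib, sub_mul, smul_mul_assoc, Finset.sum_mul,
    smul_add]
  abel

theorem isRelTwist_PhiJ (h : IsPrimOn F k) (hF : IsUnit F) : IsRelTwist F (PhiJ hk η) := by
  rw [PhiJ_eq]
  exact isRelTwist_jordanian hF constantCoeff_xPlus h.Hplus (h.Eplus.smul_X_mul hF η)
    Hplus_mul_xPlus (ext_counit_cst _) (ext_counit_smul_X_mul η (ext_counit_cst _))

theorem isPrim_PhiJ_mul_sigma (h : IsPrimOn F k) (hF : IsUnit F) :
    IsPrim (PhiJ hk η * F) (sigma hk η) := by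
  rw [PhiJ_eq]
  exact twistedComul_jordanian_mul_flog1p hF constantCoeff_xPlus (h.Eplus.smul_X_mul hF η)
    Hplus_mul_xPlus

theorem isPrim_PhiJ_mul (hF : IsUnit F) {y : PowerSeries (U K (so K M))} (hy : IsPrim F y)
    (hH : Commute (cst K (FullChain.Hplus K hk)) y) (hx : Commute (xPlus hk η) y) :
    IsPrim (PhiJ hk η * F) y := by
  rw [PhiJ_eq]
  exact twistedComul_jordanian_mul_of_commute hF constantCoeff_xPlus hy hH hx

theorem extensionCoproduct (h : IsPrimOn F k) (hF : IsUnit F) :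
    ExtensionCoproduct (PhiJ hk η * F) (vecIdx M k) (extE hk η) (extF K hk)
      (fexp K (-(2⁻¹ : K) • sigma hk η))
    (fexp K ((2⁻¹ : K) • sigma hk η)) where
  e j hj := by
    rw [PhiJ_eq]
    exact twistedComul_jordanian_mul hF constantCoeff_xPlus ((h.E1 hj).smul_X_mul hF η)
      (Hplus_mul_extE hj) (commute_xPlus_extE hj)
  f j hj := by
    rw [PhiJ_eq]
    exact twistedComul_jordanian_mul hF constantCoeff_xPlus (h.E2 hj)
      (Hplus_mul_extF hj) (commute_xPlus_extF hj)
  s := by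
    have h0 : constantCoeff (-(2⁻¹ : K) • sigma hk η) = 0 :=
      constantCoeff_smul_flog1p (-2⁻¹ : K) (xPlus hk η)
    rw [twistedComul_fexp ((isRelTwist_PhiJ h hF).isUnit.mul hF) h0,
      (isPrim_PhiJ_mul_sigma h hF).smul, fexp_add K (commute_ext_inl_inr _ _)
        (constantCoeff_ext h0 _) (constantCoeff_ext h0 _), ext_fexp, ext_fexp]

theorem isRelTwist_PhiE (h : IsPrimOn F k) (hF : IsUnit F) :
    IsRelTwist (PhiJ hk η * F) (PhiE hk η) := by
  rw [PhiE_eq]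
  exact isRelTwist_extension extensionRelations ((isRelTwist_PhiJ h hF).isUnit.mul hF)
    (extensionCoproduct h hF)

theorem isPrim_deformed (h : IsPrimOn F k) (hF : IsUnit F) :
    IsPrim (PhiE hk η * (PhiJ hk η * F)) (deformed hk η) := by
  rw [PhiE_eq]
  exact twistedComul_extension_mul_deformed extensionRelations
    ((isRelTwist_PhiJ h hF).isUnit.mul hF) (extensionCoproduct h hF)
    (fun j hj => rev_mem_vecIdx hj) (fun j _ => Fin.rev_rev j)
    (isPrim_PhiJ_mul hF (h.Eminus.smul_X_mul hF η) commute_Hplus_xMinus commute_xPlus_xMinus)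
    (commute_fexp_smul_sigma commute_xPlus_xMinus _).symm (fun j hj => commute_xMinus_extE hj)
    (fun j hj => xMinus_mul_extF hj)

theorem isPrim_PhiE_mul_Hminus (h : IsPrimOn F k) (hF : IsUnit F) :
    IsPrim (PhiE hk η * (PhiJ hk η * F)) (cst K (FullChain.Hminus K hk)) := by
  rw [PhiE_eq]
  exact twistedComul_extension_mul_of_commute extensionRelations
    ((isRelTwist_PhiJ h hF).isUnit.mul hF)
    (isPrim_PhiJ_mul hF h.Hminus (commute_cst (lie_Hplus_Hminus K hk))
      commute_Hminus_xPlus.symm)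
    (commute_extension_Hminus (commute_fexp_smul_sigma commute_Hminus_xPlus.symm _).symm)

theorem isRelTwist_PhiG (h : IsPrimOn F k) (hF : IsUnit F) :
    IsRelTwist (PhiE hk η * (PhiJ hk η * F)) (PhiG hk η ξ) := by
  have hu := (isRelTwist_PhiE (hk := hk) (η := η) h hF).isUnit.mul
    ((isRelTwist_PhiJ (hk := hk) (η := η) h hF).isUnit.mul hF)
  rw [PhiG_eq]
  refine isRelTwist_jordanian hu ?_ (isPrim_PhiE_mul_Hminus h hF) ((isPrim_deformed h hF).smul ξ)
    ?_ (ext_counit_cst _) ?_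
  · exact constantCoeff_smul constantCoeff_deformed ξ
  · rw [mul_smul_comm, Hminus_mul_deformed, smul_add, smul_mul_assoc]
  · rw [ext_smul, deformed, map_sub, xMinus, ext_counit_smul_X_mul η (ext_counit_cst _), ext_smul,
      map_sum, Finset.sum_eq_zero, smul_zero, sub_zero, smul_zero]
    intro j hj
    rw [map_mul, extE, ext_counit_smul_X_mul η (ext_counit_cst _), zero_mul]

theorem isTwist_link_mul (h : IsPrimOn F k) (hF : IsTwist F) : IsTwist (link hk η ξ * F) := by
  rw [link, mul_assoc, mul_assoc]
  exact (isRelTwist_PhiG h hF.isUnit).isTwist_mul ((isRelTwist_PhiE h hF.isUnit).isTwist_mul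
    ((isRelTwist_PhiJ h hF.isUnit).isTwist_mul hF))

/-- The generators of so(M - 4(k+1)) commute with `H`, `x` of both Jordanian factors and leave the
extension exponent invariant, so none of the three factors changes their coproduct. -/
theorem isPrimOn_link_mul (h : IsPrimOn F k) (hF : IsUnit F) :
    IsPrimOn (link hk η ξ * F) (k + 1) := by
  intro i j hi hi' hj hj'
  -- The index range required at stage k + 1 is exactly the summation range of the invariants of
  -- link `k`.
  have hi'' : i ∈ vecIdx M k := by
    rw [mem_vecIdx]
    omega
  have hj'' : j ∈ vecIdx M k := by
    rw [mem_vecIdx]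
    omega
  have hJ := (isRelTwist_PhiJ (hk := hk) (η := η) h hF).isUnit.mul hF
  have hE := (isRelTwist_PhiE (hk := hk) (η := η) h hF).isUnit.mul hJ
  have h1 : IsPrim (PhiJ hk η * F) (cst K (FullChain.gen K i j)) :=
    isPrim_PhiJ_mul hF (h.gen hi'' hj'') (commute_gen_Hplus hi'' hj'').symm
      (commute_gen_xPlus hi'' hj'').symm
  have h2 : IsPrim (PhiE hk η * (PhiJ hk η * F)) (cst K (FullChain.gen K i j)) := by
    rw [PhiE_eq]
    exact twistedComul_extension_mul_of_commute extensionRelations hJ h1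
      (commute_extension_gen hi'' hj''
        (commute_fexp_smul_sigma (commute_gen_xPlus hi'' hj'').symm _).symm)
  rw [link, mul_assoc, mul_assoc, PhiG_eq]
  exact twistedComul_jordanian_mul_of_commute hE
    (constantCoeff_smul constantCoeff_deformed ξ) h2 (commute_gen_Hminus hi'' hj'').symm
    ((commute_gen_deformed hi'' hj'').smul_right ξ).symm

theorem isTwist_chain (p : ℕ) (hM : 4 * (p + 1) ≤ M) (η ξ : ℕ → K) :
    IsTwist (chain p hM η ξ) ∧ IsPrimOn (chain p hM η ξ) (p + 1) := by
  induction p with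
  | zero =>
    have h1 : IsPrimOn (1 : PowerSeries (U2 K (so K M))) 0 := fun i j _ _ _ _ => isPrim_one_cst _
    have h2 := isTwist_link_mul (hk := hM) (η := η 0) (ξ := ξ 0) h1 isTwist_one
    have h3 := isPrimOn_link_mul (hk := hM) (η := η 0) (ξ := ξ 0) h1 isUnit_one
    rw [mul_one] at h2 h3
    exact ⟨h2, h3⟩
  | succ p ih =>
    obtain ⟨h1, h2⟩ := ih (by omega)
    exact ⟨isTwist_link_mul h2 h1, isPrimOn_link_mul h2 h1.isUnit⟩

end LinkTwist

/-! ### Terms of order zero and one in `h`. -/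

section ClassicalLimit

open PowerSeries

variable {K : Type*} [Field K] {M : ℕ}

theorem coeff_one_C_mul_inr_flog1p {L : Type*} [LieRing L] [LieAlgebra K L] (H : L)
    (x : PowerSeries (U K L)) :
    coeff 1 (PowerSeries.C (inc K L H ⊗ₜ[K] 1) *
      ext Algebra.TensorProduct.includeRight (flog1p K x)) = inc K L H ⊗ₜ[K] coeff 1 x := by
  rw [coeff_C_mul, coeff_map, coeff_one_flog1p]
  simp

theorem tensorInc_wedge {L : Type*} [LieRing L] [LieAlgebra K L] (x y : L) :
    tensorInc (wedge (K := K) x y) =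
      inc K L x ⊗ₜ[K] inc K L y - inc K L y ⊗ₜ[K] inc K L x := by
  rw [tensorInc, wedge, map_sub, TensorProduct.map_tmul, TensorProduct.map_tmul]
  rfl

theorem classicalR_neg (p : ℕ) (hM : 4 * (p + 1) ≤ M) (η ξ : ℕ → K) :
    classicalR p hM (-η) ξ = -classicalR p hM η ξ := by
  simp only [classicalR, Pi.neg_apply, neg_smul, Finset.sum_neg_distrib]

theorem comm_wedge {L : Type*} [LieRing L] [LieAlgebra K L] (x y : L) :
    TensorProduct.comm K L L (wedge (K := K) x y) = -wedge (K := K) x y := by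
  rw [wedge, map_sub, TensorProduct.comm_tmul, TensorProduct.comm_tmul, neg_sub]

theorem comm_classicalR (p : ℕ) (hM : 4 * (p + 1) ≤ M) (η ξ : ℕ → K) :
    TensorProduct.comm K _ _ (classicalR p hM η ξ) = -classicalR p hM η ξ := by
  simp only [classicalR, I12wedge, map_sum, map_smul, map_add, comm_wedge, smul_neg,
    Finset.sum_neg_distrib, ← neg_add]

variable [CharZero K]

theorem coeff_zero_link {k : ℕ} (hk : 4 * (k + 1) ≤ M) (η ξ : K) :
    coeff 0 (link hk η ξ) = 1 := by
  rw [link, coeff_zero_mul', coeff_zero_mul', PhiG, PhiE, PhiJ]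
  simp only [coeff_zero_eq_constantCoeff_apply, constantCoeff_fexp, mul_one]

theorem coeff_zero_chain (p : ℕ) (hM : 4 * (p + 1) ≤ M) (η ξ : ℕ → K) :
    coeff 0 (chain p hM η ξ) = 1 := by
  induction p with
  | zero => exact coeff_zero_link hM _ _
  | succ p ih => rw [chain, coeff_zero_mul', coeff_zero_link, ih, mul_one]

/-- All three factors start with 1, so their linear terms add. The correction I¹ enters only in
order h² and leaves no trace here. -/
theorem coeff_one_link {k : ℕ} (hk : 4 * (k + 1) ≤ M) (η ξ : K) :
    coeff 1 (link hk η ξ) = η • (inc K _ (Hplus K hk) ⊗ₜ[K] inc K _ (Eplus K hk) +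
      ξ • (inc K _ (Hminus K hk) ⊗ₜ[K] inc K _ (Eminus K hk)) + I12 K hk) := by
  have hG : coeff 1 (PhiG hk η ξ) =
      (η * ξ) • (inc K _ (Hminus K hk) ⊗ₜ[K] inc K _ (Eminus K hk)) := by
    rw [PhiG, coeff_one_fexp, coeff_one_C_mul_inr_flog1p, Gminus, coeff_smul, coeff_one_mul']
    simp
  have hE : coeff 1 (PhiE hk η) = η • I12 K hk := by
    rw [PhiE, coeff_one_fexp, coeff_smul, coeff_one_mul', coeff_one_mul', coeff_zero_mul']
    simp [constantCoeff_fexp]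
    rw [← Algebra.TensorProduct.one_def, mul_one]
  have hJ : coeff 1 (PhiJ hk η) = η • (inc K _ (Hplus K hk) ⊗ₜ[K] inc K _ (Eplus K hk)) := by
    rw [PhiJ, coeff_one_fexp, sigma, coeff_one_C_mul_inr_flog1p, coeff_smul, coeff_one_mul']
    simp
  have h0 : ∀ f : PowerSeries (U2 K (so K M)), coeff 0 (fexp K f) = 1 := fun f => by
    rw [coeff_zero_eq_constantCoeff_apply, constantCoeff_fexp]
  have hG0 : coeff 0 (PhiG hk η ξ) = 1 := h0 _
  have hE0 : coeff 0 (PhiE hk η) = 1 := h0 _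
  have hJ0 : coeff 0 (PhiJ hk η) = 1 := h0 _
  rw [link, coeff_one_mul', coeff_one_mul', coeff_zero_mul', hG0, hE0, hJ0, hG, hE, hJ]
  simp only [mul_one, one_mul, smul_add, smul_smul]
  abel

theorem coeff_one_chain (p : ℕ) (hM : 4 * (p + 1) ≤ M) (η ξ : ℕ → K) :
    coeff 1 (chain p hM η ξ) = ∑ k : Fin (p + 1),
      have hk : 4 * ((k : ℕ) + 1) ≤ M := by omega
      coeff 1 (link hk (η k) (ξ k)) := by
  induction p with
  | zero => simp [chain]
  | succ p ih =>
    rw [chain, coeff_one_mul', coeff_zero_link, coeff_zero_chain, mul_one, one_mul, ih]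
    exact (Fin.sum_univ_castSucc fun k : Fin (p + 1 + 1) =>
      coeff 1 (link (show 4 * ((k : ℕ) + 1) ≤ M by omega) (η k) (ξ k))).symm

theorem flip_sub_coeff_one_link {k : ℕ} (hk : 4 * (k + 1) ≤ M) (η ξ : K) :
    flip K _ (coeff 1 (link hk η ξ)) - coeff 1 (link hk η ξ) =
      -tensorInc (η • (wedge (K := K) (Hplus K hk) (Eplus K hk) +
        ξ • wedge (K := K) (Hminus K hk) (Eminus K hk) + I12wedge K hk)) := by
  have hf : ∀ a b : U K (so K M), flip K _ (a ⊗ₜ[K] b) = b ⊗ₜ[K] a := fun a b => by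
    simp [flip]
  have hw : tensorInc (I12wedge K hk) = I12 K hk - flip K _ (I12 K hk) := by
    rw [I12wedge, I12, tensorInc, map_sum, map_sum, ← Finset.sum_sub_distrib]
    refine Finset.sum_congr rfl fun j _ => ?_
    rw [hf]
    exact tensorInc_wedge _ _
  have ha : ∀ r r' : so K M ⊗[K] so K M, tensorInc (r + r') = tensorInc r + tensorInc r' :=
    fun r r' => map_add _ r r'
  have hs : ∀ (c : K) (r : so K M ⊗[K] so K M), tensorInc (c • r) = c • tensorInc r :=
    fun c r => map_smul _ c r
  rw [coeff_one_link, hs, ha, ha, hs, hw, tensorInc_wedge, tensorInc_wedge]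
  simp only [map_smul, map_add, hf, smul_add, smul_sub]
  abel

theorem flip_sub_coeff_one_chain (p : ℕ) (hM : 4 * (p + 1) ≤ M) (η ξ : ℕ → K) :
    flip K _ (coeff 1 (chain p hM η ξ)) - coeff 1 (chain p hM η ξ) =
      tensorInc (-classicalR p hM η ξ) := by
  rw [coeff_one_chain, map_sum, ← Finset.sum_sub_distrib, classicalR, tensorInc, map_neg, map_sum,
    ← Finset.sum_neg_distrib]
  exact Finset.sum_congr rfl fun k _ => flip_sub_coeff_one_link _ (η k) (ξ k)

theorem rMatrixQuantizes_chain (p : ℕ) (hM : 4 * (p + 1) ≤ M) (η ξ : ℕ → K) :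
    RMatrixQuantizes (chain p hM η ξ) (-classicalR p hM η ξ) :=
  (isTwist_chain p hM η ξ).1.rMatrixQuantizes (coeff_zero_chain p hM η ξ)
    (flip_sub_coeff_one_chain p hM η ξ)

end ClassicalLimit

end FullChain

end

theorem mainTheorem2 (K : Type*) [Field K] [CharZero K] (M p : ℕ) (hM : 4 * (p + 1) ≤ M)
    (η ξ : ℕ → K) :
    FullChain.IsTwist (FullChain.chain p hM η ξ) ∧
    FullChain.IsClassicalRMatrix (FullChain.classicalR p hM η ξ) ∧
    FullChain.RMatrixQuantizes (FullChain.chain p hM η ξ) (-FullChain.classicalR p hM η ξ) ∧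
    FullChain.RMatrixQuantizes (FullChain.chain p hM (-η) ξ) (FullChain.classicalR p hM η ξ) := by
  -- The sign change makes `r` itself the linear term of an R-matrix, from which `h.cybe` reads off
  -- the classical equation.
  have h := FullChain.rMatrixQuantizes_chain p hM (-η) ξ
  rw [FullChain.classicalR_neg, neg_neg] at h
  exact ⟨(FullChain.isTwist_chain p hM η ξ).1, ⟨FullChain.comm_classicalR p hM η ξ, h.cybe⟩,
    FullChain.rMatrixQuantizes_chain p hM η ξ, h⟩
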